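/- Let $M$ be a smooth $m$-manifold without boundary (Hausdorff and second countable). **Divisors.** A real divisor on a manifold $N$ is a smooth real line bundle $R\to N$ with a smooth section $q$ whose zero set is nowhere dense; for $U\subseteq N$ open, $I_q(U)\subseteq C^\infty(U)$ is the image of $\Gamma(U,R^*)\to C^\infty(U)$, $\alpha\mapsto\alpha(q)$. It is *smooth elliptic* if $D=q^{-1}(0)$ is an embedded submanifold of codimension $2$ consisting of critical points of $q$, along which the normal Hessian $\mathrm{Hess}^\nu q\in\Gamma(\mathrm{Sym}^2N^*D\otimes R)$ is definite. A real divisor $(R,q)$ on $M$ is *elliptic* if every $p\in M$ has an open neighbourhood $U$ with $I_q(U)=I_1\cdots I_j$ (where $j\ge 0$, and the empty product is $C^\infty(U)$), the $I_i$ being the ideals of smooth elliptic divisors on $U$ whose vanishing loci $D_1,\dots,D_j$ intersect transversely, i.e. $T_xM\to\bigoplus_{i:\,x\in D_i}T_xM/T_xD_i$ is onto for all $x\in U$. Such $I_1,\dots,I_j$ are called local normal crossing divisors on $U$. The intersection number of $p$ is the least $j$ that occurs for neighbourhoods of $p$; the intersection number of the divisor is the maximum of these numbers over $p\in M$; $D[j]$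 is the set of points of intersection number $j$. **Statement.** Let $(R,q)$ be an elliptic divisor on $M$ with intersection number $n$. Let $(O(2)\times\mathbb R_+)^n\rtimes S_n$, where $S_n$ permutes the factors, act on $(\mathbb R^2)^n$ by rotations/reflections and positive scalings in each plane and by permutations of the planes. Then: 1. $D[n]$ is an embedded submanifold of $M$ of codimension $2n$, and the action just described is faithful, so $(O(2)\times\mathbb R_+)^n\rtimes S_n$ is identified with a subgroup $H\subset GL(2n,\mathbb R)$. 2. For $x\in D[n]$, let $P_x$ be the set of all frames $(u_{1,1},u_{1,2},\dots,u_{n,1},u_{n,2})$ of $N_xD[n]=T_xM/T_xD[n]$ for which there are an open neighbourhood $U$ of $x$, local normal crossing divisors $I_1,\dots,I_n$ on $U$ (in some order), with vanishing loci $D_i$, and non-negative functions $f_i\in C^\infty(U)$ with $I_i=\langle f_i\rangle$, such that, under $N_xD[n]\cong\bigoplus_iN_xD_i$, the pair $(u_{i,1},u_{i,2})$ is a frame of $N_xD_i$ orthonormal for $\mathrm{Hess}^\nu f_i$, for every $i$. Then $P=\bigsqcup_xP_x$ is a reduction of the structure group of the normal bundle $ND[n]$ to $H$: each $P_x$ is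 a single (non-empty) $H$-orbit of frames, and around each point of $D[n]$ there is a smooth local frame of $ND[n]$ with values in $P$. 3. The reduction does not depend on choices: for each $x\in D[n]$ and each choice of $U$, $I_1,\dots,I_n$ and $f_1,\dots,f_n$ as in (2), there is a frame $u$ of $N_xD[n]$ that is orthonormal in the above sense for this choice, and $P_x=u\cdot H$. -/

import Mathlib

open Set Topology Bundle
open scoped Manifold ContDiff

universe u v

noncomputable section

/-! ### Embedded submanifolds, tangent and normal spaces, Hessians

`N` is a manifold modelled on `ℝ^m`. -/

section Submanifolds

variable {m : ℕ} {N : Type u} [TopologicalSpace N] [ChartedSpace (EuclideanSpace ℝ (Fin m)) N]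

/-- `S` is an embedded submanifold of codimension `k`: around each of its points it is the zero
set of a smooth submersion to `ℝ^k`. -/
def IsEmbeddedSubmanifold (m : ℕ) {N : Type u} [TopologicalSpace N]
    [ChartedSpace (EuclideanSpace ℝ (Fin m)) N] (S : Set N) (k : ℕ) : Prop :=
  ∀ x ∈ S, ∃ (V : Set N) (F : N → EuclideanSpace ℝ (Fin k)), IsOpen V ∧ x ∈ V ∧
    ContMDiffOn (𝓡 m) (𝓡 k) ∞ F V ∧
    (∀ y ∈ V, Function.Surjective (mfderiv (𝓡 m) (𝓡 k) F y)) ∧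
    S ∩ V = {y ∈ V | F y = 0}

/-- The tangent space `T_x S ⊆ T_x N` of a submanifold `S` at `x ∈ S`: the vectors annihilated by
the differentials of all smooth functions that vanish along `S` near `x`. -/
def tangentSpaceOf (m : ℕ) {N : Type u} [TopologicalSpace N]
    [ChartedSpace (EuclideanSpace ℝ (Fin m)) N] (S : Set N) (x : N) :
    Submodule ℝ (TangentSpace (𝓡 m) x) where
  carrier := {w | ∀ f : N → ℝ, ContMDiffAt (𝓡 m) 𝓘(ℝ, ℝ) ∞ f x →
    (∀ᶠ y in 𝓝 x, y ∈ S → f y = 0) → mfderiv (𝓡 m) 𝓘(ℝ, ℝ) f x w = 0}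
  add_mem' := by
    intro a b ha hb f hf h0
    rw [map_add, ha f hf h0, hb f hf h0, add_zero]
  zero_mem' := by
    intro f _ _
    rw [map_zero]
  smul_mem' := by
    intro c a ha f hf h0
    rw [map_smul, ha f hf h0, smul_zero]

/-- The normal space `N_x S = T_x N / T_x S`, the fibre at `x ∈ S` of the normal bundle of `S`. -/
abbrev NormalFibre (m : ℕ) {N : Type u} [TopologicalSpace N]
    [ChartedSpace (EuclideanSpace ℝ (Fin m)) N] (S : Set N) (x : N) : Type :=
  TangentSpace (𝓡 m) x ⧸ tangentSpaceOf m S x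

/-- The Hessian of `f` at `x`, computed in the chart that Mathlib uses to identify `T_x N` with
`ℝ^m`. It is used only at critical points of `f`, where it does not depend on the chart. -/
def hessianAt (m : ℕ) {N : Type u} [TopologicalSpace N]
    [ChartedSpace (EuclideanSpace ℝ (Fin m)) N] (f : N → ℝ) (x : N) :
    TangentSpace (𝓡 m) x →L[ℝ] TangentSpace (𝓡 m) x →L[ℝ] ℝ :=
  fderiv ℝ (fderiv ℝ (f ∘ (extChartAt (𝓡 m) x).symm)) (extChartAt (𝓡 m) x x)

end Submanifolds

/-! ### Real divisors and elliptic divisors -/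

/-- A real divisor on `N`: a smooth real line bundle `R` with a smooth section `q` whose zero set
is nowhere dense. -/
structure RealDivisor (m : ℕ) (N : Type u) [TopologicalSpace N]
    [ChartedSpace (EuclideanSpace ℝ (Fin m)) N] where
  R : N → Type v
  [addCommGroupR : ∀ x, AddCommGroup (R x)]
  [moduleR : ∀ x, Module ℝ (R x)]
  [topologicalSpaceR : ∀ x, TopologicalSpace (R x)]
  [topologicalSpaceTotal : TopologicalSpace (TotalSpace ℝ R)]
  [fiberBundle : FiberBundle ℝ R]
  [vectorBundle : VectorBundle ℝ ℝ R]
  [contMDiffVectorBundle : ContMDiffVectorBundle ∞ ℝ R (𝓡 m)]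
  q : ∀ x, R x
  contMDiff_q : ContMDiff (𝓡 m) ((𝓡 m).prod 𝓘(ℝ, ℝ)) ∞ (fun x => TotalSpace.mk' ℝ x (q x))
  isNowhereDense_zeros : IsNowhereDense {x | q x = 0}

namespace RealDivisor

attribute [instance] addCommGroupR moduleR topologicalSpaceR topologicalSpaceTotal fiberBundle
  vectorBundle contMDiffVectorBundle

section

variable {m : ℕ} {N : Type u} [TopologicalSpace N] [ChartedSpace (EuclideanSpace ℝ (Fin m)) N]

/-- The vanishing locus `q⁻¹(0)`. -/
def locus (δ : RealDivisor.{u, v} m N) : Set N := {x | δ.q x = 0}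

/-- `α` is a section of the dual bundle `R^*` that is smooth on `s`. -/
def IsSmoothDualOn (δ : RealDivisor.{u, v} m N) (s : Set N) (α : ∀ x, δ.R x →L[ℝ] ℝ) : Prop :=
  ContMDiffOn (𝓡 m) ((𝓡 m).prod 𝓘(ℝ, ℝ →L[ℝ] ℝ)) ∞
    (fun x => TotalSpace.mk' (ℝ →L[ℝ] ℝ)
      (E := fun y : N => δ.R y →L[ℝ] Bundle.Trivial N ℝ y) x (α x)) s

theorem IsSmoothDualOn.add {δ : RealDivisor.{u, v} m N} {s : Set N}
    {α β : ∀ x, δ.R x →L[ℝ] ℝ} (hα : δ.IsSmoothDualOn s α) (hβ : δ.IsSmoothDualOn s β) :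
    δ.IsSmoothDualOn s (fun x => α x + β x) :=
  ContMDiffOn.add_section (V := fun y : N => δ.R y →L[ℝ] Bundle.Trivial N ℝ y) hα hβ

theorem IsSmoothDualOn.smul {δ : RealDivisor.{u, v} m N} {s : Set N} {f : N → ℝ}
    {α : ∀ x, δ.R x →L[ℝ] ℝ} (hf : ContMDiffOn (𝓡 m) 𝓘(ℝ, ℝ) ∞ f s)
    (hα : δ.IsSmoothDualOn s α) : δ.IsSmoothDualOn s (fun x => f x • α x) :=
  ContMDiffOn.smul_section (V := fun y : N => δ.R y →L[ℝ] Bundle.Trivial N ℝ y) hf hα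

theorem isSmoothDualOn_zero (δ : RealDivisor.{u, v} m N) (s : Set N) :
    δ.IsSmoothDualOn s (fun _ => 0) :=
  (contMDiff_zeroSection ℝ (fun y : N => δ.R y →L[ℝ] Bundle.Trivial N ℝ y)).contMDiffOn

/-- The ideal `I_q ⊆ C^∞(N)`: the image of `q : Γ(R^*) → C^∞(N)`, `α ↦ α(q)`. -/
def ideal (δ : RealDivisor.{u, v} m N) : Ideal C^∞⟮𝓡 m, N; 𝓘(ℝ, ℝ), ℝ⟯ where
  carrier := {g | ∃ α : ∀ x, δ.R x →L[ℝ] ℝ, δ.IsSmoothDualOn univ α ∧ ∀ x, g x = α x (δ.q x)}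
  add_mem' := by
    rintro a b ⟨α, hα, ha⟩ ⟨β, hβ, hb⟩
    exact ⟨_, hα.add hβ, fun x => by simp [ha, hb]⟩
  zero_mem' := ⟨_, δ.isSmoothDualOn_zero univ, fun x => by simp⟩
  smul_mem' := by
    rintro c a ⟨α, hα, ha⟩
    exact ⟨_, hα.smul c.contMDiff.contMDiffOn, fun x => by simp [ha]⟩

/-- The ideal `I_q(U) ⊆ C^∞(U)` over an open set `U`: the image of
`q : Γ(U, R^*) → C^∞(U)`, `α ↦ α(q)`. -/
def idealOn (δ : RealDivisor.{u, v} m N) (U : TopologicalSpace.Opens N) :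
    Ideal C^∞⟮𝓡 m, U; 𝓘(ℝ, ℝ), ℝ⟯ where
  carrier := {g | ∃ α : ∀ x, δ.R x →L[ℝ] ℝ, δ.IsSmoothDualOn U α ∧
    ∀ x : U, g x = α x (δ.q x)}
  add_mem' := by
    rintro a b ⟨α, hα, ha⟩ ⟨β, hβ, hb⟩
    exact ⟨_, hα.add hβ, fun x => by simp [ha, hb]⟩
  zero_mem' := ⟨_, δ.isSmoothDualOn_zero U, fun x => by simp⟩
  smul_mem' := by
    classical
    rintro c a ⟨α, hα, ha⟩
    let f : N → ℝ := fun x => if h : x ∈ U then c ⟨x, h⟩ else 0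
    have hf : ContMDiffOn (𝓡 m) 𝓘(ℝ, ℝ) ∞ f U := by
      intro x hx
      have h1 : (fun y : U => f y) = c := by
        funext y
        simp [f]
      have h2 : ContMDiffAt (𝓡 m) 𝓘(ℝ, ℝ) ∞ (fun y : U => f y) (⟨x, hx⟩ : U) := by
        rw [h1]
        exact c.contMDiff.contMDiffAt
      exact (contMDiffAt_subtype_iff.1 h2).contMDiffWithinAt
    exact ⟨_, hα.smul hf, fun x => by simp [ha, f]⟩

/-- The section `q` read in a local trivialisation of `R` around `x`. -/
def localRep (δ : RealDivisor.{u, v} m N) (x : N) : N → ℝ :=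
  fun y => (trivializationAt ℝ δ.R x (TotalSpace.mk' ℝ y (δ.q y))).2

/-- A smooth elliptic divisor: the vanishing locus `D = q⁻¹(0)` is an embedded submanifold of
codimension two, consisting of critical points of `q`, along which the normal Hessian
`Hess^ν q ∈ Γ(Sym² N^*D ⊗ R)` is definite, that is, positive definite for one of the two
orientations of the line `R_x`. -/
def IsSmoothElliptic (δ : RealDivisor.{u, v} m N) : Prop :=
  IsEmbeddedSubmanifold m δ.locus 2 ∧
  ∀ x ∈ δ.locus, mfderiv (𝓡 m) 𝓘(ℝ, ℝ) (δ.localRep x) x = 0 ∧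
    ((∀ w ∉ tangentSpaceOf m δ.locus x, 0 < hessianAt m (δ.localRep x) x w w) ∨
      (∀ w ∉ tangentSpaceOf m δ.locus x, hessianAt m (δ.localRep x) x w w < 0))

/-- The vanishing loci `D_1, …, D_j` of a family of divisors intersect transversely: at each point
`x` the map `T_x N → ⨁ T_x N / T_x D_i`, the sum being over the `i` with `x ∈ D_i`, is onto. -/
def TransverseLoci {j : ℕ} (ε : Fin j → RealDivisor.{u, v} m N) : Prop :=
  ∀ (x : N) (w : Fin j → TangentSpace (𝓡 m) x), ∃ z : TangentSpace (𝓡 m) x,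
    ∀ i, x ∈ (ε i).locus → z - w i ∈ tangentSpaceOf m (ε i).locus x

/-- `ε_1, …, ε_j` is a choice of local normal crossing divisors for `δ` over `U`: smooth elliptic
divisors on `U` with transversely intersecting vanishing loci and `I_q(U) = I_1 ⋯ I_j`. -/
def IsLocalNormalCrossing (δ : RealDivisor.{u, v} m N) (U : TopologicalSpace.Opens N) {j : ℕ}
    (ε : Fin j → RealDivisor.{u, 0} m U) : Prop :=
  (∀ i, (ε i).IsSmoothElliptic) ∧ TransverseLoci ε ∧ δ.idealOn U = ∏ i, (ε i).ideal

/-- `p` has a neighbourhood over which `δ` is a normal crossing of `j` smooth elliptic divisors. -/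
def HasNormalCrossing (δ : RealDivisor.{u, v} m N) (p : N) (j : ℕ) : Prop :=
  ∃ U : TopologicalSpace.Opens N, p ∈ U ∧
    ∃ ε : Fin j → RealDivisor.{u, 0} m U, δ.IsLocalNormalCrossing U ε

/-- A (self-crossing) elliptic divisor. -/
def IsElliptic (δ : RealDivisor.{u, v} m N) : Prop :=
  ∀ p : N, ∃ j : ℕ, δ.HasNormalCrossing p j

/-- The intersection number of the point `p`. -/
def pointIntersectionNumber (δ : RealDivisor.{u, v} m N) (p : N) : ℕ :=
  sInf {j | δ.HasNormalCrossing p j}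

/-- The intersection number of the divisor `δ`, the maximum of those of the points, is `n`. -/
def HasIntersectionNumber (δ : RealDivisor.{u, v} m N) (n : ℕ) : Prop :=
  IsGreatest (range δ.pointIntersectionNumber) n

/-- `D(j)`: the points of intersection number at least `j`. -/
def filtration (δ : RealDivisor.{u, v} m N) (j : ℕ) : Set N :=
  {p | j ≤ δ.pointIntersectionNumber p}

/-- The stratum `D[j] = D(j) \ D(j + 1)`. -/
def stratum (δ : RealDivisor.{u, v} m N) (j : ℕ) : Set N :=
  δ.filtration j \ δ.filtration (j + 1)

end

end RealDivisor

/-! ### The structure group -/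

/-- The group `O(2) × ℝ_+`. -/
abbrev ConformalGroupTwo : Type := Matrix.orthogonalGroup (Fin 2) ℝ × {r : ℝ // 0 < r}

/-- The group `(O(2) × ℝ_+)^n ⋊ S_n`, where `S_n` permutes the factors. -/
abbrev WreathConformal (n : ℕ) : Type :=
  (Fin n → ConformalGroupTwo) ⋊[mulAutArrow] Equiv.Perm (Fin n)

/-- The matrix of `((O_i, r_i)_i, σ)`: it maps the `j`-th plane of `(ℝ²)^n` to the `σ j`-th plane
by `r_{σ j} O_{σ j}`. -/
def wreathMatrix {n : ℕ} (g : WreathConformal n) :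
    Matrix (Fin n × Fin 2) (Fin n × Fin 2) ℝ :=
  fun p q => if p.1 = g.right q.1 then
    ((g.left p.1).2 : ℝ) * ((g.left p.1).1 : Matrix (Fin 2) (Fin 2) ℝ) p.2 q.2 else 0

theorem wreath_mul_left {n : ℕ} (g h : WreathConformal n) (i : Fin n) :
    (g * h).left i = g.left i * h.left (g.right.symm i) := rfl

theorem wreathMatrix_apply {n : ℕ} (g : WreathConformal n) (i j : Fin n) (a b : Fin 2) :
    wreathMatrix g (i, a) (j, b) = if i = g.right j then
      ((g.left i).2 : ℝ) * ((g.left i).1 : Matrix (Fin 2) (Fin 2) ℝ) a b else 0 := rfl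

theorem wreathMatrix_one (n : ℕ) : wreathMatrix (1 : WreathConformal n) = 1 := by
  ext ⟨i, a⟩ ⟨j, b⟩
  rw [wreathMatrix_apply, Matrix.one_apply]
  by_cases h : i = j <;> simp [h, Matrix.one_apply]

theorem wreathMatrix_mul {n : ℕ} (g h : WreathConformal n) :
    wreathMatrix (g * h) = wreathMatrix g * wreathMatrix h := by
  ext ⟨i, a⟩ ⟨j, b⟩
  rw [Matrix.mul_apply, Fintype.sum_prod_type, Finset.sum_eq_single (h.right j)]
  · by_cases hi : i = g.right (h.right j)
    · simp only [wreathMatrix_apply, wreath_mul_left, hi, SemidirectProduct.mul_right,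
        Equiv.Perm.mul_apply, if_true, Equiv.symm_apply_apply, Prod.fst_mul, Prod.snd_mul,
        Submonoid.coe_mul, Matrix.mul_apply, Finset.mul_sum, Positive.val_mul]
      refine Finset.sum_congr rfl fun c _ => ?_
      ring
    · simp [wreathMatrix_apply, hi]
  · intro k _ hk
    simp [wreathMatrix_apply, hk]
  · simp

/-- `(O(2) × ℝ_+)^n ⋊ S_n` as a group of matrices of size `2n`. -/
def wreathHom (n : ℕ) : WreathConformal n →* GL (Fin n × Fin 2) ℝ :=
  MonoidHom.toHomUnits
    { toFun := wreathMatrix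
      map_one' := wreathMatrix_one n
      map_mul' := wreathMatrix_mul }

/-! ### Reductions of the structure group of a normal bundle -/

section Reduction

variable {m : ℕ} {M : Type u} [TopologicalSpace M] [ChartedSpace (EuclideanSpace ℝ (Fin m)) M]
  [IsManifold (𝓡 m) ∞ M]

/-- The right action of `GL` on frames, as a relation: `w = u · g`, that is,
`w_j = ∑ i, g_{ij} u_i`. -/
def IsFrameTranslate {ι E : Type*} [Fintype ι] [DecidableEq ι] [AddCommGroup E] [Module ℝ E]
    (u : Module.Basis ι ℝ E) (g : GL ι ℝ) (w : Module.Basis ι ℝ E) : Prop :=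
  ∀ j, w j = ∑ i, (g : Matrix ι ι ℝ) i j • u i

/-- `P`, a set of frames in each normal space of the embedded submanifold `S`, is a reduction of
the structure group of the normal bundle `NS` to the group `H` of matrices, i.e. a principal
`H`-subbundle of the frame bundle of `NS`: each `P_x` is a single `H`-orbit of frames, and around
each point of `S` there is a smooth local frame of `NS` with values in `P`. A smooth local frame of
`NS` is given by smooth local vector fields on `M`, taken along `S` and modulo `TS`. -/
def IsStructureGroupReduction (S : Set M) {ι : Type} [Fintype ι] [DecidableEq ι]
    (H : Subgroup (GL ι ℝ)) (P : ∀ x : M, Set (Module.Basis ι ℝ (NormalFibre m S x))) : Prop :=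
  (∀ x ∈ S, (P x).Nonempty) ∧
  (∀ x ∈ S, ∀ u ∈ P x, ∀ w, w ∈ P x ↔ ∃ g ∈ H, IsFrameTranslate u g w) ∧
  (∀ x ∈ S, ∃ (V : Set M) (s : ι → ∀ y : M, TangentSpace (𝓡 m) y), IsOpen V ∧ x ∈ V ∧
    (∀ i, ContMDiffOn (𝓡 m) (𝓡 m).tangent ∞
      (fun y => (⟨y, s i y⟩ : TangentBundle (𝓡 m) M)) V) ∧
    ∀ y ∈ S ∩ V, ∃ w ∈ P y, ∀ i, w i = (tangentSpaceOf m S y).mkQ (s i y))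

end Reduction

/-! ### The frames adapted to an elliptic divisor -/

namespace RealDivisor

section

variable {m : ℕ} {M : Type u} [TopologicalSpace M] [ChartedSpace (EuclideanSpace ℝ (Fin m)) M]

/-- A choice at `x` of the local data: local normal crossing divisors `I_1, …, I_n` for `δ` over an
open neighbourhood `U` of `x`, and non-negative functions `f_i` on `U` with `I_i = ⟨f_i⟩`. -/
structure LocalChoice (δ : RealDivisor.{u, v} m M) (n : ℕ) (x : M) where
  U : TopologicalSpace.Opens M
  mem : x ∈ U
  ε : Fin n → RealDivisor.{u, 0} m U
  isLocalNormalCrossing : δ.IsLocalNormalCrossing U ε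
  f : Fin n → C^∞⟮𝓡 m, U; 𝓘(ℝ, ℝ), ℝ⟯
  nonneg : ∀ i y, 0 ≤ f i y
  ideal_eq : ∀ i, (ε i).ideal = Ideal.span {f i}

/-- The frame `u = (u_{i,1}, u_{i,2})_i` of the normal space `N_x S` is adapted to the choice `c`:
under `N_x S ≃ ⨁_i N_x D_i` the pair `(u_{i,1}, u_{i,2})` is an orthonormal frame of the summand
`N_x D_i` for the normal Hessian of `f_i`. The vectors `z p` are lifts of the `u p` to `T_x U`; that
`u_{i,a}` lies in the `i`-th summand means that its lift is tangent to `D_k` for all `k ≠ i`. -/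
def LocalChoice.IsAdapted {δ : RealDivisor.{u, v} m M} {n : ℕ} {x : M}
    (c : δ.LocalChoice n x) {S : Set M}
    (u : Module.Basis (Fin n × Fin 2) ℝ (NormalFibre m S x)) : Prop :=
  ∃ z : Fin n × Fin 2 → TangentSpace (𝓡 m) (⟨x, c.mem⟩ : c.U),
    (∀ p, u p = (tangentSpaceOf m S x).mkQ
      (mfderiv (𝓡 m) (𝓡 m) (Subtype.val : c.U → M) ⟨x, c.mem⟩ (z p))) ∧
    (∀ i k, k ≠ i → ∀ a, z (i, a) ∈ tangentSpaceOf m (c.ε k).locus ⟨x, c.mem⟩) ∧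
    (∀ i a b, hessianAt m (c.f i) ⟨x, c.mem⟩ (z (i, a)) (z (i, b)) = if a = b then 1 else 0)

/-- The frames of the normal bundle of the stratum `D[n]` adapted to some choice of local normal
crossing divisors, in any order, and of non-negative generators of their ideals. -/
def adaptedFrames (δ : RealDivisor.{u, v} m M) (n : ℕ) (x : M) :
    Set (Module.Basis (Fin n × Fin 2) ℝ (NormalFibre m (δ.stratum n) x)) :=
  {u | ∃ c : δ.LocalChoice n x, c.IsAdapted u}

end

end RealDivisor

end

/-! Everything is read off from the leading term of `q` at a point of the stratum. Near `x` the
section `q`, in a trivialisation, is a nowhere vanishing function times the product of local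
representatives of the crossing divisors (`IsLocalNormalCrossing.associated`). A divisor that misses
`x` contributes only a unit and can be dropped, so in a crossing by the least number `n` of divisors
all of them pass through `x`. Each of the factors then vanishes to second order at `x`, and along a
straight line `t ↦ x + t v` in a chart `q / t ^ (2 * n)` tends to a nonzero constant times `∏ i,
Hess f_i (v, v)` (`IsLocalNormalCrossing.tendsto_chartLine`).

The order of vanishing determines `n`, so over the domain of a crossing by `n` divisors the stratum
is the intersection of all `n` loci; by transversality this is the zero set of a submersion to
`(ℝ²)^n`.

The leading coefficient determines the product of the normal Hessians up to a constant. Its zero set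
is the union of the `T_x D_i`. A subspace covered by finitely many subspaces lies in one of them,
and the `T_x D_i` are pairwise incomparable, so they are determined up to a permutation. Evaluating
on `v + e`, with `e` fixed and `v` in one summand, recovers each Hessian on its summand up to a
positive factor (`IsOrthonormalLift.exists_perm`). Hence two adapted frames differ by a permutation
of the planes and a conformal map of each plane. Conversely, every such change is realised by
permuting the divisors and rescaling the `f_i`.

Non-negative generators exist because a function with the first and second order behaviour of
Morse–Bott type is semidefinite near its critical manifold. Smooth adapted frames come from a smooth
right inverse of the joint differential of defining submersions, followed by Gram–Schmidt for the
Hessians. -/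

open Filter

/-! ### Second-order calculus at critical points and along zero sets of submersions. -/

section Calculus

variable {E : Type*} [NormedAddCommGroup E] [NormedSpace ℝ E]

theorem ContDiffAt.eventually_hasFDerivAt {F : Type*} [NormedAddCommGroup F] [NormedSpace ℝ F]
    {f : E → F} {p : E} {k : ℕ} (hf : ContDiffAt ℝ k f p) (hk : 1 ≤ k) :
    ∀ᶠ y in 𝓝 p, HasFDerivAt f (fderiv ℝ f y) y := by
  filter_upwards [hf.eventually (by simp)] with y hy
  exact (hy.differentiableAt (by simp; omega)).hasFDerivAt

theorem ContDiffAt.hasFDerivAt_fderiv {F : Type*} [NormedAddCommGroup F] [NormedSpace ℝ F]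
    {f : E → F} {p : E} (hf : ContDiffAt ℝ 2 f p) :
    HasFDerivAt (fderiv ℝ f) (fderiv ℝ (fderiv ℝ f) p) p :=
  ((hf.fderiv_right (m := 1) (by norm_num)).differentiableAt (by simp)).hasFDerivAt

/-- The second order Taylor expansion at a critical zero along a line. -/
theorem tendsto_div_sq_of_critical {f : E → ℝ} {p : E} (hf : ContDiffAt ℝ 2 f p)
    (h0 : f p = 0) (h1 : fderiv ℝ f p = 0) (v : E) :
    Tendsto (fun t : ℝ => f (p + t • v) / t ^ 2) (𝓝[≠] 0)
      (𝓝 (fderiv ℝ (fderiv ℝ f) p v v / 2)) := by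
  have hline : ∀ t : ℝ, HasDerivAt (fun t : ℝ => p + t • v) v t := fun t => by
    simpa using ((hasDerivAt_id t).smul_const v).const_add p
  have hcont : Tendsto (fun t : ℝ => p + t • v) (𝓝 0) (𝓝 p) := by
    simpa using (hline 0).continuousAt.tendsto
  have hD : ∀ᶠ t : ℝ in 𝓝 0, HasDerivAt (fun t : ℝ => f (p + t • v))
      (fderiv ℝ f (p + t • v) v) t := by
    filter_upwards [hcont.eventually (hf.eventually_hasFDerivAt (k := 2) (by norm_num))] with t ht
    exact ht.comp_hasDerivAt t (hline t)
  have hD2 : HasDerivAt (fun t : ℝ => fderiv ℝ f (p + t • v) v)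
      (fderiv ℝ (fderiv ℝ f) p v v) 0 := by
    have h := hf.hasFDerivAt_fderiv
    have h' : HasFDerivAt (fderiv ℝ f) (fderiv ℝ (fderiv ℝ f) p) (p + (0 : ℝ) • v) := by simpa
    have h2 : HasDerivAt (fun t : ℝ => fderiv ℝ f (p + t • v)) (fderiv ℝ (fderiv ℝ f) p v) 0 :=
      h'.comp_hasDerivAt (0 : ℝ) (hline 0)
    exact (ContinuousLinearMap.apply ℝ ℝ v).hasFDerivAt.comp_hasDerivAt (0 : ℝ) h2
  -- After one application of L'Hôpital's rule the quotient is half the difference quotient at `0`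
  -- of the first derivative along the line, because that derivative vanishes at `0`.
  refine HasDerivAt.lhopital_zero_nhdsNE (f' := fun t => fderiv ℝ f (p + t • v) v)
    (g' := fun t => 2 * t) (hD.filter_mono nhdsWithin_le_nhds) ?_ ?_ ?_ ?_ ?_
  · exact Eventually.of_forall fun t => by simpa using hasDerivAt_pow 2 t
  · filter_upwards [self_mem_nhdsWithin] with t ht
    simpa using ht
  · have := (hD.self_of_nhds).continuousAt.tendsto
    simp only [zero_smul, add_zero, h0] at this
    exact this.mono_left nhdsWithin_le_nhds
  · have : Tendsto (fun t : ℝ => t ^ 2) (𝓝 0) (𝓝 (0 ^ 2)) := (continuous_pow 2).tendsto 0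
    simp only [ne_eq, OfNat.ofNat_ne_zero, not_false_eq_true, zero_pow] at this
    exact this.mono_left nhdsWithin_le_nhds
  · have h := (hasDerivAt_iff_tendsto_slope.1 hD2).div_const 2
    refine h.congr' ?_
    filter_upwards [self_mem_nhdsWithin] with t ht
    have ht : t ≠ 0 := ht
    simp [slope_def_field, h1]
    field_simp

/-- At a critical point of `g` the second derivative of `g ∘ ψ` is the pullback of that of `g`. -/
theorem fderiv_fderiv_comp_of_critical {E' : Type*} [NormedAddCommGroup E'] [NormedSpace ℝ E']
    {g : E' → ℝ} {ψ : E → E'} {p : E} (hg : ContDiffAt ℝ 2 g (ψ p)) (hψ : ContDiffAt ℝ 2 ψ p)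
    (h1 : fderiv ℝ g (ψ p) = 0) (w w' : E) :
    fderiv ℝ (fderiv ℝ (g ∘ ψ)) p w w' =
      fderiv ℝ (fderiv ℝ g) (ψ p) (fderiv ℝ ψ p w) (fderiv ℝ ψ p w') := by
  have he : fderiv ℝ (g ∘ ψ) =ᶠ[𝓝 p] fun y => (fderiv ℝ g (ψ y)).comp (fderiv ℝ ψ y) := by
    filter_upwards [hψ.continuousAt.eventually (hg.eventually_hasFDerivAt (k := 2) (by norm_num)),
      hψ.eventually_hasFDerivAt (k := 2) (by norm_num)] with y h2 h3
    exact (h2.comp y h3).fderiv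
  have h2 : HasFDerivAt (fun y => fderiv ℝ g (ψ y))
      ((fderiv ℝ (fderiv ℝ g) (ψ p)).comp (fderiv ℝ ψ p)) p :=
    hg.hasFDerivAt_fderiv.comp p (hψ.differentiableAt (by simp)).hasFDerivAt
  rw [he.fderiv_eq, (h2.clm_comp hψ.hasFDerivAt_fderiv).fderiv, h1]
  simp only [add_apply, ContinuousLinearMap.comp_apply,
    ContinuousLinearMap.compL_apply, ContinuousLinearMap.flip_apply,
    zero_apply, zero_add]

/-- In the Leibniz rule every term carrying `g p` or `fderiv ℝ g p` drops out. This is why a change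
of trivialisation or of generator only rescales the Hessian. -/
theorem fderiv_mul_of_critical {f u g : E → ℝ} {p : E} (hu : ContDiffAt ℝ 2 u p)
    (hg : ContDiffAt ℝ 2 g p) (h0 : g p = 0) (h1 : fderiv ℝ g p = 0)
    (hf : ∀ᶠ y in 𝓝 p, f y = u y * g y) :
    fderiv ℝ f p = 0 ∧ fderiv ℝ (fderiv ℝ f) p = u p • fderiv ℝ (fderiv ℝ g) p := by
  have he : fderiv ℝ f =ᶠ[𝓝 p] fun y => u y • fderiv ℝ g y + g y • fderiv ℝ u y := by
    filter_upwards [hf.eventually_nhds, hu.eventually_hasFDerivAt (k := 2) (by norm_num),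
      hg.eventually_hasFDerivAt (k := 2) (by norm_num)] with y h2 h3 h4
    exact ((h3.mul h4).congr_of_eventuallyEq h2).fderiv
  refine ⟨by simp [he.self_of_nhds, h0, h1], ?_⟩
  have hu' := (hu.differentiableAt (by simp)).hasFDerivAt
  have hg' := (hg.differentiableAt (by simp)).hasFDerivAt
  rw [he.fderiv_eq, HasFDerivAt.fderiv (HasFDerivAt.fun_add (hu'.fun_smul hg.hasFDerivAt_fderiv)
    (hg'.fun_smul hu.hasFDerivAt_fderiv))]
  ext v w
  simp [h0, h1]

/-- A function that vanishes on the zero set of a submersion has differential zero on the kernel of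
the differential of the submersion. -/
theorem HasStrictFDerivAt.apply_eq_zero_of_vanish [CompleteSpace E] {G : Type*}
    [NormedAddCommGroup G] [NormedSpace ℝ G] [CompleteSpace G] {F : E → G} {f : E → ℝ} {p : E}
    {F' : E →L[ℝ] G} {f' : E →L[ℝ] ℝ} (hF : HasStrictFDerivAt F F' p)
    (hf : HasStrictFDerivAt f f' p) (hs : Function.Surjective F') (h0 : F p = 0)
    (hv : ∀ᶠ y in 𝓝 p, F y = 0 → f y = 0) {w : E} (hw : F' w = 0) : f' w = 0 := by
  have hext : IsLocalExtrOn f {y | F y = F p} p := by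
    left
    have hp : f p = 0 := hv.self_of_nhds h0
    filter_upwards [nhdsWithin_le_nhds hv, self_mem_nhdsWithin] with y hy hy'
    rw [hp, hy (by rw [← h0]; exact hy')]
  -- Lagrange multipliers: `f` is constant on the level set, so `p` is trivially an extremum there.
  -- Surjectivity of `F'` excludes the degenerate case `Λ₀ = 0`.
  obtain ⟨Λ, Λ₀, hne, hΛ⟩ := hext.exists_linear_map_of_hasStrictFDerivAt hF hf
  have h1 := hΛ w
  rw [hw, map_zero, zero_add] at h1
  rcases smul_eq_zero.1 h1 with h2 | h2
  · exfalso
    apply hne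
    have : Λ = 0 := by
      ext b
      obtain ⟨a, rfl⟩ := hs b
      simpa [h2] using hΛ a
    simp [this, h2]
  · exact h2

/-- A function with vanishing first jet along the zero set of a submersion and with positive
definite
normal Hessian is non-negative nearby. -/
theorem eventually_nonneg_of_normal_hessian_pos [FiniteDimensional ℝ E] {G : Type*}
    [NormedAddCommGroup G] [NormedSpace ℝ G] [CompleteSpace G] {F : E → G} {f : E → ℝ}
    {p : E} {A : E →L[ℝ] G} (hF : HasStrictFDerivAt F A p) (hs : Function.Surjective A)
    (hp : F p = 0) (hf : ContDiffAt ℝ 2 f p)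
    (h0 : ∀ᶠ y in 𝓝 p, F y = 0 → f y = 0 ∧ fderiv ℝ f y = 0)
    (hpos : ∀ w, A w ≠ 0 → 0 < fderiv ℝ (fderiv ℝ f) p w w) :
    ∀ᶠ y in 𝓝 p, 0 ≤ f y := by
  have : CompleteSpace E := FiniteDimensional.complete ℝ E
  set W : Submodule ℝ E := LinearMap.ker (A : E →ₗ[ℝ] G)
  -- The kernel of the projection `pr` onto `ker A` is a complement of `ker A`, on which the Hessian
  -- at `p` is positive definite.
  obtain ⟨pr, hpr⟩ := Submodule.ClosedComplemented.of_finiteDimensional W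
  have hker : ∀ d, pr d = 0 → d ≠ 0 → A d ≠ 0 := by
    intro d hd hd0 hA
    have := hpr ⟨d, by simpa [W] using hA⟩
    rw [hd] at this
    exact hd0 (congrArg Subtype.val this).symm
  have hG : HasStrictFDerivAt (fun y => (F y, pr y)) (A.prod pr) p :=
    hF.prodMk pr.hasStrictFDerivAt
  have hsG : (A.prod pr).range = ⊤ := by
    rw [LinearMap.range_eq_top]
    rintro ⟨a, w⟩
    obtain ⟨y, rfl⟩ := hs a
    refine ⟨y - (pr y : E) + w, ?_⟩
    have h1 : A (pr y : E) = 0 := by simpa [W] using (pr y).2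
    have h2 : A (w : E) = 0 := by simpa [W] using w.2
    have h3 := hpr (pr y)
    have h4 := hpr w
    simp [h1, h2, h3, h4]
  have hmap := hG.map_nhds_eq_of_surj hsG
  -- uniform positivity of the Hessian on the complement
  have hpos' : ∀ᶠ z in 𝓝 p, ∀ d ∈ Metric.sphere (0 : E) 1 ∩ {d | pr d = 0},
      0 < fderiv ℝ (fderiv ℝ f) z d d := by
    refine IsCompact.eventually_forall_of_forall_eventually ?_ ?_
    · exact (isCompact_sphere _ _).inter_right (isClosed_eq pr.continuous continuous_const)
    · rintro d ⟨hd1, hd2⟩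
      have hd0 : d ≠ 0 := by
        rintro rfl
        simp at hd1
      have hc : ContinuousAt (fderiv ℝ (fderiv ℝ f)) p :=
        (((hf.fderiv_right (m := 1) (by norm_num)).fderiv_right (m := 0)
          (by norm_num)).continuousAt)
      have hc1 : ContinuousAt (fun q : E × E => fderiv ℝ (fderiv ℝ f) q.1) (p, d) :=
        ContinuousAt.comp (f := Prod.fst) hc continuousAt_fst
      have hc2 : ContinuousAt (fun q : E × E => fderiv ℝ (fderiv ℝ f) q.1 q.2 q.2) (p, d) :=
        (hc1.clm_apply continuousAt_snd).clm_apply continuousAt_snd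
      exact hc2.eventually (lt_mem_nhds (hpos d (hker d hd2 hd0)))
  have hpos2 : ∀ᶠ z in 𝓝 p, ∀ d, pr d = 0 → 0 ≤ fderiv ℝ (fderiv ℝ f) z d d := by
    filter_upwards [hpos'] with z hz d hd
    by_cases hd0 : d = 0
    · simp [hd0]
    have h1 := hz (‖d‖⁻¹ • d) ⟨by simp [norm_smul, hd0], by simp [hd]⟩
    simp only [map_smul, smul_apply, smul_eq_mul] at h1
    have h2 : 0 < ‖d‖⁻¹ := by positivity
    exact (pos_of_mul_pos_right (pos_of_mul_pos_right h1 h2.le) h2.le).le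
  obtain ⟨r, hr, hball⟩ := Metric.eventually_nhds_iff_ball.1
    (((hpos2.and h0).and (hf.eventually_hasFDerivAt (k := 2) (by norm_num))).and
      ((hf.fderiv_right (m := 1) (by norm_num)).eventually_hasFDerivAt (k := 1) le_rfl))
  -- Since `(F, pr)` is open at `p`, each `y` near `p` has a foot point `y'` in the ball with `F y'
  -- = 0` and `pr y' = pr y`; then `y - y'` lies in the chosen complement.
  have himg : (fun y => (F y, pr y)) '' Metric.ball p r ∈ 𝓝 ((0 : G), pr p) := by
    rw [← hp, ← hmap]
    exact image_mem_map (Metric.ball_mem_nhds p hr)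
  have hc : ContinuousAt (fun y => ((0 : G), pr y)) p := by fun_prop
  filter_upwards [hc.eventually himg, Metric.ball_mem_nhds p hr] with y hy hyr
  obtain ⟨y', hy', hyy⟩ := hy
  simp only [Prod.mk.injEq] at hyy
  obtain ⟨⟨⟨-, h1⟩, -⟩, -⟩ := hball y' hy'
  obtain ⟨hf0, hf1⟩ := h1 hyy.1
  set d := y - y' with hd
  have hprd : pr d = 0 := by simp [hd, hyy.2]
  have hseg : ∀ t ∈ Icc (0 : ℝ) 1, y' + t • d ∈ Metric.ball p r := fun t ht =>
    (convex_ball p r).add_smul_sub_mem hy' hyr ht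
  have hline : ∀ t : ℝ, HasDerivAt (fun t : ℝ => y' + t • d) d t := fun t => by
    simpa using ((hasDerivAt_id t).smul_const d).const_add y'
  have hγ : ∀ t ∈ Icc (0 : ℝ) 1, HasDerivAt (fun t : ℝ => f (y' + t • d))
      (fderiv ℝ f (y' + t • d) d) t := fun t ht =>
    (hball _ (hseg t ht)).1.2.comp_hasDerivAt t (hline t)
  have hγ' : ∀ t ∈ Icc (0 : ℝ) 1, HasDerivAt (fun t : ℝ => fderiv ℝ f (y' + t • d) d)
      (fderiv ℝ (fderiv ℝ f) (y' + t • d) d d) t := fun t ht => by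
    have h2 : HasDerivAt (fun t : ℝ => fderiv ℝ f (y' + t • d))
        (fderiv ℝ (fderiv ℝ f) (y' + t • d) d) t :=
      (hball _ (hseg t ht)).2.comp_hasDerivAt t (hline t)
    exact (ContinuousLinearMap.apply ℝ ℝ d).hasFDerivAt.comp_hasDerivAt t h2
  -- The mean value theorem is used twice on the segment from `y'` to `y`. As `f` and its
  -- differential vanish at `y'`, the sign of the Hessian on `d` passes to the first derivative and
  -- then to `f y`.
  obtain ⟨s, hs, hs'⟩ := exists_hasDerivAt_eq_slope (fun t : ℝ => f (y' + t • d)) _ zero_lt_one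
    (fun t ht => (hγ t ht).continuousAt.continuousWithinAt)
    (fun t ht => hγ t (Ioo_subset_Icc_self ht))
  have hsub : Icc 0 s ⊆ Icc (0 : ℝ) 1 := Icc_subset_Icc le_rfl hs.2.le
  obtain ⟨r', hr1, hr2⟩ := exists_hasDerivAt_eq_slope
    (fun t : ℝ => fderiv ℝ f (y' + t • d) d) _ hs.1
    (fun t ht => (hγ' t (hsub ht)).continuousAt.continuousWithinAt)
    (fun t ht => hγ' t (hsub (Ioo_subset_Icc_self ht)))
  have h3 : 0 ≤ fderiv ℝ (fderiv ℝ f) (y' + r' • d) d d :=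
    (hball _ (hseg r' (hsub (Ioo_subset_Icc_self hr1)))).1.1.1 d hprd
  simp only [hr2, zero_smul, add_zero, hf1, zero_apply, sub_zero] at h3
  rw [le_div_iff₀ hs.1, zero_mul] at h3
  simp only [hs', zero_smul, add_zero, hf0, one_smul, sub_zero, div_one] at h3
  simpa [hd] using h3

end Calculus

theorem two_le_smooth : (2 : WithTop ℕ∞) ≤ ∞ := ENat.LEInfty.out

/-! ### Differentials, Hessians and tangent spaces in charts. -/

section Charts

variable {m : ℕ} {M : Type u} [TopologicalSpace M] [ChartedSpace (EuclideanSpace ℝ (Fin m)) M]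
  {F : Type*} [NormedAddCommGroup F] [NormedSpace ℝ F]

local notation "𝔼" => EuclideanSpace ℝ (Fin m)

theorem mfderiv_eq_fderiv_extChartAt {f : M → F} {x : M}
    (hf : MDifferentiableAt (𝓡 m) 𝓘(ℝ, F) f x) :
    mfderiv (𝓡 m) 𝓘(ℝ, F) f x =
      fderiv ℝ (f ∘ (extChartAt (𝓡 m) x).symm) (extChartAt (𝓡 m) x x) := by
  rw [hf.mfderiv]
  simp only [writtenInExtChartAt, extChartAt_model_space_eq_id, PartialEquiv.refl_coe,
    Function.id_comp, ModelWithCorners.range_eq_univ, fderivWithin_univ]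
  rfl

theorem tendsto_extChartAt_symm (x : M) {y : M} (hy : y ∈ (extChartAt (𝓡 m) x).source) :
    Tendsto (extChartAt (𝓡 m) x).symm (𝓝 (extChartAt (𝓡 m) x y)) (𝓝 y) := by
  have h := continuousAt_extChartAt_symm' (I := 𝓡 m) hy
  rwa [ContinuousAt, (extChartAt (𝓡 m) x).left_inv hy] at h

theorem eventually_extChartAt_symm (x : M) {y : M} (hy : y ∈ (extChartAt (𝓡 m) x).source)
    {p : M → Prop} (hp : ∀ᶠ z in 𝓝 y, p z) :
    ∀ᶠ z in 𝓝 (extChartAt (𝓡 m) x y), p ((extChartAt (𝓡 m) x).symm z) :=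
  (tendsto_extChartAt_symm x hy).eventually hp

theorem comp_extChartAt_symm_comp_eventuallyEq {X : Type*} (f : M → X) (x : M) {y : M}
    (hy : y ∈ (extChartAt (𝓡 m) x).source) :
    (f ∘ (extChartAt (𝓡 m) x).symm) ∘ extChartAt (𝓡 m) x =ᶠ[𝓝 y] f := by
  filter_upwards [extChartAt_source_mem_nhds' (I := 𝓡 m) hy] with z hz
  exact congrArg f ((extChartAt (𝓡 m) x).left_inv hz)

variable [IsManifold (𝓡 m) ∞ M]

theorem contMDiffAt_extChartAt_symm (x : M) {y : M} (hy : y ∈ (extChartAt (𝓡 m) x).source) :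
    ContMDiffAt 𝓘(ℝ, 𝔼) (𝓡 m) ∞ (extChartAt (𝓡 m) x).symm (extChartAt (𝓡 m) x y) := by
  have h := contMDiffWithinAt_extChartAt_symm_range (I := 𝓡 m) (n := ∞) x
    ((extChartAt (𝓡 m) x).map_source hy)
  rwa [ModelWithCorners.range_eq_univ, contMDiffWithinAt_univ] at h

theorem ContMDiffAt.contDiffAt_comp_extChartAt_symm {f : M → F} (x : M) {y : M}
    (hy : y ∈ (extChartAt (𝓡 m) x).source) (hf : ContMDiffAt (𝓡 m) 𝓘(ℝ, F) ∞ f y) :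
    ContDiffAt ℝ ∞ (f ∘ (extChartAt (𝓡 m) x).symm) (extChartAt (𝓡 m) x y) := by
  rw [← contMDiffAt_iff_contDiffAt]
  refine ContMDiffAt.comp _ ?_ (contMDiffAt_extChartAt_symm x hy)
  rwa [(extChartAt (𝓡 m) x).left_inv hy]

theorem contMDiffAt_extChartAt_of_mem (x : M) {y : M} (hy : y ∈ (extChartAt (𝓡 m) x).source) :
    ContMDiffAt (𝓡 m) 𝓘(ℝ, 𝔼) ∞ (extChartAt (𝓡 m) x) y :=
  contMDiffAt_extChartAt' (by rwa [extChartAt_source] at hy)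

theorem mfderiv_eq_fderiv_comp_mfderiv_extChartAt {f : M → F} (x : M) {y : M}
    (hy : y ∈ (extChartAt (𝓡 m) x).source) (hf : ContMDiffAt (𝓡 m) 𝓘(ℝ, F) ∞ f y)
    (w : TangentSpace (𝓡 m) y) :
    mfderiv (𝓡 m) 𝓘(ℝ, F) f y w =
      fderiv ℝ (f ∘ (extChartAt (𝓡 m) x).symm) (extChartAt (𝓡 m) x y)
        (mfderiv (𝓡 m) 𝓘(ℝ, 𝔼) (extChartAt (𝓡 m) x) y w) := by
  have h1 := (hf.contDiffAt_comp_extChartAt_symm x hy).differentiableAt (by simp)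
  have h2 := (contMDiffAt_extChartAt_of_mem x hy).mdifferentiableAt (by simp)
  rw [← (comp_extChartAt_symm_comp_eventuallyEq f x hy).mfderiv_eq,
    mfderiv_comp (I' := 𝓘(ℝ, 𝔼)) y h1.mdifferentiableAt h2, mfderiv_eq_fderiv]
  rfl

theorem bijective_mfderiv_extChartAt (x : M) {y : M} (hy : y ∈ (extChartAt (𝓡 m) x).source) :
    Function.Bijective (mfderiv (𝓡 m) 𝓘(ℝ, 𝔼) (extChartAt (𝓡 m) x) y) := by
  have : IsManifold (𝓡 m) 1 M := IsManifold.of_le (n := ∞) (by simp)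
  obtain ⟨e, he⟩ := isInvertible_mfderiv_extChartAt (I := 𝓡 m) hy
  rw [← he]
  exact e.bijective

/-- The second derivative of the transition map enters the chain rule only multiplied by the
differential of `f`, which is zero at `y`. With the chart fixed at `x`, the right-hand side can be
differentiated in `y`, whereas `hessianAt` changes its chart with the point. -/
theorem hessianAt_eq_of_critical {f : M → ℝ} (x : M) {y : M}
    (hy : y ∈ (extChartAt (𝓡 m) x).source) (hf : ContMDiffAt (𝓡 m) 𝓘(ℝ, ℝ) ∞ f y)
    (h1 : mfderiv (𝓡 m) 𝓘(ℝ, ℝ) f y = 0) (w w' : TangentSpace (𝓡 m) y) :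
    hessianAt m f y w w' =
      fderiv ℝ (fderiv ℝ (f ∘ (extChartAt (𝓡 m) x).symm)) (extChartAt (𝓡 m) x y)
        (mfderiv (𝓡 m) 𝓘(ℝ, 𝔼) (extChartAt (𝓡 m) x) y w)
        (mfderiv (𝓡 m) 𝓘(ℝ, 𝔼) (extChartAt (𝓡 m) x) y w') := by
  set ψ := extChartAt (𝓡 m) x ∘ (extChartAt (𝓡 m) y).symm with hψ
  have hψy : ψ (extChartAt (𝓡 m) y y) = extChartAt (𝓡 m) x y := by simp [hψ]
  have hself := mem_extChartAt_source (I := 𝓡 m) y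
  have hψs : ContDiffAt ℝ ∞ ψ (extChartAt (𝓡 m) y y) :=
    (contMDiffAt_extChartAt_of_mem x hy).contDiffAt_comp_extChartAt_symm y hself
  have hD : mfderiv (𝓡 m) 𝓘(ℝ, 𝔼) (extChartAt (𝓡 m) x) y =
      fderiv ℝ ψ (extChartAt (𝓡 m) y y) :=
    mfderiv_eq_fderiv_extChartAt ((contMDiffAt_extChartAt_of_mem x hy).mdifferentiableAt (by simp))
  have hg := hf.contDiffAt_comp_extChartAt_symm x hy
  have hg1 : fderiv ℝ (f ∘ (extChartAt (𝓡 m) x).symm) (extChartAt (𝓡 m) x y) = 0 := by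
    ext v
    obtain ⟨w, rfl⟩ := (bijective_mfderiv_extChartAt x hy).2 v
    have := mfderiv_eq_fderiv_comp_mfderiv_extChartAt x hy hf w
    rw [h1] at this
    exact this.symm
  have he : f ∘ (extChartAt (𝓡 m) y).symm =ᶠ[𝓝 (extChartAt (𝓡 m) y y)]
      (f ∘ (extChartAt (𝓡 m) x).symm) ∘ ψ := by
    filter_upwards [eventually_extChartAt_symm y hself
      (comp_extChartAt_symm_comp_eventuallyEq f x hy)] with z hz
    exact hz.symm
  have key : ∀ a b : 𝔼, fderiv ℝ (fderiv ℝ (f ∘ (extChartAt (𝓡 m) y).symm))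
      (extChartAt (𝓡 m) y y) a b =
      fderiv ℝ (fderiv ℝ (f ∘ (extChartAt (𝓡 m) x).symm)) (extChartAt (𝓡 m) x y)
        (fderiv ℝ ψ (extChartAt (𝓡 m) y y) a) (fderiv ℝ ψ (extChartAt (𝓡 m) y y) b) := by
    intro a b
    rw [he.fderiv.fderiv_eq, ← hψy]
    exact fderiv_fderiv_comp_of_critical (by rw [hψy]; exact hg.of_le two_le_smooth)
      (hψs.of_le two_le_smooth) (by rw [hψy]; exact hg1) a b
  rw [hD]
  exact key w w'

theorem hessianAt_symm {f : M → ℝ} {x : M} (hf : ContMDiffAt (𝓡 m) 𝓘(ℝ, ℝ) ∞ f x)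
    (w w' : TangentSpace (𝓡 m) x) : hessianAt m f x w w' = hessianAt m f x w' w :=
  ((hf.contDiffAt_comp_extChartAt_symm x (mem_extChartAt_source x)).isSymmSndFDerivAt
    (by rw [minSmoothness_of_isRCLikeNormedField]; exact two_le_smooth)) w w'

/-- The tangent space of the zero set of a submersion is the kernel of its differential. -/
theorem mem_tangentSpaceOf_iff {S : Set M} {x : M} {k : ℕ} {G : M → EuclideanSpace ℝ (Fin k)}
    (hG : ContMDiffAt (𝓡 m) (𝓡 k) ∞ G x)
    (hs : Function.Surjective (mfderiv (𝓡 m) (𝓡 k) G x)) (hx : G x = 0)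
    (hS : ∀ᶠ y in 𝓝 x, (y ∈ S ↔ G y = 0)) (w : TangentSpace (𝓡 m) x) :
    w ∈ tangentSpaceOf m S x ↔ mfderiv (𝓡 m) (𝓡 k) G x w = 0 := by
  have hself := mem_extChartAt_source (I := 𝓡 m) x
  constructor
  · intro hw
    refine PiLp.ext fun i => ?_
    have h1 : ContMDiffAt (𝓡 m) 𝓘(ℝ, ℝ) ∞ (fun y => G y i) x :=
      (EuclideanSpace.proj i : EuclideanSpace ℝ (Fin k) →L[ℝ] ℝ).contMDiff.contMDiffAt.comp x hG
    have h2 := hw (fun y => G y i) h1 (by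
      filter_upwards [hS] with y hy hyS
      rw [hy.1 hyS]
      rfl)
    have h3 : mfderiv (𝓡 m) 𝓘(ℝ, ℝ) (fun y => G y i) x =
        (EuclideanSpace.proj i : EuclideanSpace ℝ (Fin k) →L[ℝ] ℝ).comp
          (mfderiv (𝓡 m) (𝓡 k) G x) := by
      have := mfderiv_comp (I := 𝓡 m) (I' := 𝓡 k) (I'' := 𝓘(ℝ, ℝ)) x
        (EuclideanSpace.proj i : EuclideanSpace ℝ (Fin k) →L[ℝ] ℝ).mdifferentiableAt
        (hG.mdifferentiableAt (by simp))
      rw [ContinuousLinearMap.mfderiv_eq] at this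
      exact this
    rw [h3] at h2
    exact h2
  -- The converse needs that a function vanishing on the zero set of `G` has differential zero on
  -- `ker dG`, which is the multiplier argument in the chart.
  · intro hw f hf hv
    have hGs := (hG.contDiffAt_comp_extChartAt_symm x hself).hasStrictFDerivAt (by simp)
    have hfs := (hf.contDiffAt_comp_extChartAt_symm x hself).hasStrictFDerivAt (by simp)
    rw [mfderiv_eq_fderiv_extChartAt (hG.mdifferentiableAt (by simp))] at hw hs
    rw [mfderiv_eq_fderiv_extChartAt (hf.mdifferentiableAt (by simp))]
    refine hGs.apply_eq_zero_of_vanish hfs hs (by simpa using hx) ?_ hw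
    filter_upwards [eventually_extChartAt_symm x hself hS,
      eventually_extChartAt_symm x hself hv] with y h1 h2 h3
    exact h2 (h1.2 h3)

/-- The partial derivative of `f` in a constant chart direction `v` vanishes along `S`, so it is
itself a test function in the definition of `tangentSpaceOf`; its differential at `w` is `Hess f (w,
v)`. -/
theorem hessianAt_eq_zero_of_mem_tangentSpaceOf {f : M → ℝ} {S : Set M} {x : M}
    (hf : ∀ᶠ y in 𝓝 x, ContMDiffAt (𝓡 m) 𝓘(ℝ, ℝ) ∞ f y)
    (h1 : ∀ᶠ y in 𝓝 x, y ∈ S → mfderiv (𝓡 m) 𝓘(ℝ, ℝ) f y = 0) {w : TangentSpace (𝓡 m) x}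
    (hw : w ∈ tangentSpaceOf m S x) (v : TangentSpace (𝓡 m) x) : hessianAt m f x w v = 0 := by
  have hself := mem_extChartAt_source (I := 𝓡 m) x
  set g := f ∘ (extChartAt (𝓡 m) x).symm
  have hg : ContDiffAt ℝ ∞ g (extChartAt (𝓡 m) x x) :=
    hf.self_of_nhds.contDiffAt_comp_extChartAt_symm x hself
  have hg' : ContDiffAt ℝ ∞ (fderiv ℝ g) (extChartAt (𝓡 m) x x) := hg.fderiv_right (by simp)
  have hh : ContMDiffAt (𝓡 m) 𝓘(ℝ, ℝ) ∞ (fun y => fderiv ℝ g (extChartAt (𝓡 m) x y) v) x := by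
    have h2 : ContDiffAt ℝ ∞ (fun z => fderiv ℝ g z v) (extChartAt (𝓡 m) x x) :=
      hg'.clm_apply contDiffAt_const
    exact h2.contMDiffAt.comp x contMDiffAt_extChartAt
  have h3 := hw _ hh (by
    filter_upwards [h1, hf, extChartAt_source_mem_nhds (I := 𝓡 m) x] with y hy hfy hys hyS
    obtain ⟨v', hv'⟩ := (bijective_mfderiv_extChartAt x hys).2 v
    have h4 := mfderiv_eq_fderiv_comp_mfderiv_extChartAt x hys hfy v'
    rw [hv', hy hyS] at h4
    exact h4.symm)
  rw [mfderiv_eq_fderiv_extChartAt (hh.mdifferentiableAt (by simp))] at h3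
  have he : (fun y => fderiv ℝ g (extChartAt (𝓡 m) x y) v) ∘ (extChartAt (𝓡 m) x).symm
      =ᶠ[𝓝 (extChartAt (𝓡 m) x x)] fun z => fderiv ℝ g z v := by
    filter_upwards [extChartAt_target_mem_nhds (I := 𝓡 m) x] with z hz
    exact congrArg (fun z' => fderiv ℝ g z' v) ((extChartAt (𝓡 m) x).right_inv hz)
  have h5 : ∀ a b : 𝔼, fderiv ℝ (fun z => fderiv ℝ g z b) (extChartAt (𝓡 m) x x) a =
      fderiv ℝ (fderiv ℝ g) (extChartAt (𝓡 m) x x) a b := by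
    intro a b
    have h6 := (ContinuousLinearMap.apply ℝ ℝ b).hasFDerivAt.comp (extChartAt (𝓡 m) x x)
      (hg'.differentiableAt (by simp)).hasFDerivAt
    exact congrArg (fun L : 𝔼 →L[ℝ] ℝ => L a) h6.fderiv
  rw [he.fderiv_eq] at h3
  exact (h5 w v).symm.trans h3

end Charts

/-! ### Passing between a manifold and its open subsets. -/

section OpenSubmanifold

variable {m : ℕ} {M : Type u} [TopologicalSpace M] [ChartedSpace (EuclideanSpace ℝ (Fin m)) M]
  {U : TopologicalSpace.Opens M}

local notation "𝔼" => EuclideanSpace ℝ (Fin m)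

/-- The preferred chart of `U` at `y` is the restriction of that of `M`. So, with both tangent
spaces identified with `ℝ^m`, differentials and Hessians on `U` and on `M` agree literally and the
inclusion has differential the identity. -/
theorem val_comp_extChartAt_symm_eventuallyEq (y : U) :
    Subtype.val ∘ (extChartAt (𝓡 m) y).symm =ᶠ[𝓝 (extChartAt (𝓡 m) y.1 y.1)]
      (extChartAt (𝓡 m) y.1).symm :=
  (TopologicalSpace.Opens.chartAt_subtype_val_symm_eventuallyEq (H := 𝔼) U (x := y)).symm

theorem comp_val_comp_extChartAt_symm_eventuallyEq {X : Type*} (f : M → X) (y : U) :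
    (fun z : U => f z) ∘ (extChartAt (𝓡 m) y).symm =ᶠ[𝓝 (extChartAt (𝓡 m) y.1 y.1)]
      f ∘ (extChartAt (𝓡 m) y.1).symm := by
  filter_upwards [val_comp_extChartAt_symm_eventuallyEq y] with z hz
  exact congrArg f hz

theorem hessianAt_comp_val (f : M → ℝ) (y : U) (w w' : 𝔼) :
    hessianAt m (fun z : U => f z) y w w' = hessianAt m f y.1 w w' :=
  congrArg (fun B : 𝔼 →L[ℝ] 𝔼 →L[ℝ] ℝ => B w w')
    (Filter.EventuallyEq.fderiv_eq (𝕜 := ℝ)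
      (comp_val_comp_extChartAt_symm_eventuallyEq f y).fderiv)

theorem mfderiv_comp_val {F : Type*} [NormedAddCommGroup F] [NormedSpace ℝ F] {f : M → F} {y : U}
    (hf : ContMDiffAt (𝓡 m) 𝓘(ℝ, F) ∞ f y.1) (w : 𝔼) :
    mfderiv (𝓡 m) 𝓘(ℝ, F) (fun z : U => f z) y w = mfderiv (𝓡 m) 𝓘(ℝ, F) f y.1 w := by
  rw [mfderiv_eq_fderiv_extChartAt (hf.mdifferentiableAt (by simp)),
    mfderiv_eq_fderiv_extChartAt ((contMDiffAt_subtype_iff.2 hf).mdifferentiableAt (by simp))]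
  exact congrArg (fun B : 𝔼 →L[ℝ] F => B w) (Filter.EventuallyEq.fderiv_eq (𝕜 := ℝ)
    (comp_val_comp_extChartAt_symm_eventuallyEq f y))

theorem mfderiv_val_apply [IsManifold (𝓡 m) ∞ M] (y : U) (w : 𝔼) :
    mfderiv (𝓡 m) (𝓡 m) (Subtype.val : U → M) y w = w := by
  have h1 : MDifferentiableAt (𝓡 m) (𝓡 m) (Subtype.val : U → M) y :=
    (contMDiff_subtype_val (n := ∞) y).mdifferentiableAt (by simp)
  rw [h1.mfderiv, ModelWithCorners.range_eq_univ, fderivWithin_univ]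
  have he : writtenInExtChartAt (𝓡 m) (𝓡 m) y (Subtype.val : U → M)
      =ᶠ[𝓝 (extChartAt (𝓡 m) y.1 y.1)] id := by
    filter_upwards [val_comp_extChartAt_symm_eventuallyEq y,
      extChartAt_target_mem_nhds (I := 𝓡 m) y.1] with z hz hz'
    exact (congrArg (extChartAt (𝓡 m) y.1) hz).trans ((extChartAt (𝓡 m) y.1).right_inv hz')
  exact congrArg (fun B : 𝔼 →L[ℝ] 𝔼 => B w) (he.fderiv_eq.trans fderiv_id)

theorem eventually_val_iff {y : U} {p : M → Prop} :
    (∀ᶠ z : U in 𝓝 y, p z) ↔ ∀ᶠ z in 𝓝 y.1, p z := by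
  rw [← (U.isOpen.isOpenEmbedding_subtypeVal.map_nhds_eq y), eventually_map]
  rfl

/-- The value `0` outside `U` is arbitrary: the extension is used only through its germs at points
of `U`. -/
theorem contMDiffAt_extend_val {F : Type*} [NormedAddCommGroup F] [NormedSpace ℝ F] {f : U → F}
    {y : U} (hf : ContMDiffAt (𝓡 m) 𝓘(ℝ, F) ∞ f y) :
    ContMDiffAt (𝓡 m) 𝓘(ℝ, F) ∞ (Function.extend Subtype.val f 0) y.1 := by
  refine contMDiffAt_subtype_iff.1 ?_
  convert! hf using 1
  exact funext fun z => Subtype.val_injective.extend_apply f 0 z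

theorem extend_val_apply {F : Type*} [Zero F] (f : U → F) :
    (fun z : U => Function.extend Subtype.val f 0 z.1) = f :=
  funext fun z => Subtype.val_injective.extend_apply f 0 z

theorem mem_tangentSpaceOf_opens_iff {L : Set U} {S : Set M} {y : U}
    (h : ∀ᶠ z in 𝓝 y, (z ∈ L ↔ z.1 ∈ S)) (w : 𝔼) :
    w ∈ tangentSpaceOf m L y ↔ w ∈ tangentSpaceOf m S y.1 := by
  constructor
  · intro hw f hf h0
    have h1 := hw (fun z : U => f z) (contMDiffAt_subtype_iff.2 hf) (by
      filter_upwards [eventually_val_iff.2 h0, h] with z h2 h3 h4 using h2 (h3.1 h4))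
    exact (mfderiv_comp_val hf w).symm.trans h1
  · intro hw f hf h0
    have h1 := hw _ (contMDiffAt_extend_val hf) (by
      refine eventually_val_iff.1 ?_
      filter_upwards [h0, h] with z h2 h3 h4
      rw [Subtype.val_injective.extend_apply]
      exact h2 (h3.2 h4))
    have h2 := mfderiv_comp_val (contMDiffAt_extend_val hf) w
    rw [extend_val_apply] at h2
    exact h2.trans h1

theorem IsEmbeddedSubmanifold.image_val {L : Set U} {k : ℕ} (hL : IsEmbeddedSubmanifold m L k) :
    IsEmbeddedSubmanifold m (Subtype.val '' L) k := by
  rintro _ ⟨y, hy, rfl⟩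
  obtain ⟨V, G, hV, hyV, hG, hs, hE⟩ := hL y hy
  have hG' : ∀ z ∈ V, ContMDiffAt (𝓡 m) (𝓡 k) ∞ G z := fun z hz =>
    (hG z hz).contMDiffAt (hV.mem_nhds hz)
  refine ⟨Subtype.val '' V, Function.extend Subtype.val G 0,
    U.isOpen.isOpenEmbedding_subtypeVal.isOpenMap V hV, mem_image_of_mem _ hyV, ?_, ?_, ?_⟩
  · rintro _ ⟨z, hz, rfl⟩
    exact (contMDiffAt_extend_val (hG' z hz)).contMDiffWithinAt
  · rintro _ ⟨z, hz, rfl⟩ c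
    obtain ⟨w, hw⟩ := hs z hz c
    have h2 := mfderiv_comp_val (contMDiffAt_extend_val (hG' z hz)) w
    rw [extend_val_apply] at h2
    exact ⟨w, h2.symm.trans hw⟩
  · rw [← image_inter Subtype.val_injective, hE]
    ext z
    constructor
    · rintro ⟨z, ⟨hz, hz'⟩, rfl⟩
      exact ⟨mem_image_of_mem _ hz, by rw [Subtype.val_injective.extend_apply]; exact hz'⟩
    · rintro ⟨⟨z, hz, rfl⟩, hz'⟩
      rw [Subtype.val_injective.extend_apply] at hz'
      exact ⟨z, ⟨hz, hz'⟩, rfl⟩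

theorem IsEmbeddedSubmanifold.preimage_val {S : Set M} {k : ℕ} (hS : IsEmbeddedSubmanifold m S k)
    (U : TopologicalSpace.Opens M) :
    IsEmbeddedSubmanifold m (Subtype.val ⁻¹' S : Set U) k := by
  intro y hy
  obtain ⟨V, G, hV, hyV, hG, hs, hE⟩ := hS y.1 hy
  have hG' : ∀ z ∈ V, ContMDiffAt (𝓡 m) (𝓡 k) ∞ G z := fun z hz =>
    (hG z hz).contMDiffAt (hV.mem_nhds hz)
  refine ⟨Subtype.val ⁻¹' V, fun z => G z, hV.preimage continuous_subtype_val, hyV, ?_, ?_, ?_⟩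
  · intro z hz
    exact (contMDiffAt_subtype_iff.2 (hG' z hz)).contMDiffWithinAt
  · intro z hz c
    obtain ⟨w, hw⟩ := hs z hz c
    exact ⟨w, (mfderiv_comp_val (hG' z hz) w).trans hw⟩
  · rw [← preimage_inter, hE]
    rfl

end OpenSubmanifold

/-! ### Functions that agree up to a smooth unit. -/

section Associated

variable {m : ℕ} {M : Type u} [TopologicalSpace M] [ChartedSpace (EuclideanSpace ℝ (Fin m)) M]

/-- Near `x` the function `f` is the product of `g` and a smooth function without zeros. -/
def SmoothAssociatedAt (m : ℕ) {M : Type u} [TopologicalSpace M]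
    [ChartedSpace (EuclideanSpace ℝ (Fin m)) M] (f g : M → ℝ) (x : M) : Prop :=
  ∃ a : M → ℝ, a x ≠ 0 ∧ ∀ᶠ y in 𝓝 x, ContMDiffAt (𝓡 m) 𝓘(ℝ, ℝ) ∞ a y ∧ f y = a y * g y

namespace SmoothAssociatedAt

variable {f g h : M → ℝ} {x : M}

theorem refl (f : M → ℝ) (x : M) : SmoothAssociatedAt m f f x :=
  ⟨1, by simp, Eventually.of_forall fun y => ⟨contMDiffAt_const, by simp⟩⟩

theorem trans (h1 : SmoothAssociatedAt m f g x) (h2 : SmoothAssociatedAt m g h x) :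
    SmoothAssociatedAt m f h x := by
  obtain ⟨a, ha, h1⟩ := h1
  obtain ⟨b, hb, h2⟩ := h2
  refine ⟨fun y => a y * b y, mul_ne_zero ha hb, ?_⟩
  filter_upwards [h1, h2] with y h3 h4
  exact ⟨h3.1.mul h4.1, by rw [h3.2, h4.2, mul_assoc]⟩

theorem symm (h1 : SmoothAssociatedAt m f g x) : SmoothAssociatedAt m g f x := by
  obtain ⟨a, ha, h1⟩ := h1
  refine ⟨fun y => (a y)⁻¹, inv_ne_zero ha, ?_⟩
  filter_upwards [h1, h1.self_of_nhds.1.continuousAt.eventually_ne ha] with y h3 h4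
  refine ⟨?_, by rw [h3.2]; field_simp⟩
  exact (contDiffAt_inv ℝ h4).contMDiffAt.comp y h3.1

theorem mul {f' g' : M → ℝ} (h1 : SmoothAssociatedAt m f g x)
    (h2 : SmoothAssociatedAt m f' g' x) :
    SmoothAssociatedAt m (fun y => f y * f' y) (fun y => g y * g' y) x := by
  obtain ⟨a, ha, h1⟩ := h1
  obtain ⟨b, hb, h2⟩ := h2
  refine ⟨fun y => a y * b y, mul_ne_zero ha hb, ?_⟩
  filter_upwards [h1, h2] with y h3 h4
  exact ⟨h3.1.mul h4.1, by rw [h3.2, h4.2]; ring⟩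

theorem prod {ι : Type*} (s : Finset ι) {f g : ι → M → ℝ}
    (h1 : ∀ i ∈ s, SmoothAssociatedAt m (f i) (g i) x) :
    SmoothAssociatedAt m (fun y => ∏ i ∈ s, f i y) (fun y => ∏ i ∈ s, g i y) x := by
  classical
  induction s using Finset.induction_on with
  | empty => simpa using refl _ x
  | insert i s hi ih =>
    simp only [Finset.prod_insert hi]
    exact (h1 i (by simp)).mul (ih fun j hj => h1 j (by simp [hj]))

theorem of_ne_zero (hf : ∀ᶠ y in 𝓝 x, ContMDiffAt (𝓡 m) 𝓘(ℝ, ℝ) ∞ f y) (hx : f x ≠ 0) :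
    SmoothAssociatedAt m f 1 x :=
  ⟨f, hx, hf.mono fun y hy => ⟨hy, by simp⟩⟩

theorem eq_zero_iff (h1 : SmoothAssociatedAt m f g x) : f x = 0 ↔ g x = 0 := by
  obtain ⟨a, ha, h1⟩ := h1
  rw [h1.self_of_nhds.2]
  simp [ha]

/-- Two functions that divide each other and are non-zero on a dense set are associated. -/
theorem of_mul_of_mul {a b : M → ℝ}
    (ha : ∀ᶠ y in 𝓝 x, ContMDiffAt (𝓡 m) 𝓘(ℝ, ℝ) ∞ a y)
    (hb : ContinuousAt b x)
    (hf : ∀ᶠ y in 𝓝 x, f y = a y * g y) (hg : ∀ᶠ y in 𝓝 x, g y = b y * f y)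
    (hd : ∃ᶠ y in 𝓝 x, f y ≠ 0) : SmoothAssociatedAt m f g x := by
  refine ⟨a, ?_, ha.and hf⟩
  -- If `a x = 0` then `a * b ≠ 1` near `x`, whereas `f = a * b * f` forces `a * b = 1` wherever `f
  -- ≠ 0`.
  intro h0
  have hc : ContinuousAt (fun y => a y * b y) x := ha.self_of_nhds.continuousAt.mul hb
  have h1 : ∀ᶠ y in 𝓝 x, a y * b y ≠ 1 := hc.eventually_ne (by simp [h0])
  refine hd ?_
  filter_upwards [h1, hf, hg] with y h2 h3 h4
  rw [not_not]
  by_contra h5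
  apply h2
  rw [h4, ← mul_assoc] at h3
  exact mul_right_cancel₀ h5 (by rw [one_mul]; exact h3.symm)

theorem mfderiv_hessianAt [IsManifold (𝓡 m) ∞ M] (h1 : SmoothAssociatedAt m f g x)
    (hg : ContMDiffAt (𝓡 m) 𝓘(ℝ, ℝ) ∞ g x) (h0 : g x = 0)
    (hd : mfderiv (𝓡 m) 𝓘(ℝ, ℝ) g x = 0) :
    mfderiv (𝓡 m) 𝓘(ℝ, ℝ) f x = 0 ∧ ∃ c : ℝ, c ≠ 0 ∧ hessianAt m f x = c • hessianAt m g x := by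
  obtain ⟨a, ha, h1⟩ := h1
  have hself := mem_extChartAt_source (I := 𝓡 m) x
  have hf : ContMDiffAt (𝓡 m) 𝓘(ℝ, ℝ) ∞ f x :=
    (h1.self_of_nhds.1.mul hg).congr_of_eventuallyEq (h1.mono fun y hy => hy.2)
  rw [mfderiv_eq_fderiv_extChartAt (hg.mdifferentiableAt (by simp))] at hd
  have := fderiv_mul_of_critical
    ((h1.self_of_nhds.1.contDiffAt_comp_extChartAt_symm x hself).of_le two_le_smooth)
    ((hg.contDiffAt_comp_extChartAt_symm x hself).of_le two_le_smooth) (by simpa using h0) hd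
    (eventually_extChartAt_symm x hself (h1.mono fun y hy => hy.2))
  refine ⟨?_, a x, ha, ?_⟩
  · rw [mfderiv_eq_fderiv_extChartAt (hf.mdifferentiableAt (by simp))]
    exact this.1
  · have h2 := this.2
    simp only [Function.comp_apply, extChartAt_to_inv] at h2
    exact h2

end SmoothAssociatedAt

end Associated

/-! ### Cut-off functions, local representatives of `q` and the ideals of divisors. -/

section Bump

variable {m : ℕ} {N : Type u} [TopologicalSpace N] [ChartedSpace (EuclideanSpace ℝ (Fin m)) N]
  [IsManifold (𝓡 m) ∞ N] [T2Space N]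

theorem exists_contMDiff_eventually_eq_one (x : N) {V : Set N} (hV : V ∈ 𝓝 x) :
    ∃ χ : N → ℝ, ContMDiff (𝓡 m) 𝓘(ℝ, ℝ) ∞ χ ∧ tsupport χ ⊆ V ∧ ∀ᶠ y in 𝓝 x, χ y = 1 := by
  obtain ⟨φ, -, hφ⟩ := (SmoothBumpFunction.nhds_basis_tsupport (I := 𝓡 m) x).mem_iff.1 hV
  exact ⟨φ, φ.contMDiff, hφ, φ.eventuallyEq_one⟩

end Bump

namespace RealDivisor

section LocalRep

variable {m : ℕ} {N : Type u} [TopologicalSpace N] [ChartedSpace (EuclideanSpace ℝ (Fin m)) N]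
  (δ : RealDivisor.{u, v} m N)

/-- The open set over which the line bundle is trivialised by the preferred trivialisation
at `x`. -/
def trivSet (x : N) : Set N := (trivializationAt ℝ δ.R x).baseSet

theorem isOpen_trivSet (x : N) : IsOpen (δ.trivSet x) := (trivializationAt ℝ δ.R x).open_baseSet

theorem mem_trivSet (x : N) : x ∈ δ.trivSet x := mem_baseSet_trivializationAt ℝ δ.R x

theorem trivSet_mem_nhds (x : N) : δ.trivSet x ∈ 𝓝 x :=
  (δ.isOpen_trivSet x).mem_nhds (δ.mem_trivSet x)

/-- The local frame of the dual line bundle given by the preferred trivialisation at `x`. -/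
noncomputable def coframe (x y : N) : δ.R y →L[ℝ] ℝ :=
  (trivializationAt ℝ δ.R x).continuousLinearMapAt ℝ y

variable {δ}

theorem coframe_apply {x y : N} (hy : y ∈ δ.trivSet x) : δ.coframe x y (δ.q y) = δ.localRep x y :=
  Trivialization.continuousLinearMapAt_apply_of_mem (R := ℝ) (trivializationAt ℝ δ.R x) hy (δ.q y)

theorem localRep_contMDiffAt {x y : N} (hy : y ∈ δ.trivSet x) :
    ContMDiffAt (𝓡 m) 𝓘(ℝ, ℝ) ∞ (δ.localRep x) y :=
  ((trivializationAt ℝ δ.R x).contMDiffAt_section_iff (IB := 𝓡 m) (n := ∞) hy).1 (δ.contMDiff_q y)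

theorem q_eq_localRep_smul {x y : N} (hy : y ∈ δ.trivSet x) :
    δ.q y = δ.localRep x y • (trivializationAt ℝ δ.R x).symmL ℝ y 1 := by
  have h := (trivializationAt ℝ δ.R x).symmL_continuousLinearMapAt (R := ℝ) hy (δ.q y)
  rw [← map_smul, smul_eq_mul, mul_one, ← coframe_apply hy]
  exact h.symm

theorem localRep_eq_zero_iff {x y : N} (hy : y ∈ δ.trivSet x) :
    δ.localRep x y = 0 ↔ y ∈ δ.locus := by
  constructor
  · intro h
    have := q_eq_localRep_smul hy
    rw [h, zero_smul] at this
    exact this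
  · intro h
    rw [← coframe_apply hy, show δ.q y = 0 from h, map_zero]

theorem frequently_localRep_ne_zero (x : N) : ∃ᶠ y in 𝓝 x, δ.localRep x y ≠ 0 := by
  intro h
  have h1 : ∀ᶠ y in 𝓝 x, y ∈ closure {x | δ.q x = 0} := by
    filter_upwards [h, δ.trivSet_mem_nhds x] with y hy hyx
    exact subset_closure ((localRep_eq_zero_iff hyx).1 (not_not.1 hy))
  have h2 : x ∈ interior (closure {x | δ.q x = 0}) := mem_interior_iff_mem_nhds.2 h1
  rw [δ.isNowhereDense_zeros] at h2
  exact h2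

/-- Read in the trivialisation at `y`, the coframe is the coordinate change between the
trivialisations at `y` and at `x`, which is smooth. -/
theorem contMDiffAt_coframe {x y : N} (hy : y ∈ δ.trivSet x) :
    ContMDiffAt (𝓡 m) ((𝓡 m).prod 𝓘(ℝ, ℝ →L[ℝ] ℝ)) ∞
      (fun y => TotalSpace.mk' (ℝ →L[ℝ] ℝ)
        (E := fun y : N => δ.R y →L[ℝ] Bundle.Trivial N ℝ y) y (δ.coframe x y)) y := by
  refine contMDiffAt_totalSpace.mpr ⟨contMDiffAt_id, ?_⟩
  have hy' := mem_baseSet_trivializationAt ℝ δ.R y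
  refine (contMDiffAt_coordChangeL (IB := 𝓡 m) (n := ∞) hy' hy).congr_of_eventuallyEq ?_
  filter_upwards [(trivializationAt ℝ δ.R y).open_baseSet.mem_nhds hy',
    (δ.isOpen_trivSet x).mem_nhds hy] with b hb hb'
  refine ContinuousLinearMap.ext fun t => ?_
  rw [hom_trivializationAt_apply, ContinuousLinearMap.inCoordinates]
  simp only [ContinuousLinearMap.comp_apply, ContinuousLinearEquiv.coe_coe]
  rw [Trivialization.coordChangeL_apply _ _ ⟨hb, hb'⟩, Trivialization.symmL_apply _ hb]
  change (Bundle.Trivial.trivialization N ℝ).continuousLinearMapAt ℝ b _ = _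
  rw [Bundle.Trivial.continuousLinearMapAt_trivialization]
  exact Trivialization.continuousLinearMapAt_apply_of_mem (R := ℝ) (trivializationAt ℝ δ.R x) hb' _

theorem isSmoothDualOn_cutoff {x : N} {χ : N → ℝ} (hχ : ContMDiff (𝓡 m) 𝓘(ℝ, ℝ) ∞ χ)
    (hs : tsupport χ ⊆ δ.trivSet x) :
    δ.IsSmoothDualOn univ (fun y => χ y • δ.coframe x y) := by
  intro y _
  by_cases hy : y ∈ tsupport χ
  · have h1 : δ.IsSmoothDualOn (δ.trivSet x) (δ.coframe x) :=
      fun z hz => (contMDiffAt_coframe hz).contMDiffWithinAt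
    exact ((h1.smul hχ.contMDiffOn y (hs hy)).contMDiffAt
      ((δ.isOpen_trivSet x).mem_nhds (hs hy))).contMDiffWithinAt
  · have h1 := (δ.isSmoothDualOn_zero univ y (mem_univ y)).contMDiffAt univ_mem
    refine (h1.congr_of_eventuallyEq ?_).contMDiffWithinAt
    filter_upwards [(isClosed_tsupport χ).isOpen_compl.mem_nhds hy] with z hz
    have h2 : χ z = 0 := image_eq_zero_of_notMem_tsupport hz
    simp only [h2, zero_smul]

/-- On a trivialising set the pairing of `q` with a section of the dual bundle is a multiple of the
local representative of `q`. -/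
theorem IsSmoothDualOn.exists_eq_mul_localRep {s : Set N} (hs : IsOpen s)
    {α : ∀ x, δ.R x →L[ℝ] ℝ} (hα : δ.IsSmoothDualOn s α) (x : N) :
    ∃ a : N → ℝ, (∀ y ∈ s ∩ δ.trivSet x, ContMDiffAt (𝓡 m) 𝓘(ℝ, ℝ) ∞ a y) ∧
      ∀ y ∈ s ∩ δ.trivSet x, α y (δ.q y) = a y * δ.localRep x y := by
  refine ⟨fun y => α y ((trivializationAt ℝ δ.R x).symmL ℝ y 1), ?_, ?_⟩
  · rintro y ⟨hys, hyx⟩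
    have h1 : ContMDiffAt (𝓡 m) ((𝓡 m).prod 𝓘(ℝ, ℝ)) ∞
        (fun y => TotalSpace.mk' ℝ y ((trivializationAt ℝ δ.R x).symmL ℝ y 1)) y := by
      refine ((trivializationAt ℝ δ.R x).contMDiffAt_section_iff (IB := 𝓡 m) (n := ∞) hyx).2 ?_
      refine (contMDiffAt_const (c := (1 : ℝ))).congr_of_eventuallyEq ?_
      filter_upwards [(δ.isOpen_trivSet x).mem_nhds hyx] with z hz
      have h2 := (trivializationAt ℝ δ.R x).continuousLinearMapAt_symmL (R := ℝ) hz 1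
      rwa [Trivialization.continuousLinearMapAt_apply_of_mem (R := ℝ) _ hz] at h2
    have h2 := ((hα y hys).contMDiffAt (hs.mem_nhds hys)).clm_bundle_apply h1
    exact ((contMDiffAt_totalSpace (IM := 𝓡 m)).1 h2).2
  · rintro y ⟨hys, hyx⟩
    rw [q_eq_localRep_smul hyx, map_smul, smul_eq_mul, mul_comm]

theorem cutoff_smul_coframe_apply {x : N} {χ : N → ℝ} (hs : tsupport χ ⊆ δ.trivSet x) (y : N) :
    χ y • δ.coframe x y (δ.q y) = χ y * δ.localRep x y := by
  by_cases hy : y ∈ tsupport χ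
  · rw [coframe_apply (hs hy), smul_eq_mul]
  · rw [image_eq_zero_of_notMem_tsupport hy, zero_smul, zero_mul]

theorem contMDiff_cutoff_mul_localRep {x : N} {χ : N → ℝ} (hχ : ContMDiff (𝓡 m) 𝓘(ℝ, ℝ) ∞ χ)
    (hs : tsupport χ ⊆ δ.trivSet x) :
    ContMDiff (𝓡 m) 𝓘(ℝ, ℝ) ∞ (fun y => χ y * δ.localRep x y) := by
  intro y
  by_cases hy : y ∈ tsupport χ
  · exact hχ.contMDiffAt.mul (localRep_contMDiffAt (hs hy))
  · refine (contMDiffAt_const (c := (0 : ℝ))).congr_of_eventuallyEq ?_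
    filter_upwards [(isClosed_tsupport χ).isOpen_compl.mem_nhds hy] with z hz
    rw [image_eq_zero_of_notMem_tsupport hz, zero_mul]

theorem exists_mem_ideal_cutoff {x : N} {χ : N → ℝ} (hχ : ContMDiff (𝓡 m) 𝓘(ℝ, ℝ) ∞ χ)
    (hs : tsupport χ ⊆ δ.trivSet x) : ∃ g ∈ δ.ideal, ∀ y, g y = χ y * δ.localRep x y :=
  ⟨⟨_, contMDiff_cutoff_mul_localRep hχ hs⟩, ⟨_, isSmoothDualOn_cutoff hχ hs,
    fun y => (cutoff_smul_coframe_apply hs y).symm⟩, fun _ => rfl⟩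

theorem exists_mem_idealOn_cutoff {x : N} {χ : N → ℝ} (hχ : ContMDiff (𝓡 m) 𝓘(ℝ, ℝ) ∞ χ)
    (hs : tsupport χ ⊆ δ.trivSet x) (U : TopologicalSpace.Opens N) :
    ∃ g ∈ δ.idealOn U, ∀ y : U, g y = χ y * δ.localRep x y :=
  ⟨⟨fun y : U => χ y * δ.localRep x y,
    fun y => contMDiffAt_subtype_iff.2 (contMDiff_cutoff_mul_localRep hχ hs y)⟩,
    ⟨_, (isSmoothDualOn_cutoff hχ hs).mono (subset_univ _),
      fun y => (cutoff_smul_coframe_apply hs y).symm⟩, fun _ => rfl⟩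

/-- Over a trivialising open set the ideal is generated by the local representative of `q`. -/
theorem mem_idealOn_iff {x : N} {U : TopologicalSpace.Opens N} (hU : (U : Set N) ⊆ δ.trivSet x)
    (g : C^∞⟮𝓡 m, U; 𝓘(ℝ, ℝ), ℝ⟯) :
    g ∈ δ.idealOn U ↔ ∃ a : N → ℝ, (∀ y ∈ U, ContMDiffAt (𝓡 m) 𝓘(ℝ, ℝ) ∞ a y) ∧
      ∀ y : U, g y = a y * δ.localRep x y := by
  constructor
  · rintro ⟨α, hα, hg⟩
    obtain ⟨a, ha, ha'⟩ := hα.exists_eq_mul_localRep U.isOpen x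
    exact ⟨a, fun y hy => ha y ⟨hy, hU hy⟩, fun y => (hg y).trans (ha' y ⟨y.2, hU y.2⟩)⟩
  · rintro ⟨a, ha, hg⟩
    refine ⟨fun y => a y • δ.coframe x y, IsSmoothDualOn.smul
      (fun y hy => (ha y hy).contMDiffWithinAt)
      (fun y hy => (contMDiffAt_coframe (hU hy)).contMDiffWithinAt), fun y => ?_⟩
    rw [hg y, ← coframe_apply (hU y.2)]
    rfl

/-- A generator of the ideal of a divisor is a local representative of it, up to units. -/
theorem associated_localRep_of_ideal_eq_span [IsManifold (𝓡 m) ∞ N] [T2Space N]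
    {f : C^∞⟮𝓡 m, N; 𝓘(ℝ, ℝ), ℝ⟯} (hf : δ.ideal = Ideal.span {f}) (x : N) :
    SmoothAssociatedAt m f (δ.localRep x) x := by
  have h1 : f ∈ δ.ideal := by
    rw [hf]
    exact Ideal.mem_span_singleton_self f
  obtain ⟨α, hα, hfα⟩ := h1
  obtain ⟨a, ha, ha'⟩ := hα.exists_eq_mul_localRep isOpen_univ x
  -- The ideal consists of functions on all of `N`, so the local representative is cut off to become
  -- an element of it. It is then a multiple of `f`, and near `x` the cut-off is invisible.
  obtain ⟨χ, hχ, hs, hχ1⟩ := exists_contMDiff_eventually_eq_one (m := m) x (δ.trivSet_mem_nhds x)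
  obtain ⟨g, hg, hgy⟩ := exists_mem_ideal_cutoff hχ hs
  rw [hf, Ideal.mem_span_singleton'] at hg
  obtain ⟨b, rfl⟩ := hg
  have hb : ∀ᶠ y in 𝓝 x, δ.localRep x y = b y * f y := by
    filter_upwards [hχ1] with y hy
    rw [← one_mul (δ.localRep x y), ← hy, ← hgy y]
    rfl
  refine SmoothAssociatedAt.of_mul_of_mul (a := a) (b := b) ?_ b.contMDiff.continuous.continuousAt
    ?_ hb ?_
  · filter_upwards [δ.trivSet_mem_nhds x] with y hy using ha y ⟨mem_univ y, hy⟩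
  · filter_upwards [δ.trivSet_mem_nhds x] with y hy
    rw [hfα y, ha' y ⟨mem_univ y, hy⟩]
  · refine ((frequently_localRep_ne_zero (δ := δ) x).and_eventually hb).mono ?_
    rintro y ⟨h2, h3⟩ h4
    exact h2 (by rw [h3, h4, mul_zero])

end LocalRep

section Trivial

variable {m : ℕ} {N : Type u} [TopologicalSpace N] [ChartedSpace (EuclideanSpace ℝ (Fin m)) N]
  (f : C^∞⟮𝓡 m, N; 𝓘(ℝ, ℝ), ℝ⟯) (hf : IsNowhereDense {x | f x = 0})

/-- The divisor given by a function, that is, by a section of the trivial line bundle. -/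
noncomputable def ofFunction : RealDivisor.{u, 0} m N where
  R := Bundle.Trivial N ℝ
  addCommGroupR := fun _ => inferInstanceAs (AddCommGroup ℝ)
  moduleR := fun _ => inferInstanceAs (Module ℝ ℝ)
  topologicalSpaceR := fun _ => inferInstanceAs (TopologicalSpace ℝ)
  fiberBundle := inferInstanceAs (FiberBundle ℝ (Bundle.Trivial N ℝ))
  vectorBundle := inferInstanceAs (VectorBundle ℝ ℝ (Bundle.Trivial N ℝ))
  contMDiffVectorBundle := inferInstanceAs (ContMDiffVectorBundle ∞ ℝ (Bundle.Trivial N ℝ) (𝓡 m))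
  q := f
  contMDiff_q := fun x => contMDiffAt_totalSpace.2 ⟨contMDiffAt_id,
    (f.contMDiff x).congr_of_eventuallyEq (Eventually.of_forall fun _ => rfl)⟩
  isNowhereDense_zeros := hf

theorem ofFunction_localRep (x : N) : (ofFunction f hf).localRep x = f := rfl

theorem ofFunction_locus : (ofFunction f hf).locus = {x | f x = 0} := rfl

theorem ofFunction_ideal : (ofFunction f hf).ideal = Ideal.span {f} := by
  ext g
  rw [Ideal.mem_span_singleton']
  constructor
  · rintro ⟨α, hα, hg⟩
    rcases isEmpty_or_nonempty N with hN | ⟨⟨x⟩⟩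
    · exact ⟨0, by ext y; exact hN.elim y⟩
    obtain ⟨a, ha, ha'⟩ := hα.exists_eq_mul_localRep isOpen_univ x
    refine ⟨⟨a, fun y => ha y ⟨mem_univ y, mem_univ y⟩⟩, ?_⟩
    ext y
    exact ((hg y).trans (ha' y ⟨mem_univ y, mem_univ y⟩)).symm
  · rintro ⟨a, rfl⟩
    rcases isEmpty_or_nonempty N with hN | ⟨⟨x⟩⟩
    · exact ⟨fun y => 0, isSmoothDualOn_zero _ _, fun y => hN.elim y⟩
    refine ⟨fun y => a y • (ofFunction f hf).coframe x y, IsSmoothDualOn.smul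
      a.contMDiff.contMDiffOn
      (fun y _ => (contMDiffAt_coframe (mem_univ y)).contMDiffWithinAt), fun y => ?_⟩
    exact congrArg (a y * ·) (coframe_apply (δ := ofFunction f hf) (x := x) (mem_univ y)).symm

end Trivial

end RealDivisor

/-! ### Signs and invariance of the local representatives of smooth elliptic divisors. -/

section MorseBott

variable {m : ℕ} {N : Type u} [TopologicalSpace N] [ChartedSpace (EuclideanSpace ℝ (Fin m)) N]
  [IsManifold (𝓡 m) ∞ N]

/-- A function with vanishing first jet along an embedded submanifold and with positive definite
normal
Hessian at a point of it is non-negative near this point. -/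
theorem eventually_nonneg_of_hessianAt_pos {S : Set N} {k : ℕ} (hS : IsEmbeddedSubmanifold m S k)
    {x : N} (hx : x ∈ S) {f : N → ℝ} (hf : ∀ᶠ y in 𝓝 x, ContMDiffAt (𝓡 m) 𝓘(ℝ, ℝ) ∞ f y)
    (h0 : ∀ᶠ y in 𝓝 x, y ∈ S → f y = 0 ∧ mfderiv (𝓡 m) 𝓘(ℝ, ℝ) f y = 0)
    (hpos : ∀ w ∉ tangentSpaceOf m S x, 0 < hessianAt m f x w w) : ∀ᶠ y in 𝓝 x, 0 ≤ f y := by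
  obtain ⟨V, G, hV, hxV, hG, hs, hE⟩ := hS x hx
  have hself := mem_extChartAt_source (I := 𝓡 m) x
  have hGx := (hG x hxV).contMDiffAt (hV.mem_nhds hxV)
  have hmem : ∀ y ∈ V, (y ∈ S ↔ G y = 0) := fun y hy => by
    have := Set.ext_iff.1 hE y
    simpa [hy] using this
  have hGs := (hGx.contDiffAt_comp_extChartAt_symm x hself).hasStrictFDerivAt (by simp)
  have hsx := hs x hxV
  have hiff := mem_tangentSpaceOf_iff hGx hsx ((hmem x hxV).1 hx)
    (by filter_upwards [hV.mem_nhds hxV] with y hy using hmem y hy)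
  rw [mfderiv_eq_fderiv_extChartAt (hGx.mdifferentiableAt (by simp))] at hsx hiff
  have key := eventually_nonneg_of_normal_hessian_pos hGs hsx (by simpa using (hmem x hxV).1 hx)
    ((hf.self_of_nhds.contDiffAt_comp_extChartAt_symm x hself).of_le two_le_smooth) ?_ ?_
  · have h1 : ∀ᶠ y in 𝓝 x, 0 ≤ (f ∘ (extChartAt (𝓡 m) x).symm) (extChartAt (𝓡 m) x y) :=
      (continuousAt_extChartAt (I := 𝓡 m) x).eventually key
    filter_upwards [h1, extChartAt_source_mem_nhds (I := 𝓡 m) x] with y hy hy'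
    have h2 : (extChartAt (𝓡 m) x).symm (extChartAt (𝓡 m) x y) = y :=
      (extChartAt (𝓡 m) x).left_inv hy'
    rwa [Function.comp_apply, h2] at hy
  · filter_upwards [eventually_extChartAt_symm x hself (((h0.and hf).and (hV.mem_nhds hxV)).and
      (extChartAt_source_mem_nhds (I := 𝓡 m) x)), extChartAt_target_mem_nhds (I := 𝓡 m) x]
      with z hz hzt hz0
    obtain ⟨⟨⟨h1, h2⟩, h3⟩, h4⟩ := hz
    obtain ⟨h5, h6⟩ := h1 ((hmem _ h3).2 hz0)
    refine ⟨h5, ?_⟩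
    ext v
    obtain ⟨w, rfl⟩ := (bijective_mfderiv_extChartAt x h4).2 v
    have h7 := mfderiv_eq_fderiv_comp_mfderiv_extChartAt x h4 h2 w
    rw [h6, (extChartAt (𝓡 m) x).right_inv hzt] at h7
    exact h7.symm
  · intro w hw
    exact hpos w fun h => hw ((hiff w).1 h)

end MorseBott

namespace RealDivisor

section

variable {m : ℕ} {N : Type u} [TopologicalSpace N] [ChartedSpace (EuclideanSpace ℝ (Fin m)) N]
  {δ : RealDivisor.{u, v} m N}

theorem frequently_notMem_locus (δ : RealDivisor.{u, v} m N) (x : N) :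
    ∃ᶠ y in 𝓝 x, y ∉ δ.locus := by
  refine ((frequently_localRep_ne_zero (δ := δ) x).and_eventually (δ.trivSet_mem_nhds x)).mono ?_
  rintro y ⟨h1, h2⟩ h3
  exact h1 ((localRep_eq_zero_iff h2).2 h3)

/-- The unit is the transition function of the line bundle. The elliptic condition at `y` is stated
in the trivialisation at `y` itself; this transports it to a single representative valid on a whole
neighbourhood of `x`. -/
theorem associated_localRep_localRep {x y : N} (hy : y ∈ δ.trivSet x) :
    SmoothAssociatedAt m (δ.localRep x) (δ.localRep y) y := by
  have hsm : ∀ x, δ.IsSmoothDualOn (δ.trivSet x) (δ.coframe x) :=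
    fun x z hz => (contMDiffAt_coframe hz).contMDiffWithinAt
  obtain ⟨a, ha, ha'⟩ := (hsm x).exists_eq_mul_localRep (δ.isOpen_trivSet x) y
  obtain ⟨b, hb, hb'⟩ := (hsm y).exists_eq_mul_localRep (δ.isOpen_trivSet y) x
  have hx' := (δ.isOpen_trivSet x).mem_nhds hy
  refine SmoothAssociatedAt.of_mul_of_mul (a := a) (b := b) ?_
    (hb y ⟨δ.mem_trivSet y, hy⟩).continuousAt ?_ ?_ ?_
  · filter_upwards [hx', δ.trivSet_mem_nhds y] with z h1 h2 using ha z ⟨h1, h2⟩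
  · filter_upwards [hx', δ.trivSet_mem_nhds y] with z h1 h2
    rw [← ha' z ⟨h1, h2⟩, coframe_apply h1]
  · filter_upwards [hx', δ.trivSet_mem_nhds y] with z h1 h2
    rw [← hb' z ⟨h2, h1⟩, coframe_apply h2]
  · refine ((δ.frequently_notMem_locus y).and_eventually hx').mono ?_
    rintro z ⟨h1, h2⟩ h3
    exact h1 ((localRep_eq_zero_iff h2).1 h3)

/-- A unit multiplies the Hessian by a nonzero constant, so criticality and definiteness survive,
though the sign may flip. -/
theorem IsSmoothElliptic.of_associated [IsManifold (𝓡 m) ∞ N] (hδ : δ.IsSmoothElliptic)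
    {f : N → ℝ} {x : N} (hf : SmoothAssociatedAt m f (δ.localRep x) x) (hx : x ∈ δ.locus) :
    mfderiv (𝓡 m) 𝓘(ℝ, ℝ) f x = 0 ∧
      ((∀ w ∉ tangentSpaceOf m δ.locus x, 0 < hessianAt m f x w w) ∨
        (∀ w ∉ tangentSpaceOf m δ.locus x, hessianAt m f x w w < 0)) := by
  obtain ⟨h1, h2⟩ := hδ.2 x hx
  obtain ⟨h3, c, hc, h4⟩ := hf.mfderiv_hessianAt (localRep_contMDiffAt (δ.mem_trivSet x))
    ((localRep_eq_zero_iff (δ.mem_trivSet x)).2 hx) h1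
  refine ⟨h3, ?_⟩
  have h5 : ∀ w, hessianAt m f x w w = c * hessianAt m (δ.localRep x) x w w := fun w => by
    rw [h4]
    rfl
  simp only [h5]
  rcases lt_or_gt_of_ne hc with hc | hc <;> rcases h2 with h2 | h2
  · exact Or.inr fun w hw => mul_neg_of_neg_of_pos hc (h2 w hw)
  · exact Or.inl fun w hw => mul_pos_of_neg_of_neg hc (h2 w hw)
  · exact Or.inl fun w hw => mul_pos hc (h2 w hw)
  · exact Or.inr fun w hw => mul_neg_of_pos_of_neg hc (h2 w hw)

/-- With the sign that makes the normal Hessian positive at `x`, the representative is of Morse–Bott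
type and hence non-negative near `x`. This produces the functions `f_i ≥ 0`. -/
theorem IsSmoothElliptic.exists_sign [IsManifold (𝓡 m) ∞ N] (hδ : δ.IsSmoothElliptic)
    {x : N} (hx : x ∈ δ.locus) :
    ∃ s : ℝ, s ≠ 0 ∧ ∀ᶠ y in 𝓝 x, 0 ≤ s * δ.localRep x y := by
  have hself := δ.trivSet_mem_nhds x
  have key : ∀ s : ℝ, s ≠ 0 →
      (∀ w ∉ tangentSpaceOf m δ.locus x, 0 < hessianAt m (fun y => s * δ.localRep x y) x w w) →
      ∀ᶠ y in 𝓝 x, 0 ≤ s * δ.localRep x y := by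
    intro s hs hpos
    refine eventually_nonneg_of_hessianAt_pos hδ.1 hx ?_ ?_ hpos
    · filter_upwards [hself] with y hy
      exact contMDiffAt_const.mul (localRep_contMDiffAt hy)
    · filter_upwards [hself] with y hy hyl
      refine ⟨by rw [(localRep_eq_zero_iff hy).2 hyl, mul_zero], (hδ.of_associated ?_ hyl).1⟩
      refine SmoothAssociatedAt.trans ?_ (associated_localRep_localRep hy)
      exact ⟨fun _ => s, hs, Eventually.of_forall fun z => ⟨contMDiffAt_const, rfl⟩⟩
  rcases (hδ.2 x hx).2 with h | h
  · refine ⟨1, one_ne_zero, key 1 one_ne_zero ?_⟩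
    simpa only [one_mul] using h
  · refine ⟨-1, by norm_num, key (-1) (by norm_num) ?_⟩
    intro w hw
    have h1 : SmoothAssociatedAt m (fun y => -1 * δ.localRep x y) (δ.localRep x) x :=
      ⟨fun _ => -1, by norm_num, Eventually.of_forall fun z => ⟨contMDiffAt_const, rfl⟩⟩
    have h2 : hessianAt m (fun y => -1 * δ.localRep x y) x w w =
        - hessianAt m (δ.localRep x) x w w := by
      have h3 : (fun y => -1 * δ.localRep x y) = -δ.localRep x := by
        ext y
        simp
      rw [h3]
      have h4 : ∀ g : EuclideanSpace ℝ (Fin m) → ℝ, fderiv ℝ (-g) = -fderiv ℝ g :=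
        fun g => funext fun z => fderiv_neg
      have h5 : ∀ p v : EuclideanSpace ℝ (Fin m),
          fderiv ℝ (fderiv ℝ (-(δ.localRep x ∘ (extChartAt (𝓡 m) x).symm))) p v v =
          - fderiv ℝ (fderiv ℝ (δ.localRep x ∘ (extChartAt (𝓡 m) x).symm)) p v v := by
        intro p v
        rw [h4, fderiv_neg]
        rfl
      exact h5 _ w
    rw [h2]
    linarith [h w hw]

end

/-! ### Normal crossings as products of local representatives. -/

section LocalMultiples

variable {m : ℕ} {N : Type u} [TopologicalSpace N] [ChartedSpace (EuclideanSpace ℝ (Fin m)) N]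

theorem _root_.ContMDiffMap.finset_prod_apply {ι : Type*} (s : Finset ι)
    (F : ι → C^∞⟮𝓡 m, N; 𝓘(ℝ, ℝ), ℝ⟯) (y : N) : (∏ i ∈ s, F i) y = ∏ i ∈ s, F i y := by
  classical
  induction s using Finset.induction_on with
  | empty => simp
  | insert i s hi ih =>
    rw [Finset.prod_insert hi, Finset.prod_insert hi, ContMDiffMap.coe_mul, Pi.mul_apply, ih]

/-- The ideal of the functions that are smooth multiples of `P` on `V`. -/
def localMultiples (m : ℕ) {N : Type u} [TopologicalSpace N]
    [ChartedSpace (EuclideanSpace ℝ (Fin m)) N] (V : Set N) (P : N → ℝ) :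
    Ideal C^∞⟮𝓡 m, N; 𝓘(ℝ, ℝ), ℝ⟯ where
  carrier := {g | ∃ b : N → ℝ, (∀ y ∈ V, ContMDiffAt (𝓡 m) 𝓘(ℝ, ℝ) ∞ b y) ∧
    ∀ y ∈ V, g y = b y * P y}
  add_mem' := by
    rintro g h ⟨b, hb, hg⟩ ⟨c, hc, hh⟩
    exact ⟨fun y => b y + c y, fun y hy => (hb y hy).add (hc y hy), fun y hy => by
      rw [ContMDiffMap.coe_add, Pi.add_apply, hg y hy, hh y hy, add_mul]⟩
  zero_mem' := ⟨fun _ => 0, fun _ _ => contMDiffAt_const, fun y _ => by simp⟩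
  smul_mem' := by
    rintro a g ⟨b, hb, hg⟩
    exact ⟨fun y => a y * b y, fun y hy => a.contMDiff.contMDiffAt.mul (hb y hy), fun y hy => by
      rw [smul_eq_mul, ContMDiffMap.coe_mul, Pi.mul_apply, hg y hy, mul_assoc]⟩

/-- Elements of a product of ideals are sums of products; since the local multiples form an ideal,
only products of elements need to be checked. -/
theorem prod_le_localMultiples {ι : Type*} (s : Finset ι) {V : Set N}
    {I : ι → Ideal C^∞⟮𝓡 m, N; 𝓘(ℝ, ℝ), ℝ⟯} {P : ι → N → ℝ}
    (h : ∀ i ∈ s, I i ≤ localMultiples m V (P i)) :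
    ∏ i ∈ s, I i ≤ localMultiples m V (fun y => ∏ i ∈ s, P i y) := by
  classical
  induction s using Finset.induction_on with
  | empty =>
    intro g _
    exact ⟨g, fun y _ => g.contMDiff.contMDiffAt, fun y _ => by simp⟩
  | insert i s hi ih =>
    rw [Finset.prod_insert hi, Ideal.mul_le]
    intro g hg g' hg'
    obtain ⟨b, hb, hgb⟩ := h i (by simp) hg
    obtain ⟨c, hc, hgc⟩ := ih (fun j hj => h j (by simp [hj])) hg'
    refine ⟨fun y => b y * c y, fun y hy => (hb y hy).mul (hc y hy), fun y hy => ?_⟩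
    rw [ContMDiffMap.coe_mul, Pi.mul_apply, hgb y hy, hgc y hy]
    simp only [Finset.prod_insert hi]
    ring

theorem ideal_le_localMultiples (δ : RealDivisor.{u, v} m N) {V : Set N} {x : N}
    (hV : V ⊆ δ.trivSet x) : δ.ideal ≤ localMultiples m V (δ.localRep x) := by
  rintro g ⟨α, hα, hg⟩
  obtain ⟨a, ha, ha'⟩ := hα.exists_eq_mul_localRep isOpen_univ x
  exact ⟨a, fun y hy => ha y ⟨mem_univ y, hV hy⟩,
    fun y hy => (hg y).trans (ha' y ⟨mem_univ y, hV hy⟩)⟩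

end LocalMultiples

section NormalCrossing

variable {m : ℕ} {M : Type u} [TopologicalSpace M] [ChartedSpace (EuclideanSpace ℝ (Fin m)) M]
  [IsManifold (𝓡 m) ∞ M] [T2Space M] {δ : RealDivisor.{u, v} m M}

/-- Locally a normal crossing divisor is the product of the crossing smooth divisors. -/
theorem IsLocalNormalCrossing.associated {U : TopologicalSpace.Opens M} {j : ℕ}
    {ε : Fin j → RealDivisor.{u, 0} m U} (hε : δ.IsLocalNormalCrossing U ε) (x : U) :
    SmoothAssociatedAt m (fun y : U => δ.localRep x.1 y) (fun y => ∏ i, (ε i).localRep x y) x := by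
  set V : Set U := ⋂ i, (ε i).trivSet x with hVdef
  have hV : V ∈ 𝓝 x := iInter_mem.2 fun i => (ε i).trivSet_mem_nhds x
  obtain ⟨χ, hχ, hs, hχ1⟩ := exists_contMDiff_eventually_eq_one (m := m) x hV
  -- Both divisibilities come from cut-offs: the product of the cut-off representatives of the `ε i`
  -- lies in `I_q(U)`, and the cut-off representative of `δ` lies in the product of the ideals.
  have h1 := fun i => exists_mem_ideal_cutoff (δ := ε i) hχ (hs.trans (iInter_subset _ i))
  choose F hF hFy using h1
  have h2 : ∏ i, F i ∈ δ.idealOn U := by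
    rw [hε.2.2]
    exact Ideal.prod_mem_prod fun i _ => hF i
  obtain ⟨α, hα, hαy⟩ := h2
  obtain ⟨a, ha, ha'⟩ := hα.exists_eq_mul_localRep U.isOpen x.1
  obtain ⟨χ', hχ', hs', hχ1'⟩ := exists_contMDiff_eventually_eq_one (m := m) x.1
    (δ.trivSet_mem_nhds x.1)
  obtain ⟨g, hg, hgy⟩ := exists_mem_idealOn_cutoff hχ' hs' U
  rw [hε.2.2] at hg
  obtain ⟨b, hb, hb'⟩ := prod_le_localMultiples (V := V) Finset.univ
    (fun i _ => (ε i).ideal_le_localMultiples (iInter_subset _ i)) hg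
  refine SmoothAssociatedAt.of_mul_of_mul (a := b) (b := fun y : U => a y) ?_ ?_ ?_ ?_ ?_
  · filter_upwards [eventually_mem_nhds_iff.2 hV] with y hy using hb y (mem_of_mem_nhds hy)
  · exact (contMDiffAt_subtype_iff.2 (ha x.1 ⟨x.2, δ.mem_trivSet _⟩)).continuousAt
  · filter_upwards [hV, eventually_val_iff.2 hχ1'] with y hy hy1
    have h3 := hgy y
    rw [hy1, one_mul] at h3
    rw [← h3, hb' y hy]
  · filter_upwards [hχ1, eventually_val_iff.2 (δ.trivSet_mem_nhds x.1)] with y hy1 hy2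
    have h3 := hαy y
    rw [ha' y.1 ⟨y.2, hy2⟩] at h3
    rw [← h3]
    rw [ContMDiffMap.finset_prod_apply]
    refine Finset.prod_congr rfl fun i _ => ?_
    rw [hFy i y, hy1, one_mul]
  · intro h
    exact frequently_localRep_ne_zero (δ := δ) x.1
      (eventually_val_iff (p := fun y => ¬ δ.localRep x.1 y ≠ 0).1 h)

end NormalCrossing

end RealDivisor

/-! ### Shrinking a crossing, dropping divisors, and crossings given by non-negative functions. -/

namespace RealDivisor

section NormalCrossing

variable {m : ℕ} {M : Type u} [TopologicalSpace M] [ChartedSpace (EuclideanSpace ℝ (Fin m)) M]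
  {δ : RealDivisor.{u, v} m M}

theorem mem_image_locus_iff {U : TopologicalSpace.Opens M} {ε : RealDivisor.{u, 0} m U} {f : M → ℝ}
    {y : U} (hf : SmoothAssociatedAt m (fun z : U => f z) (ε.localRep y) y) :
    f y = 0 ↔ y ∈ ε.locus :=
  hf.eq_zero_iff.trans (localRep_eq_zero_iff (ε.mem_trivSet y))

theorem mem_stratum_iff {n : ℕ} {x : M} : x ∈ δ.stratum n ↔ δ.pointIntersectionNumber x = n := by
  simp only [stratum, filtration, Set.mem_sdiff, mem_ofPred_eq]
  omega

variable [IsManifold (𝓡 m) ∞ M] [T2Space M]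

/-- Functions that generate some of the ideals of a normal crossing give a normal crossing if their
product is a local representative of the divisor up to units. -/
theorem IsLocalNormalCrossing.ofFunction {U V : TopologicalSpace.Opens M} (hVU : V ≤ U) {j k : ℕ}
    {ε : Fin j → RealDivisor.{u, 0} m U} (hε : δ.IsLocalNormalCrossing U ε) {ι : Fin k → Fin j}
    (hι : Function.Injective ι) {f : Fin k → M → ℝ}
    (hf : ∀ i, ∀ y ∈ V, ContMDiffAt (𝓡 m) 𝓘(ℝ, ℝ) ∞ (f i) y)
    (hfε : ∀ i (y : V), SmoothAssociatedAt m (fun z : U => f i z)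
      ((ε (ι i)).localRep ⟨y.1, hVU y.2⟩) ⟨y.1, hVU y.2⟩)
    {x : M} (hx : (V : Set M) ⊆ δ.trivSet x) {a : M → ℝ}
    (ha : ∀ y ∈ V, ContMDiffAt (𝓡 m) 𝓘(ℝ, ℝ) ∞ a y) (ha0 : ∀ y ∈ V, a y ≠ 0)
    (hprod : ∀ y ∈ V, δ.localRep x y = a y * ∏ i, f i y)
    {g : Fin k → C^∞⟮𝓡 m, V; 𝓘(ℝ, ℝ), ℝ⟯} (hg : ∀ i (y : V), g i y = f i y) :
    ∃ nd : ∀ i, IsNowhereDense {y | g i y = 0},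
      δ.IsLocalNormalCrossing V (fun i => RealDivisor.ofFunction (g i) (nd i)) := by
  have hgf : ∀ i, (g i : V → ℝ) = fun y : V => f i y := fun i => funext (hg i)
  have nd : ∀ i, IsNowhereDense {y | g i y = 0} := by
    intro i
    have hcl : IsClosed {y | g i y = 0} :=
      isClosed_eq (g i).contMDiff.continuous continuous_const
    rw [hcl.isNowhereDense_iff, eq_empty_iff_forall_notMem]
    intro y hy
    -- A factor vanishing on an open set would make `q` vanish there, against the nowhere density of
    -- its zeros.
    have h1 : ∀ᶠ z : V in 𝓝 y, z.1 ∈ δ.locus := by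
      filter_upwards [mem_interior_iff_mem_nhds.1 hy] with z hz
      rw [← localRep_eq_zero_iff (hx z.2), hprod z.1 z.2,
        Finset.prod_eq_zero (Finset.mem_univ i) ((hg i z).symm.trans hz), mul_zero]
    refine δ.frequently_notMem_locus y.1 ?_
    simpa only [not_not] using eventually_val_iff.1 h1
  have hloc : ∀ i (y : V), y ∈ (RealDivisor.ofFunction (g i) (nd i)).locus ↔
      (⟨y.1, hVU y.2⟩ : U) ∈ (ε (ι i)).locus := by
    intro i y
    rw [← mem_image_locus_iff (hfε i y), ofFunction_locus]
    change g i y = 0 ↔ _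
    rw [hg i y]
  set S : Fin k → Set M := fun i => Subtype.val '' (ε (ι i)).locus with hS
  have hSU : ∀ i (y : U), y ∈ (ε (ι i)).locus ↔ y.1 ∈ S i := fun i y =>
    (Subtype.val_injective.mem_set_image).symm
  have hSV : ∀ i (y : V), y ∈ (RealDivisor.ofFunction (g i) (nd i)).locus ↔ y.1 ∈ S i := fun i y =>
    (hloc i y).trans (hSU i ⟨y.1, hVU y.2⟩)
  have hT : ∀ i (y : V) (w : EuclideanSpace ℝ (Fin m)),
      w ∈ tangentSpaceOf m (RealDivisor.ofFunction (g i) (nd i)).locus y ↔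
        w ∈ tangentSpaceOf m (ε (ι i)).locus (⟨y.1, hVU y.2⟩ : U) := fun i y w =>
    (mem_tangentSpaceOf_opens_iff (Eventually.of_forall (hSV i)) w).trans
      (mem_tangentSpaceOf_opens_iff (y := ⟨y.1, hVU y.2⟩) (Eventually.of_forall (hSU i)) w).symm
  refine ⟨nd, fun i => ⟨?_, fun y hy => ?_⟩, fun y w => ?_, ?_⟩
  · have h1 := ((hε.1 (ι i)).1.image_val).preimage_val V
    have h2 : (RealDivisor.ofFunction (g i) (nd i)).locus = Subtype.val ⁻¹' S i :=
      Set.ext (hSV i)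
    rw [h2]
    exact h1
  · obtain ⟨h1, h2⟩ := (hε.1 (ι i)).of_associated (hfε i y) ((hloc i y).1 hy)
    rw [ofFunction_localRep, hgf i]
    have hsm := hf i y.1 y.2
    have hess : ∀ w : EuclideanSpace ℝ (Fin m), hessianAt m (fun y : V => f i y) y w w =
        hessianAt m (fun z : U => f i z) ⟨y.1, hVU y.2⟩ w w := fun w =>
      (hessianAt_comp_val (f i) y w w).trans
        (hessianAt_comp_val (f i) (⟨y.1, hVU y.2⟩ : U) w w).symm
    refine ⟨?_, ?_⟩
    · ext w
      have h3 := (mfderiv_comp_val hsm w).trans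
        (mfderiv_comp_val (y := (⟨y.1, hVU y.2⟩ : U)) hsm w).symm
      rw [h1] at h3
      exact h3
    · refine h2.imp (fun h w hw => ?_) (fun h w hw => ?_)
      · exact (h w fun h' => hw ((hT i y w).2 h')).trans_eq (hess w).symm
      · exact (hess w).trans_lt (h w fun h' => hw ((hT i y w).2 h'))
  · let w' : Fin k → EuclideanSpace ℝ (Fin m) := w
    -- Transversality of the selected divisors follows from that of the whole family, with the
    -- arbitrary target `0` for the divisors outside the range of `ι`.
    obtain ⟨z, hz⟩ := hε.2.1 ⟨y.1, hVU y.2⟩ (Function.extend ι w' 0)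
    refine ⟨z, fun i hi => (hT i y _).2 ?_⟩
    have h1 := hz (ι i) ((hloc i y).1 hi)
    have h2 : Function.extend ι w' 0 (ι i) = w' i := hι.extend_apply _ _ _
    let z' : EuclideanSpace ℝ (Fin m) := z
    exact (congrArg (fun v : EuclideanSpace ℝ (Fin m) =>
      (z' - v) ∈ tangentSpaceOf m (ε (ι i)).locus ⟨y.1, hVU y.2⟩) h2).mp h1
  · simp only [ofFunction_ideal]
    rw [Ideal.prod_span_singleton]
    ext h
    rw [mem_idealOn_iff hx, Ideal.mem_span_singleton']
    constructor
    · rintro ⟨b, hb, hh⟩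
      refine ⟨⟨fun y : V => b y * a y, fun y => contMDiffAt_subtype_iff.2
        ((hb y y.2).mul (ha y y.2))⟩, ?_⟩
      ext y
      change b y * a y * (∏ i, g i) y = h y
      rw [ContMDiffMap.finset_prod_apply, hh y, hprod y y.2, ← mul_assoc]
      simp only [hg]
    · rintro ⟨b, rfl⟩
      refine ⟨fun y => Function.extend Subtype.val b 0 y * (a y)⁻¹, fun y hy => ?_, fun y => ?_⟩
      · have h1 : ContMDiffAt (𝓡 m) 𝓘(ℝ, ℝ) ∞ (Function.extend Subtype.val b 0) y :=
          contMDiffAt_extend_val (y := ⟨y, hy⟩) b.contMDiff.contMDiffAt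
        exact h1.mul ((contDiffAt_inv ℝ (ha0 y hy)).contMDiffAt.comp y (ha y hy))
      · beta_reduce
        rw [Subtype.val_injective.extend_apply, ContMDiffMap.coe_mul, Pi.mul_apply,
          ContMDiffMap.finset_prod_apply, hprod y y.2]
        simp only [hg]
        have := ha0 y y.2
        field_simp

/-- A normal crossing can be restricted to small neighbourhoods of `x`, the divisors that do not
pass through `x` being dropped, and the others being given by functions. -/
theorem IsLocalNormalCrossing.exists_ofFunction {U : TopologicalSpace.Opens M} {j k : ℕ}
    {ε : Fin j → RealDivisor.{u, 0} m U} (hε : δ.IsLocalNormalCrossing U ε) (x : U)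
    {ι : Fin k → Fin j} (hι : Function.Injective ι)
    (hout : ∀ i ∉ range ι, x ∉ (ε i).locus) {s : Fin k → ℝ} (hs : ∀ i, s i ≠ 0)
    {W : Set U} (hW : W ∈ 𝓝 x) :
    ∃ V : TopologicalSpace.Opens M, x.1 ∈ V ∧ ∃ hVU : V ≤ U, (∀ y : V, ⟨y.1, hVU y.2⟩ ∈ W) ∧
      ∃ g : Fin k → C^∞⟮𝓡 m, V; 𝓘(ℝ, ℝ), ℝ⟯,
      (∀ i (y : V), g i y = s i * (ε (ι i)).localRep x ⟨y.1, hVU y.2⟩) ∧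
      ∃ nd : ∀ i, IsNowhereDense {y | g i y = 0},
        δ.IsLocalNormalCrossing V (fun i => RealDivisor.ofFunction (g i) (nd i)) := by
  classical
  -- the product over the selected divisors represents the divisor
  have hA : SmoothAssociatedAt m (fun y : U => δ.localRep x.1 y)
      (fun y => ∏ i, s i * (ε (ι i)).localRep x y) x := by
    -- The representative of a divisor that misses `x` is a unit at `x` and is replaced by `1`.
    have hB : SmoothAssociatedAt m (fun y => ∏ i, (ε i).localRep x y)
        (fun y => ∏ i, if i ∈ range ι then (ε i).localRep x y else 1) x := by
      refine SmoothAssociatedAt.prod _ fun i _ => ?_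
      by_cases hi : i ∈ range ι
      · simp only [hi, if_true]
        exact .refl _ _
      · simp only [hi, if_false]
        refine SmoothAssociatedAt.of_ne_zero ?_ fun h => hout i hi
          ((localRep_eq_zero_iff ((ε i).mem_trivSet x)).1 h)
        filter_upwards [(ε i).trivSet_mem_nhds x] with y hy using localRep_contMDiffAt hy
    have hC : ∀ y, (∏ i, if i ∈ range ι then (ε i).localRep x y else 1) =
        ∏ i, (ε (ι i)).localRep x y := by
      intro y
      rw [← Finset.prod_filter, ← Finset.prod_image (s := Finset.univ) (g := ι)
        (f := fun i => (ε i).localRep x y) hι.injOn]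
      exact Finset.prod_congr (by ext; simp) fun _ _ => rfl
    simp only [hC] at hB
    refine (hε.associated x).trans (hB.trans ?_)
    refine SmoothAssociatedAt.prod _ fun i _ => ?_
    exact SmoothAssociatedAt.symm
      ⟨fun _ => s i, hs i, Eventually.of_forall fun z => ⟨contMDiffAt_const, rfl⟩⟩
  obtain ⟨a, ha0, ha⟩ := hA
  have hV0 : ∀ᶠ y in 𝓝 x, y ∈ W ∧ (ContMDiffAt (𝓡 m) 𝓘(ℝ, ℝ) ∞ a y ∧
      δ.localRep x.1 y = a y * ∏ i, s i * (ε (ι i)).localRep x y) ∧ a y ≠ 0 ∧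
      y.1 ∈ δ.trivSet x.1 ∧ ∀ i, y ∈ (ε (ι i)).trivSet x :=
    Eventually.and hW (ha.and ((ha.self_of_nhds.1.continuousAt.eventually_ne ha0).and
      ((eventually_val_iff.2 (δ.trivSet_mem_nhds x.1)).and
        (eventually_all.2 fun i => (ε (ι i)).trivSet_mem_nhds x))))
  obtain ⟨V0, hV0, hV0o, hxV0⟩ := eventually_nhds_iff.1 hV0
  set V : TopologicalSpace.Opens M :=
    ⟨Subtype.val '' V0, U.isOpen.isOpenEmbedding_subtypeVal.isOpenMap V0 hV0o⟩ with hVdef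
  have hVU : V ≤ U := by
    rintro _ ⟨y, -, rfl⟩
    exact y.2
  have hmem : ∀ y (hy : y ∈ V), (⟨y, hVU hy⟩ : U) ∈ V0 := by
    rintro _ ⟨y, hy, rfl⟩
    exact hy
  set f : Fin k → M → ℝ := fun i => Function.extend Subtype.val
    (fun y : U => s i * (ε (ι i)).localRep x y) 0 with hfdef
  have hfy : ∀ i (y : U), f i y = s i * (ε (ι i)).localRep x y := fun i y =>
    Subtype.val_injective.extend_apply _ _ y
  have hf : ∀ i, ∀ y ∈ V, ContMDiffAt (𝓡 m) 𝓘(ℝ, ℝ) ∞ (f i) y := fun i y hy =>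
    contMDiffAt_extend_val (y := ⟨y, hVU hy⟩) (contMDiffAt_const.mul
      (localRep_contMDiffAt ((hV0 _ (hmem y hy)).2.2.2.2 i)))
  refine ⟨V, ⟨x, hxV0, rfl⟩, hVU, fun y => (hV0 _ (hmem y y.2)).1,
    fun i => ⟨fun y : V => f i y, fun y => contMDiffAt_subtype_iff.2 (hf i y y.2)⟩,
    fun i y => hfy i ⟨y.1, hVU y.2⟩, ?_⟩
  refine hε.ofFunction hVU hι hf ?_ (x := x.1) (a := Function.extend Subtype.val a 0) ?_ ?_ ?_ ?_
    (fun i y => rfl)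
  · intro i y
    refine SmoothAssociatedAt.trans ?_
      (associated_localRep_localRep ((hV0 _ (hmem y y.2)).2.2.2.2 i))
    exact ⟨fun _ => s i, hs i, Eventually.of_forall fun z => ⟨contMDiffAt_const, hfy i z⟩⟩
  · exact fun y hy => (hV0 _ (hmem y hy)).2.2.2.1
  · exact fun y hy => contMDiffAt_extend_val (y := ⟨y, hVU hy⟩) (hV0 _ (hmem y hy)).2.1.1
  · intro y hy
    have h1 : Function.extend Subtype.val a 0 y = a ⟨y, hVU hy⟩ :=
      Subtype.val_injective.extend_apply a 0 (⟨y, hVU hy⟩ : U)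
    rw [h1]
    exact (hV0 _ (hmem y hy)).2.2.1
  · intro y hy
    have h1 : Function.extend Subtype.val a 0 y = a ⟨y, hVU hy⟩ :=
      Subtype.val_injective.extend_apply a 0 (⟨y, hVU hy⟩ : U)
    rw [h1, (hV0 _ (hmem y hy)).2.1.2]
    congr 1
    exact Finset.prod_congr rfl fun i _ => (hfy i ⟨y, hVU hy⟩).symm

/-- A divisor missing `x` could be dropped near `x`, leaving a crossing by `n - 1` divisors, against
the minimality of `n`. -/
theorem mem_locus_of_pointIntersectionNumber {U : TopologicalSpace.Opens M} {n : ℕ}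
    {ε : Fin n → RealDivisor.{u, 0} m U} (hε : δ.IsLocalNormalCrossing U ε) (x : U)
    (hx : δ.pointIntersectionNumber x = n) (i : Fin n) : x ∈ (ε i).locus := by
  by_contra hi
  obtain ⟨k, rfl⟩ : ∃ k, n = k + 1 := ⟨n - 1, by have := i.pos; omega⟩
  obtain ⟨V, hxV, hVU, -, g, -, nd, h⟩ := hε.exists_ofFunction x
    (ι := i.succAbove) Fin.succAbove_right_injective (by
      intro l hl
      rw [Fin.range_succAbove, mem_compl_iff, not_not] at hl
      rwa [hl]) (s := fun _ => 1) (fun _ => one_ne_zero) univ_mem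
  have h1 : δ.pointIntersectionNumber x.1 ≤ k := Nat.sInf_le ⟨V, hxV, _, h⟩
  omega

/-- A crossing realising the minimum has all its divisors through `x`, so each has a representative
of constant sign near `x`. After restriction these signed representatives generate the ideals. -/
theorem exists_localChoice (hδ : δ.IsElliptic) {n : ℕ} {x : M} (hx : x ∈ δ.stratum n) :
    Nonempty (δ.LocalChoice n x) := by
  rw [mem_stratum_iff] at hx
  have h1 : n ∈ {j | δ.HasNormalCrossing x j} := by
    rw [← hx]
    exact Nat.sInf_mem (hδ x)
  obtain ⟨U, hxU, ε, hε⟩ := h1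
  have h2 := fun i => (hε.1 i).exists_sign (x := ⟨x, hxU⟩)
    (mem_locus_of_pointIntersectionNumber hε ⟨x, hxU⟩ hx i)
  choose s hs hpos using h2
  obtain ⟨V, hxV, hVU, hW, g, hg, nd, h⟩ := hε.exists_ofFunction ⟨x, hxU⟩
    (ι := id) Function.injective_id (fun i hi => absurd ⟨i, rfl⟩ hi) hs (eventually_all.2 hpos)
  exact ⟨⟨V, hxV, _, h, g, fun i y => (hW y i).trans_eq (hg i y).symm,
    fun i => ofFunction_ideal _ _⟩⟩

end NormalCrossing

end RealDivisor

/-! ### Linear algebra of the tangent spaces, the normal forms and the structure group. -/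

/-- A vector space over an infinite field is not a finite union of proper subspaces; this is applied
to the traces of the `W i` on `P`. -/
theorem Submodule.exists_le_of_subset_iUnion {E : Type*} [AddCommGroup E] [Module ℝ E]
    {ι : Type*} [Finite ι] {P : Submodule ℝ E} {W : ι → Submodule ℝ E}
    (h : (P : Set E) ⊆ ⋃ i, (W i : Set E)) : ∃ i, P ≤ W i := by
  obtain ⟨i, hi⟩ := Subspace.exists_eq_top_of_iUnion_eq_univ
    (p := fun i => (W i).comap P.subtype) (by
      rw [eq_univ_iff_forall]
      intro x
      obtain ⟨i, hi⟩ := mem_iUnion.1 (h x.2)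
      exact mem_iUnion.2 ⟨i, hi⟩)
  exact ⟨i, fun x hx => by
    have : (⟨x, hx⟩ : P) ∈ (W i).comap P.subtype := hi ▸ Submodule.mem_top
    exact this⟩

section NormalForms

variable {E : Type*} [AddCommGroup E] [Module ℝ E] [TopologicalSpace E]

/-- `B` is a symmetric bilinear form with kernel `W` that is positive definite modulo `W`. -/
structure IsNormalForm (W : Submodule ℝ E) (B : E →L[ℝ] E →L[ℝ] ℝ) : Prop where
  symm : ∀ v w, B v w = B w v
  ker : ∀ w ∈ W, ∀ v, B w v = 0
  pos : ∀ w ∉ W, 0 < B w w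

namespace IsNormalForm

variable {W : Submodule ℝ E} {B : E →L[ℝ] E →L[ℝ] ℝ}

theorem ker_right (h : IsNormalForm W B) {w : E} (hw : w ∈ W) (v : E) : B v w = 0 := by
  rw [h.symm, h.ker w hw]

theorem apply_self_eq_zero_iff (h : IsNormalForm W B) (v : E) : B v v = 0 ↔ v ∈ W := by
  refine ⟨fun h0 => ?_, fun hv => h.ker v hv v⟩
  by_contra hv
  exact (h.pos v hv).ne' h0

theorem congr (h : IsNormalForm W B) {v v' w w' : E} (hv : v - v' ∈ W) (hw : w - w' ∈ W) :
    B v w = B v' w' := by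
  have h1 := h.ker _ hv w
  have h2 := h.ker_right hw v'
  rw [map_sub, sub_apply] at h1
  rw [map_sub] at h2
  linarith

theorem add_self_eq (h : IsNormalForm W B) (v : E) {w : E} (hw : w ∈ W) :
    B (v + w) (v + w) = B v v := h.congr (by simpa) (by simpa)

end IsNormalForm

/-- The vectors `z (i, a)` are orthonormal for `B i` and tangent to the other subspaces `W k`. -/
structure IsOrthonormalLift {n : ℕ} (W : Fin n → Submodule ℝ E) (B : Fin n → E →L[ℝ] E →L[ℝ] ℝ)
    (z : Fin n × Fin 2 → E) : Prop where
  mem : ∀ i k, k ≠ i → ∀ a, z (i, a) ∈ W k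
  orth : ∀ i a b, B i (z (i, a)) (z (i, b)) = if a = b then 1 else 0

namespace IsOrthonormalLift

variable {n : ℕ} {W : Fin n → Submodule ℝ E} {B : Fin n → E →L[ℝ] E →L[ℝ] ℝ}
  {z : Fin n × Fin 2 → E}

theorem notMem (hz : IsOrthonormalLift W B z) (hB : ∀ i, IsNormalForm (W i) (B i)) (i : Fin n)
    (a : Fin 2) : z (i, a) ∉ W i := by
  intro h
  have := hz.orth i a a
  rw [(hB i).ker _ h] at this
  simp at this

/-- For `i ≠ k` the vector `z (k, 0)` lies in `W i` but not in `W k`. -/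
theorem eq_of_le (hz : IsOrthonormalLift W B z) (hB : ∀ i, IsNormalForm (W i) (B i)) {i k : Fin n}
    (h : W i ≤ W k) : i = k := by
  by_contra hik
  exact hz.notMem hB k 0 (h (hz.mem k i hik 0))

/-- Since `B k` kills the vectors of the other planes, pairing with `z (k, b)` under `B k` extracts
the `(k, b)` coordinate. -/
theorem apply_eq (hz : IsOrthonormalLift W B z) (hB : ∀ i, IsNormalForm (W i) (B i))
    (k : Fin n) (b : Fin 2) (p : Fin n × Fin 2) :
    B k (z p) (z (k, b)) = if p = (k, b) then 1 else 0 := by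
  obtain ⟨i, a⟩ := p
  by_cases hik : i = k
  · subst hik
    rw [hz.orth]
    simp
  · rw [(hB k).ker _ (hz.mem i k (Ne.symm hik) a)]
    simp [hik]

theorem apply_sum (hz : IsOrthonormalLift W B z) (hB : ∀ i, IsNormalForm (W i) (B i))
    (c : Fin n × Fin 2 → ℝ) (k : Fin n) (b : Fin 2) :
    B k (∑ p, c p • z p) (z (k, b)) = c (k, b) := by
  simp [map_sum, sum_apply, hz.apply_eq hB]

theorem linearIndependent (hz : IsOrthonormalLift W B z) (hB : ∀ i, IsNormalForm (W i) (B i))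
    {T : Submodule ℝ E} (hT : ∀ i, T ≤ W i) : LinearIndependent ℝ (fun p => T.mkQ (z p)) := by
  rw [Fintype.linearIndependent_iff]
  rintro c hc ⟨k, b⟩
  have h1 : ∑ p, c p • z p ∈ T := by
    rw [← Submodule.Quotient.mk_eq_zero, ← Submodule.mkQ_apply, map_sum]
    simpa only [map_smul] using hc
  rw [← hz.apply_sum hB c k b, (hB k).ker _ (hT k h1)]

/-- The forms and subspaces of two crossings with proportional products agree up to a permutation
and positive factors. -/
theorem exists_perm {W' : Fin n → Submodule ℝ E} {B' : Fin n → E →L[ℝ] E →L[ℝ] ℝ}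
    {z' : Fin n × Fin 2 → E} (hz : IsOrthonormalLift W B z) (hB : ∀ i, IsNormalForm (W i) (B i))
    (hz' : IsOrthonormalLift W' B' z') (hB' : ∀ i, IsNormalForm (W' i) (B' i)) {κ : ℝ}
    (hκ : κ ≠ 0) (hprod : ∀ v, ∏ i, B i v v = κ * ∏ i, B' i v v) :
    ∃ σ : Equiv.Perm (Fin n), ∀ i, W' i = W (σ i) ∧ ∃ l : ℝ, 0 < l ∧ ∀ v w,
      (∀ k ≠ σ i, v ∈ W k) → (∀ k ≠ σ i, w ∈ W k) → B (σ i) v w = l * B' i v w := by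
  -- The two products have the same zero set, which is the union of the `W j` and also the union of
  -- the `W' i`.
  have h1 : ∀ i, ∃ j, W' i ≤ W j := by
    intro i
    refine Submodule.exists_le_of_subset_iUnion fun v hv => ?_
    have h2 : ∏ i, B' i v v = 0 := Finset.prod_eq_zero (Finset.mem_univ i) ((hB' i).ker v hv v)
    have h3 := hprod v
    rw [h2, mul_zero, Finset.prod_eq_zero_iff] at h3
    obtain ⟨j, -, hj⟩ := h3
    exact mem_iUnion.2 ⟨j, ((hB j).apply_self_eq_zero_iff v).1 hj⟩
  have h2 : ∀ j, ∃ i, W j ≤ W' i := by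
    intro j
    refine Submodule.exists_le_of_subset_iUnion fun v hv => ?_
    have h2 : ∏ i, B i v v = 0 := Finset.prod_eq_zero (Finset.mem_univ j) ((hB j).ker v hv v)
    have h3 := hprod v
    rw [h2, zero_eq_mul, or_iff_right hκ, Finset.prod_eq_zero_iff] at h3
    obtain ⟨i, -, hi⟩ := h3
    exact mem_iUnion.2 ⟨i, ((hB' i).apply_self_eq_zero_iff v).1 hi⟩
  choose τ hτ using h1
  choose τ' hτ' using h2
  have hl : ∀ i, τ' (τ i) = i := fun i => (hz'.eq_of_le hB' ((hτ i).trans (hτ' _))).symm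
  have hr : ∀ j, τ (τ' j) = j := fun j => (hz.eq_of_le hB ((hτ' j).trans (hτ _))).symm
  refine ⟨⟨τ, τ', hl, hr⟩, fun i => ?_⟩
  change W' i = W (τ i) ∧ ∃ l : ℝ, 0 < l ∧ ∀ v w, (∀ k ≠ τ i, v ∈ W k) →
      (∀ k ≠ τ i, w ∈ W k) → B (τ i) v w = l * B' i v w
  have hW : ∀ i, W' i = W (τ i) := fun i => le_antisymm (hτ i) (by
    have := hτ' (τ i)
    rwa [hl] at this)
  refine ⟨hW i, ?_⟩
  -- The vector `e` is invisible to `B (τ i)` and has length one for every other `B k`. For `v` in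
  -- the `τ i`-th summand, the product at `v + e` is therefore exactly `B (τ i) v v`, while on the
  -- other side only `B' i v v` depends on `v`.
  set e : E := ∑ k ∈ Finset.univ.erase (τ i), z (k, 0) with he
  have he1 : e ∈ W (τ i) := Submodule.sum_mem _ fun k hk =>
    hz.mem k _ (Finset.ne_of_mem_erase hk).symm 0
  have he2 : ∀ k ≠ τ i, B k e e = 1 := by
    intro k hk
    have hr : ∑ l ∈ (Finset.univ.erase (τ i)).erase k, z (l, 0) ∈ W k :=
      Submodule.sum_mem _ fun l hl => hz.mem l _ (Finset.ne_of_mem_erase hl).symm 0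
    rw [he, ← Finset.add_sum_erase _ _ (Finset.mem_erase.2 ⟨hk, Finset.mem_univ k⟩),
      (hB k).add_self_eq _ hr, hz.orth]
    simp
  set l : ℝ := κ * ∏ k ∈ Finset.univ.erase i, B' k e e with hl'
  have hquad : ∀ v, (∀ k ≠ τ i, v ∈ W k) → B (τ i) v v = l * B' i v v := by
    intro v hv
    have h3 := hprod (v + e)
    rw [← Finset.mul_prod_erase _ _ (Finset.mem_univ (τ i)), (hB _).add_self_eq v he1,
      Finset.prod_eq_one, mul_one, ← Finset.mul_prod_erase _ _ (Finset.mem_univ i),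
      (hB' i).add_self_eq v (hW i ▸ he1)] at h3
    · rw [h3, hl', mul_comm (B' i v v), ← mul_assoc]
      congr 2
      refine Finset.prod_congr rfl fun k hk => ?_
      rw [add_comm, (hB' k).add_self_eq]
      rw [hW k]
      exact hv _ fun h => Finset.ne_of_mem_erase hk (by rw [← hl k, h, hl])
    · intro k hk
      have hk := Finset.ne_of_mem_erase hk
      rw [add_comm, (hB k).add_self_eq _ (hv k hk), he2 k hk]
  -- The factor is positive because both quadratic forms are positive at `z (τ i, 0)`.
  have hlpos : 0 < l := by
    have h3 := hquad (z (τ i, 0)) fun k hk => hz.mem _ k hk 0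
    rw [hz.orth, if_pos rfl] at h3
    have h4 := (hB' i).pos (z (τ i, 0)) (by rw [hW i]; exact hz.notMem hB _ _)
    by_contra h5
    nlinarith
  refine ⟨l, hlpos, fun v w hv hw => ?_⟩
  -- Polarisation.
  have h3 := hquad (v + w) fun k hk => (W k).add_mem (hv k hk) (hw k hk)
  simp only [map_add, add_apply, hquad v hv, hquad w hw, (hB (τ i)).symm w v,
    (hB' i).symm w v] at h3
  linarith

/-- Two frames adapted to crossings with proportional products differ by an element of the
structure group. -/
theorem exists_isFrameTranslate {W' : Fin n → Submodule ℝ E} {B' : Fin n → E →L[ℝ] E →L[ℝ] ℝ}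
    {z' : Fin n × Fin 2 → E} (hz : IsOrthonormalLift W B z) (hB : ∀ i, IsNormalForm (W i) (B i))
    (hz' : IsOrthonormalLift W' B' z') (hB' : ∀ i, IsNormalForm (W' i) (B' i)) {κ : ℝ}
    (hκ : κ ≠ 0) (hprod : ∀ v, ∏ i, B i v v = κ * ∏ i, B' i v v)
    {T : Submodule ℝ E} (hT : ∀ i, T ≤ W i) {u u' : Module.Basis (Fin n × Fin 2) ℝ (E ⧸ T)}
    (hu : ∀ p, u p = T.mkQ (z p)) (hu' : ∀ p, u' p = T.mkQ (z' p)) :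
    ∃ g : WreathConformal n, IsFrameTranslate u (wreathHom n g) u' := by
  obtain ⟨σ, hσ⟩ := hz.exists_perm hB hz' hB' hκ hprod
  choose hW l hl hBl using hσ
  have hmem : ∀ i a, ∀ k ≠ σ i, z' (i, a) ∈ W k := by
    intro i a k hk
    have h1 := hz'.mem i (σ.symm k) (fun h => hk (by rw [← h, σ.apply_symm_apply])) a
    rwa [hW, σ.apply_symm_apply] at h1
  -- The `i`-th plane of `u'` is the `σ i`-th plane of `u`, and `A i` is the matrix of coordinates
  -- between them. Comparing the forms gives `Aᵀ A = l`, so `A` is `√l` times an orthogonal matrix.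
  set A : Fin n → Matrix (Fin 2) (Fin 2) ℝ :=
    fun i b a => B (σ i) (z' (i, a)) (z (σ i, b)) with hA
  have hexp : ∀ i a, z' (i, a) - ∑ b, A i b a • z (σ i, b) ∈ T := by
    intro i a
    set c : Fin n × Fin 2 → ℝ := fun p => u.repr (u' (i, a)) p with hc
    have h1 : z' (i, a) - ∑ p, c p • z p ∈ T := by
      rw [← Submodule.Quotient.mk_eq_zero, ← Submodule.mkQ_apply, map_sub, map_sum, ← hu',
        sub_eq_zero]
      simp only [map_smul, ← hu]
      exact (u.sum_repr (u' (i, a))).symm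
    have h2 : ∀ k b, c (k, b) = B k (z' (i, a)) (z (k, b)) := by
      intro k b
      rw [← hz.apply_sum hB c k b]
      exact (hB k).congr ((W k).neg_mem_iff.1 (by simpa using hT k h1)) (by simp)
    have h3 : ∑ p, c p • z p = ∑ b, A i b a • z (σ i, b) := by
      rw [Fintype.sum_prod_type, Finset.sum_eq_single (σ i)]
      · simp only [h2, hA]
      · intro k _ hk
        refine Finset.sum_eq_zero fun b _ => ?_
        rw [h2, (hB k).ker _ (hmem i a k hk), zero_smul]
      · simp
    rwa [h3] at h1
  have hAA : ∀ i, (A i).transpose * A i = l i • (1 : Matrix (Fin 2) (Fin 2) ℝ) := by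
    intro i
    ext a b
    have h1 := hBl i (z' (i, a)) (z' (i, b)) (hmem i a) (hmem i b)
    rw [hz'.orth, (hB (σ i)).congr (hT _ (hexp i a)) (hT _ (hexp i b))] at h1
    rw [Matrix.mul_apply, Matrix.smul_apply, Matrix.one_apply, smul_eq_mul, ← h1]
    simp [hz.orth, Matrix.transpose_apply]
  have hO : ∀ i, (Real.sqrt (l i))⁻¹ • A i ∈ Matrix.orthogonalGroup (Fin 2) ℝ := by
    intro i
    rw [Matrix.mem_orthogonalGroup_iff']
    rw [Matrix.transpose_smul, Matrix.smul_mul, Matrix.mul_smul, hAA i, smul_smul, smul_smul]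
    have h1 : (Real.sqrt (l i))⁻¹ * (Real.sqrt (l i))⁻¹ * l i = 1 := by
      have h2 : Real.sqrt (l i) ≠ 0 := (Real.sqrt_pos.2 (hl i)).ne'
      field_simp
      rw [Real.sq_sqrt (hl i).le]
    rw [h1, one_smul]
  -- In `wreathMatrix` the conformal factors are indexed by the target plane, hence the `σ.symm`.
  refine ⟨⟨fun k => (⟨_, hO (σ.symm k)⟩, ⟨Real.sqrt (l (σ.symm k)), Real.sqrt_pos.2 (hl _)⟩), σ⟩,
    ?_⟩
  rintro ⟨i, a⟩
  change u' (i, a) = ∑ p, wreathMatrix _ p (i, a) • u p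
  rw [Fintype.sum_prod_type, Finset.sum_eq_single (σ i)]
  · have h1 : ∀ b, wreathMatrix (⟨fun k => (⟨_, hO (σ.symm k)⟩,
        ⟨Real.sqrt (l (σ.symm k)), Real.sqrt_pos.2 (hl _)⟩), σ⟩ : WreathConformal n)
        (σ i, b) (i, a) = A i b a := by
      intro b
      rw [wreathMatrix_apply, if_pos rfl]
      simp only [Equiv.symm_apply_apply, Matrix.smul_apply, smul_eq_mul]
      have h2 : Real.sqrt (l i) ≠ 0 := (Real.sqrt_pos.2 (hl i)).ne'
      field_simp
    simp only [h1, hu, hu', ← map_smul, ← map_sum]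
    rw [← sub_eq_zero, ← map_sub, Submodule.mkQ_apply, Submodule.Quotient.mk_eq_zero]
    exact hexp i a
  · intro k _ hk
    refine Finset.sum_eq_zero fun b _ => ?_
    rw [wreathMatrix_apply, if_neg hk, zero_smul]
  · simp

/-- The translates of an orthonormal lift are orthonormal for the permuted and rescaled forms. -/
theorem translate (hz : IsOrthonormalLift W B z) (g : WreathConformal n) :
    IsOrthonormalLift (fun i => W (g.right i))
      (fun i => (((g.left (g.right i)).2 : ℝ) ^ 2)⁻¹ • B (g.right i))
      (fun q => ∑ p, wreathMatrix g p q • z p) := by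
  have hsum : ∀ i a, ∑ p, wreathMatrix g p (i, a) • z p =
      ∑ b, (((g.left (g.right i)).2 : ℝ) *
        ((g.left (g.right i)).1 : Matrix (Fin 2) (Fin 2) ℝ) b a) • z (g.right i, b) := by
    intro i a
    rw [Fintype.sum_prod_type, Finset.sum_eq_single (g.right i)]
    · simp only [wreathMatrix_apply, if_true]
    · intro k _ hk
      refine Finset.sum_eq_zero fun b _ => ?_
      rw [wreathMatrix_apply, if_neg hk, zero_smul]
    · simp
  refine ⟨fun i k hk a => ?_, fun i a b => ?_⟩
  · rw [hsum]
    exact Submodule.sum_mem _ fun b _ => Submodule.smul_mem _ _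
      (hz.mem _ _ (fun h => hk (g.right.injective h)) b)
  · simp only [hsum]
    set r : ℝ := ((g.left (g.right i)).2 : ℝ)
    set O : Matrix (Fin 2) (Fin 2) ℝ := ((g.left (g.right i)).1 : Matrix (Fin 2) (Fin 2) ℝ)
    have hr : 0 < r := (g.left (g.right i)).2.2
    have hO : O.transpose * O = 1 :=
      (Matrix.mem_orthogonalGroup_iff' _ _).1 (g.left (g.right i)).1.2
    have h1 := congrFun (congrFun hO a) b
    rw [Matrix.mul_apply, Matrix.one_apply] at h1
    rw [← h1]
    simp [hz.orth, Matrix.transpose_apply]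
    field_simp

end IsOrthonormalLift

/-- The permutation is visible in the positions of the nonzero blocks, the scaling is the length of
a column of a block, and dividing by it leaves the orthogonal matrix. -/
theorem wreathHom_injective (n : ℕ) : Function.Injective (wreathHom n) := by
  intro g h hgh
  have hm : ∀ p q, wreathMatrix g p q = wreathMatrix h p q := by
    have h0 : ((wreathHom n g : GL (Fin n × Fin 2) ℝ) : Matrix (Fin n × Fin 2) (Fin n × Fin 2) ℝ) =
        (wreathHom n h : GL (Fin n × Fin 2) ℝ) := by rw [hgh]
    exact fun p q => congrFun (congrFun h0 p) q
  have hO : ∀ (g : WreathConformal n) i,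
      ((g.left i).1 : Matrix (Fin 2) (Fin 2) ℝ).transpose *
        ((g.left i).1 : Matrix (Fin 2) (Fin 2) ℝ) = 1 := fun g i =>
    (Matrix.mem_orthogonalGroup_iff' _ _).1 (g.left i).1.2
  have hne : ∀ (g : WreathConformal n) i, ∃ b,
      ((g.left i).1 : Matrix (Fin 2) (Fin 2) ℝ) b 0 ≠ 0 := by
    intro g i
    by_contra! h0
    have := congrFun (congrFun (hO g i) 0) 0
    simp [Matrix.mul_apply, h0] at this
  have hright : g.right = h.right := by
    ext1 i
    by_contra hi
    obtain ⟨b, hb⟩ := hne g (g.right i)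
    have := hm (g.right i, b) (i, 0)
    rw [wreathMatrix_apply, wreathMatrix_apply, if_pos rfl, if_neg hi] at this
    exact mul_ne_zero (g.left (g.right i)).2.2.ne' hb this
  have hmat : ∀ k a b, ((g.left k).2 : ℝ) * ((g.left k).1 : Matrix (Fin 2) (Fin 2) ℝ) a b =
      ((h.left k).2 : ℝ) * ((h.left k).1 : Matrix (Fin 2) (Fin 2) ℝ) a b := by
    intro k a b
    have := hm (k, a) (g.right.symm k, b)
    rwa [wreathMatrix_apply, wreathMatrix_apply, if_pos (by simp), if_pos (by simp [← hright])]
      at this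
  have hr : ∀ k, ((g.left k).2 : ℝ) = ((h.left k).2 : ℝ) := by
    intro k
    have h1 := congrFun (congrFun (hO g k) 0) 0
    have h2 := congrFun (congrFun (hO h k) 0) 0
    rw [Matrix.mul_apply, Matrix.one_apply_eq] at h1 h2
    simp only [Matrix.transpose_apply, Fin.sum_univ_two] at h1 h2
    have h3 := hmat k 0 0
    have h4 := hmat k 1 0
    set r := ((g.left k).2 : ℝ)
    set s := ((h.left k).2 : ℝ)
    have hr : 0 < r := (g.left k).2.2
    have hs : 0 < s := (h.left k).2.2
    -- The equal first columns of the two blocks have squared lengths `r ^ 2` and `s ^ 2`.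
    have h5 : r ^ 2 = s ^ 2 := by
      linear_combination (-r ^ 2) * h1 + s ^ 2 * h2 +
        (r * ((g.left k).1 : Matrix (Fin 2) (Fin 2) ℝ) 0 0 +
          s * ((h.left k).1 : Matrix (Fin 2) (Fin 2) ℝ) 0 0) * h3 +
        (r * ((g.left k).1 : Matrix (Fin 2) (Fin 2) ℝ) 1 0 +
          s * ((h.left k).1 : Matrix (Fin 2) (Fin 2) ℝ) 1 0) * h4
    exact (pow_left_inj₀ hr.le hs.le two_ne_zero).1 h5
  refine SemidirectProduct.ext (funext fun k => Prod.ext (Subtype.ext ?_) (Subtype.ext (hr k)))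
    hright
  ext a b
  have h1 := hmat k a b
  rw [hr k] at h1
  exact mul_left_cancel₀ (h.left k).2.2.ne' h1

end NormalForms

/-! ### The leading term of a divisor and the intersection number. -/

section LeadingTerm

variable {m : ℕ} {N : Type u} [TopologicalSpace N] [ChartedSpace (EuclideanSpace ℝ (Fin m)) N]

local notation "𝔼" => EuclideanSpace ℝ (Fin m)

/-- The straight line through `x` in the preferred chart at `x`, in the direction `v`. -/
noncomputable def chartLine (x : N) (v : 𝔼) (t : ℝ) : N :=
  (extChartAt (𝓡 m) x).symm (extChartAt (𝓡 m) x x + t • v)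

theorem tendsto_chartLine (x : N) (v : 𝔼) : Tendsto (chartLine x v) (𝓝 0) (𝓝 x) := by
  refine (tendsto_extChartAt_symm x (mem_extChartAt_source x)).comp ?_
  have h : Continuous fun t : ℝ => extChartAt (𝓡 m) x x + t • v := by fun_prop
  simpa using h.tendsto 0

variable [IsManifold (𝓡 m) ∞ N]

theorem tendsto_chartLine_div_sq {f : N → ℝ} {x : N} (hf : ContMDiffAt (𝓡 m) 𝓘(ℝ, ℝ) ∞ f x)
    (h0 : f x = 0) (h1 : mfderiv (𝓡 m) 𝓘(ℝ, ℝ) f x = 0) (v : 𝔼) :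
    Tendsto (fun t => f (chartLine x v t) / t ^ 2) (𝓝[≠] 0)
      (𝓝 (hessianAt m f x v v / 2)) := by
  rw [mfderiv_eq_fderiv_extChartAt (hf.mdifferentiableAt (by simp))] at h1
  exact tendsto_div_sq_of_critical
    ((hf.contDiffAt_comp_extChartAt_symm x (mem_extChartAt_source x)).of_le two_le_smooth)
    (by simpa using h0) h1 v

theorem tendsto_chartLine_of_associated_prod {j : ℕ} {Q : N → ℝ} {g : Fin j → N → ℝ} {x : N}
    (hQ : SmoothAssociatedAt m Q (fun y => ∏ i, g i y) x)
    (hg : ∀ i, ContMDiffAt (𝓡 m) 𝓘(ℝ, ℝ) ∞ (g i) x) (h0 : ∀ i, g i x = 0)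
    (h1 : ∀ i, mfderiv (𝓡 m) 𝓘(ℝ, ℝ) (g i) x = 0) :
    ∃ c : ℝ, c ≠ 0 ∧ ∀ v : 𝔼, Tendsto (fun t => Q (chartLine x v t) / t ^ (2 * j)) (𝓝[≠] 0)
      (𝓝 (c * ∏ i, hessianAt m (g i) x v v)) := by
  obtain ⟨a, ha, hQ⟩ := hQ
  -- Each factor has second-order coefficient half its Hessian, and the unit contributes its value
  -- at `x`.
  refine ⟨a x * (1 / 2) ^ j, by positivity, fun v => ?_⟩
  have hline : Tendsto (chartLine x v) (𝓝[≠] 0) (𝓝 x) :=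
    (tendsto_chartLine x v).mono_left nhdsWithin_le_nhds
  have h2 : Tendsto (fun t => a (chartLine x v t)) (𝓝[≠] 0) (𝓝 (a x)) :=
    hQ.self_of_nhds.1.continuousAt.tendsto.comp hline
  have h3 := h2.mul (tendsto_finsetProd Finset.univ fun i _ =>
    tendsto_chartLine_div_sq (hg i) (h0 i) (h1 i) v)
  have h4 : a x * ∏ i, hessianAt m (g i) x v v / 2 =
      a x * (1 / 2) ^ j * ∏ i, hessianAt m (g i) x v v := by
    rw [Finset.prod_div_distrib, Finset.prod_const, Finset.card_univ, Fintype.card_fin,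
      one_div, inv_pow]
    ring
  rw [h4] at h3
  refine h3.congr' ?_
  filter_upwards [hline.eventually hQ] with t ht
  rw [ht.2, Finset.prod_div_distrib, Finset.prod_const, Finset.card_univ, Fintype.card_fin,
    ← pow_mul, mul_div_assoc]

end LeadingTerm

namespace RealDivisor

section

variable {m : ℕ} {N : Type u} [TopologicalSpace N] [ChartedSpace (EuclideanSpace ℝ (Fin m)) N]
  [IsManifold (𝓡 m) ∞ N] [T2Space N] {δ : RealDivisor.{u, v} m N}

/-- The Hessian of a non-negative generator of the ideal of a smooth elliptic divisor. -/
theorem IsSmoothElliptic.isNormalForm (hδ : δ.IsSmoothElliptic)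
    {f : C^∞⟮𝓡 m, N; 𝓘(ℝ, ℝ), ℝ⟯} (hf : δ.ideal = Ideal.span {f}) (hf0 : ∀ y, 0 ≤ f y) {x : N}
    (hx : x ∈ δ.locus) : IsNormalForm (tangentSpaceOf m δ.locus x) (hessianAt m f x) := by
  have has := fun y => associated_localRep_of_ideal_eq_span hf y
  have hcrit : ∀ y ∈ δ.locus, mfderiv (𝓡 m) 𝓘(ℝ, ℝ) f y = 0 := fun y hy =>
    (hδ.of_associated (has y) hy).1
  refine ⟨hessianAt_symm f.contMDiff.contMDiffAt, fun w hw v =>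
    hessianAt_eq_zero_of_mem_tangentSpaceOf (Eventually.of_forall fun y => f.contMDiff.contMDiffAt)
      (Eventually.of_forall hcrit) hw v, ?_⟩
  -- Negative definiteness is excluded by `f ≥ 0` along a chart line.
  rcases (hδ.of_associated (has x) hx).2 with h | h
  · exact h
  · intro w hw
    have h0 : f x = 0 := (has x).eq_zero_iff.2 ((localRep_eq_zero_iff (δ.mem_trivSet x)).2 hx)
    have h1 := tendsto_chartLine_div_sq f.contMDiff.contMDiffAt h0 (hcrit x hx) w
    have h2 := ge_of_tendsto' h1 fun t => div_nonneg (hf0 _) (sq_nonneg t)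
    exact absurd (h w hw) (by
      intro h3
      have h4 : hessianAt m f x w w / 2 < 0 := div_neg_of_neg_of_pos h3 two_pos
      exact absurd h2 (not_le.2 h4))

end

section

variable {m : ℕ} {M : Type u} [TopologicalSpace M] [ChartedSpace (EuclideanSpace ℝ (Fin m)) M]
  [IsManifold (𝓡 m) ∞ M] [T2Space M] {δ : RealDivisor.{u, v} m M}

local notation "𝔼" => EuclideanSpace ℝ (Fin m)

/-- The leading term of a divisor at a point of a normal crossing. -/
theorem IsLocalNormalCrossing.tendsto_chartLine {U : TopologicalSpace.Opens M} {j : ℕ}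
    {ε : Fin j → RealDivisor.{u, 0} m U} (hε : δ.IsLocalNormalCrossing U ε) {x : U}
    (hx : ∀ i, x ∈ (ε i).locus) {g : Fin j → U → ℝ}
    (hg : ∀ i, SmoothAssociatedAt m (g i) ((ε i).localRep x) x) :
    ∃ c : ℝ, c ≠ 0 ∧ ∀ v : 𝔼,
      Tendsto (fun t => δ.localRep x.1 (chartLine x.1 v t) / t ^ (2 * j)) (𝓝[≠] 0)
      (𝓝 (c * ∏ i, hessianAt m (g i) x v v)) := by
  have hgs : ∀ i, ContMDiffAt (𝓡 m) 𝓘(ℝ, ℝ) ∞ (g i) x := fun i => by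
    obtain ⟨a, -, ha⟩ := hg i
    exact (ha.self_of_nhds.1.mul (localRep_contMDiffAt ((ε i).mem_trivSet x))).congr_of_eventuallyEq
      (ha.mono fun y hy => hy.2)
  obtain ⟨c, hc, hlim⟩ := tendsto_chartLine_of_associated_prod
    ((hε.associated x).trans (SmoothAssociatedAt.prod _ fun i _ => (hg i).symm)) hgs
    (fun i => (hg i).eq_zero_iff.2 ((localRep_eq_zero_iff ((ε i).mem_trivSet x)).2 (hx i)))
    (fun i => ((hε.1 i).of_associated (hg i) (hx i)).1)
  refine ⟨c, hc, fun v => (hlim v).congr' ?_⟩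
  -- The chart lines of `U` and of `M` coincide for small `t`; using those of `M` makes limits from
  -- different domains comparable.
  have h : Tendsto (fun t : ℝ => extChartAt (𝓡 m) x.1 x.1 + t • v) (𝓝[≠] 0)
      (𝓝 (extChartAt (𝓡 m) x.1 x.1)) := by
    have h : Continuous fun t : ℝ => extChartAt (𝓡 m) x.1 x.1 + t • v := by fun_prop
    have h' := h.tendsto 0
    rw [zero_smul, add_zero] at h'
    exact h'.mono_left nhdsWithin_le_nhds
  filter_upwards [h.eventually
    (comp_val_comp_extChartAt_symm_eventuallyEq (δ.localRep x.1) x)] with t ht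
  exact congrArg (· / t ^ (2 * j)) ht

/-- By transversality one vector can have a prescribed nonzero class in every normal space at once.
In its direction the leading coefficient of the divisor does not vanish. -/
theorem IsLocalNormalCrossing.exists_notMem {U : TopologicalSpace.Opens M} {j : ℕ}
    {ε : Fin j → RealDivisor.{u, 0} m U} (hε : δ.IsLocalNormalCrossing U ε) {x : U}
    (hx : ∀ i, x ∈ (ε i).locus) :
    ∃ v : TangentSpace (𝓡 m) x, ∀ i, v ∉ tangentSpaceOf m (ε i).locus x := by
  have h1 : ∀ i, ∃ w : TangentSpace (𝓡 m) x, w ∉ tangentSpaceOf m (ε i).locus x := by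
    intro i
    obtain ⟨V, G, hV, hxV, hG, hs, hE⟩ := (hε.1 i).1 x (hx i)
    have hmem : ∀ y ∈ V, (y ∈ (ε i).locus ↔ G y = 0) := fun y hy => by
      have := Set.ext_iff.1 hE y
      simpa [hy] using this
    obtain ⟨w, hw⟩ := hs x hxV (EuclideanSpace.single 0 1 : EuclideanSpace ℝ (Fin 2))
    refine ⟨w, fun hw' => ?_⟩
    rw [mem_tangentSpaceOf_iff ((hG x hxV).contMDiffAt (hV.mem_nhds hxV)) (hs x hxV)
      ((hmem x hxV).1 (hx i))
      (by filter_upwards [hV.mem_nhds hxV] with y hy using hmem y hy)] at hw'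
    have h2 : (EuclideanSpace.single 0 1 : EuclideanSpace ℝ (Fin 2)) = 0 := hw.symm.trans hw'
    simpa using congrArg (fun z : EuclideanSpace ℝ (Fin 2) => z 0) h2
  choose w hw using h1
  obtain ⟨z, hz⟩ := hε.2.1 x w
  exact ⟨z, fun i hi => hw i ((Submodule.sub_mem_iff_right _ hi).1 (hz i (hx i)))⟩

/-- The number of divisors of a normal crossing that all pass through `x` is determined by the
order of vanishing at `x`. -/
theorem IsLocalNormalCrossing.card_le {U U' : TopologicalSpace.Opens M} {j j' : ℕ}
    {ε : Fin j → RealDivisor.{u, 0} m U} {ε' : Fin j' → RealDivisor.{u, 0} m U'}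
    (hε : δ.IsLocalNormalCrossing U ε) (hε' : δ.IsLocalNormalCrossing U' ε') {x : M}
    (hxU : x ∈ U) (hxU' : x ∈ U') (hx : ∀ i, ⟨x, hxU⟩ ∈ (ε i).locus)
    (hx' : ∀ i, ⟨x, hxU'⟩ ∈ (ε' i).locus) : j' ≤ j := by
  by_contra! hlt
  obtain ⟨c, hc, hlim⟩ := hε.tendsto_chartLine hx fun i => .refl _ _
  obtain ⟨c', hc', hlim'⟩ := hε'.tendsto_chartLine hx' fun i => .refl _ _
  obtain ⟨v, hv⟩ := hε.exists_notMem hx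
  have h1 : Tendsto (fun t : ℝ => t ^ (2 * (j' - j))) (𝓝[≠] 0) (𝓝 0) := by
    have h2 : Tendsto (fun t : ℝ => t ^ (2 * (j' - j))) (𝓝 0) (𝓝 (0 ^ (2 * (j' - j)))) :=
      (continuous_pow _).tendsto 0
    rw [zero_pow (by omega)] at h2
    exact h2.mono_left nhdsWithin_le_nhds
  have h3 := h1.mul (hlim' v)
  rw [zero_mul] at h3
  -- If `j' > j`, vanishing to order `2 * j'` would make the nonzero coefficient of order `2 * j`
  -- equal to zero.
  have h4 := tendsto_nhds_unique (h3.congr' ?_) (hlim v)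
  · refine mul_ne_zero hc (Finset.prod_ne_zero_iff.2 fun i _ => ?_) h4.symm
    rcases ((hε.1 i).2 _ (hx i)).2 with h | h
    · exact (h v (hv i)).ne'
    · exact (h v (hv i)).ne
  · filter_upwards [self_mem_nhdsWithin] with t ht
    have ht : t ≠ 0 := ht
    have h5 : t ^ (2 * j') = t ^ (2 * (j' - j)) * t ^ (2 * j) := by
      rw [← pow_add]
      congr 1
      omega
    rw [h5]
    field_simp

/-- A point through which all the divisors of a normal crossing pass has their number as its
intersection number. -/
theorem IsLocalNormalCrossing.pointIntersectionNumber_eq {U : TopologicalSpace.Opens M} {j : ℕ}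
    {ε : Fin j → RealDivisor.{u, 0} m U} (hε : δ.IsLocalNormalCrossing U ε) {x : U}
    (hx : ∀ i, x ∈ (ε i).locus) : δ.pointIntersectionNumber x = j := by
  have h1 : δ.HasNormalCrossing x j := ⟨U, x.2, ε, hε⟩
  refine le_antisymm (Nat.sInf_le h1) ?_
  obtain ⟨U', hxU', ε', hε'⟩ : δ.HasNormalCrossing x (δ.pointIntersectionNumber x) :=
    Nat.sInf_mem (s := {j | δ.HasNormalCrossing x j}) ⟨j, h1⟩
  exact hε'.card_le hε hxU' x.2
    (mem_locus_of_pointIntersectionNumber hε' ⟨x, hxU'⟩ rfl) hx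

/-- Minimality gives one direction and the order of vanishing the other. It holds at every point of
`U`, so one crossing describes the whole stratum inside `U`. -/
theorem IsLocalNormalCrossing.mem_stratum_iff {U : TopologicalSpace.Opens M} {n : ℕ}
    {ε : Fin n → RealDivisor.{u, 0} m U} (hε : δ.IsLocalNormalCrossing U ε) (x : U) :
    x.1 ∈ δ.stratum n ↔ ∀ i, x ∈ (ε i).locus := by
  rw [RealDivisor.mem_stratum_iff]
  exact ⟨mem_locus_of_pointIntersectionNumber hε x, hε.pointIntersectionNumber_eq⟩

end

end RealDivisor

/-! ### Smooth right inverses and Gram–Schmidt. -/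

section RightInverse

variable {E : Type*} [NormedAddCommGroup E] [NormedSpace ℝ E] [FiniteDimensional ℝ E]
  {X : Type*} [NormedAddCommGroup X] [NormedSpace ℝ X] [FiniteDimensional ℝ X]

/-- The differential of a submersion has a smooth family of right inverses. -/
theorem exists_contDiffAt_rightInverse {G : E → X} {p : E}
    (hG : ∀ᶠ y in 𝓝 p, ContDiffAt ℝ ∞ G y) (hs : Function.Surjective (fderiv ℝ G p)) :
    ∃ Z : E → X →L[ℝ] E, ∀ᶠ y in 𝓝 p, ContDiffAt ℝ ∞ Z y ∧ ∀ ξ, fderiv ℝ G y (Z y ξ) = ξ := by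
  have : CompleteSpace E := FiniteDimensional.complete ℝ E
  have : CompleteSpace X := FiniteDimensional.complete ℝ X
  obtain ⟨R, hR⟩ := (fderiv ℝ G p : E →ₗ[ℝ] X).exists_rightInverse_of_surjective
    (LinearMap.range_eq_top.2 hs)
  set R' : X →L[ℝ] E := LinearMap.toContinuousLinearMap R
  set A : E → X →L[ℝ] X := fun y => (fderiv ℝ G y).comp R' with hA
  have hAp : A p = 1 := by
    ext ξ
    exact congrArg (fun L : X →ₗ[ℝ] X => L ξ) hR
  have hAs : ∀ᶠ y in 𝓝 p, ContDiffAt ℝ ∞ A y := by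
    filter_upwards [hG] with y hy
    exact (hy.fderiv_right (m := ∞) (by simp)).clm_comp contDiffAt_const
  have hunit : ∀ᶠ y in 𝓝 p, IsUnit (A y) := by
    refine hAs.self_of_nhds.continuousAt.eventually ?_
    rw [hAp]
    exact Units.isOpen.mem_nhds isUnit_one
  refine ⟨fun y => R'.comp (Ring.inverse (A y)), ?_⟩
  filter_upwards [hAs, hunit] with y hy hyu
  refine ⟨?_, fun ξ => ?_⟩
  · obtain ⟨u, hu⟩ := hyu
    have h1 : ContDiffAt ℝ ∞ Ring.inverse (A y) := hu ▸ contDiffAt_ringInverse ℝ u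
    exact contDiffAt_const.clm_comp (h1.comp y hy)
  · have h1 := Ring.mul_inverse_cancel _ hyu
    exact congrArg (fun L : X →L[ℝ] X => L ξ) h1

end RightInverse

section GramSchmidt

variable {E : Type*} [NormedAddCommGroup E] [NormedSpace ℝ E]

/-- The part of `z₁` orthogonal to `z₀` for the bilinear form `B`. -/
noncomputable def orthPart (B : E →L[ℝ] E →L[ℝ] ℝ) (z₀ z₁ : E) : E :=
  z₁ - (B z₁ z₀ * (B z₀ z₀)⁻¹) • z₀

/-- The Gram-Schmidt orthonormalisation of two vectors for the bilinear form `B`. -/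
noncomputable def orthonormalPair (B : E →L[ℝ] E →L[ℝ] ℝ) (z₀ z₁ : E) : Fin 2 → E :=
  ![(Real.sqrt (B z₀ z₀))⁻¹ • z₀,
    (Real.sqrt (B (orthPart B z₀ z₁) (orthPart B z₀ z₁)))⁻¹ • orthPart B z₀ z₁]

theorem orthonormalPair_apply {B : E →L[ℝ] E →L[ℝ] ℝ} {z₀ z₁ : E}
    (hsymm : ∀ v w, B v w = B w v) (h0 : 0 < B z₀ z₀)
    (h1 : 0 < B (orthPart B z₀ z₁) (orthPart B z₀ z₁)) (a b : Fin 2) :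
    B (orthonormalPair B z₀ z₁ a) (orthonormalPair B z₀ z₁ b) = if a = b then 1 else 0 := by
  have key : ∀ w, 0 < B w w → (Real.sqrt (B w w))⁻¹ * ((Real.sqrt (B w w))⁻¹ * B w w) = 1 := by
    intro w hw
    have h2 : Real.sqrt (B w w) ≠ 0 := (Real.sqrt_pos.2 hw).ne'
    field_simp
    rw [Real.sq_sqrt hw.le]
  have horth : B (orthPart B z₀ z₁) z₀ = 0 := by
    simp only [orthPart, map_sub, map_smul, sub_apply, smul_apply, smul_eq_mul]
    have := h0.ne'
    field_simp
    ring
  have horth' : B z₀ (orthPart B z₀ z₁) = 0 := by rw [hsymm, horth]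
  fin_cases a <;> fin_cases b
  · simpa [orthonormalPair] using key _ h0
  · simp [orthonormalPair, horth']
  · simp [orthonormalPair, horth]
  · simpa [orthonormalPair] using key _ h1

theorem orthonormalPair_mem {B : E →L[ℝ] E →L[ℝ] ℝ} {z₀ z₁ : E} {W : Submodule ℝ E}
    (h0 : z₀ ∈ W) (h1 : z₁ ∈ W) (a : Fin 2) : orthonormalPair B z₀ z₁ a ∈ W := by
  fin_cases a
  · exact W.smul_mem _ h0
  · exact W.smul_mem _ (W.sub_mem h1 (W.smul_mem _ h0))

theorem contDiffAt_orthPart {F : Type*} [NormedAddCommGroup F] [NormedSpace ℝ F]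
    {B : F → E →L[ℝ] E →L[ℝ] ℝ} {z₀ z₁ : F → E} {p : F} (hB : ContDiffAt ℝ ∞ B p)
    (hz₀ : ContDiffAt ℝ ∞ z₀ p) (hz₁ : ContDiffAt ℝ ∞ z₁ p) (h0 : B p (z₀ p) (z₀ p) ≠ 0) :
    ContDiffAt ℝ ∞ (fun y => orthPart (B y) (z₀ y) (z₁ y)) p :=
  hz₁.sub ((((hB.clm_apply hz₁).clm_apply hz₀).mul
    (((hB.clm_apply hz₀).clm_apply hz₀).inv h0)).smul hz₀)

theorem contDiffAt_orthonormalPair {F : Type*} [NormedAddCommGroup F] [NormedSpace ℝ F]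
    {B : F → E →L[ℝ] E →L[ℝ] ℝ} {z₀ z₁ : F → E} {p : F} (hB : ContDiffAt ℝ ∞ B p)
    (hz₀ : ContDiffAt ℝ ∞ z₀ p) (hz₁ : ContDiffAt ℝ ∞ z₁ p) (h0 : 0 < B p (z₀ p) (z₀ p))
    (h1 : 0 < B p (orthPart (B p) (z₀ p) (z₁ p)) (orthPart (B p) (z₀ p) (z₁ p))) (a : Fin 2) :
    ContDiffAt ℝ ∞ (fun y => orthonormalPair (B y) (z₀ y) (z₁ y) a) p := by
  have key : ∀ z : F → E, ContDiffAt ℝ ∞ z p → 0 < B p (z p) (z p) →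
      ContDiffAt ℝ ∞ (fun y => (Real.sqrt (B y (z y) (z y)))⁻¹ • z y) p := fun z hz hpos =>
    ((((hB.clm_apply hz).clm_apply hz).sqrt hpos.ne').inv (Real.sqrt_pos.2 hpos).ne').smul hz
  fin_cases a
  · exact key z₀ hz₀ h0
  · exact key _ (contDiffAt_orthPart hB hz₀ hz₁ h0.ne') h1

end GramSchmidt

/-! ### Normal spaces and comparison of local choices. -/

section

variable {m : ℕ} {M : Type u} [TopologicalSpace M] [ChartedSpace (EuclideanSpace ℝ (Fin m)) M]

theorem IsEmbeddedSubmanifold.exists_submersion {S : Set M} {k : ℕ}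
    (hS : IsEmbeddedSubmanifold m S k) {x : M} (hx : x ∈ S) :
    ∃ G : M → EuclideanSpace ℝ (Fin k), ∀ᶠ y in 𝓝 x, ContMDiffAt (𝓡 m) (𝓡 k) ∞ G y ∧
      Function.Surjective (mfderiv (𝓡 m) (𝓡 k) G y) ∧ (y ∈ S ↔ G y = 0) := by
  obtain ⟨V, G, hV, hxV, hG, hs, hE⟩ := hS x hx
  refine ⟨G, ?_⟩
  filter_upwards [hV.mem_nhds hxV] with y hy
  refine ⟨(hG y hy).contMDiffAt (hV.mem_nhds hy), hs y hy, ?_⟩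
  have := Set.ext_iff.1 hE y
  simpa [hy] using this

variable [IsManifold (𝓡 m) ∞ M]

theorem IsEmbeddedSubmanifold.finrank_normalFibre {S : Set M} {k : ℕ}
    (hS : IsEmbeddedSubmanifold m S k) {x : M} (hx : x ∈ S) :
    Module.finrank ℝ (NormalFibre m S x) = k := by
  obtain ⟨G, hG⟩ := hS.exists_submersion hx
  obtain ⟨h1, h2, h3⟩ := hG.self_of_nhds
  have hiff := mem_tangentSpaceOf_iff h1 h2 (h3.1 hx) (hG.mono fun y hy => hy.2.2)
  let L : TangentSpace (𝓡 m) x →ₗ[ℝ] EuclideanSpace ℝ (Fin k) :=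
    (mfderiv (𝓡 m) (𝓡 k) G x).toLinearMap
  have hL : tangentSpaceOf m S x = LinearMap.ker L := Submodule.ext hiff
  have e := LinearMap.quotKerEquivOfSurjective L h2
  rw [((Submodule.quotEquivOfEq _ _ hL).trans e).finrank_eq, finrank_euclideanSpace_fin]

end

theorem tangentSpaceOf_mono {m : ℕ} {M : Type u} [TopologicalSpace M]
    [ChartedSpace (EuclideanSpace ℝ (Fin m)) M] {S S' : Set M} {x : M}
    (h : ∀ᶠ y in 𝓝 x, y ∈ S → y ∈ S') : tangentSpaceOf m S x ≤ tangentSpaceOf m S' x :=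
  fun _ hw f hf h0 => hw f hf (by filter_upwards [h, h0] with y h1 h2 h3 using h2 (h1 h3))

theorem hessianAt_const_smul {m : ℕ} {M : Type u} [TopologicalSpace M]
    [ChartedSpace (EuclideanSpace ℝ (Fin m)) M] (r : ℝ) (f : M → ℝ) (x : M) :
    hessianAt m (fun y => r • f y) x = r • hessianAt m f x := by
  have key : ∀ h : EuclideanSpace ℝ (Fin m) → ℝ,
      fderiv ℝ (fderiv ℝ fun y => r • h y) = r • fderiv ℝ (fderiv ℝ h) := fun h =>
    (congrArg (fderiv ℝ) (fderiv_const_smul_field (f := h) r)).trans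
      (fderiv_const_smul_field (𝕜 := ℝ) (f := fderiv ℝ h) r)
  exact congrFun (key _) _

namespace RealDivisor

section

variable {m : ℕ} {M : Type u} [TopologicalSpace M] [ChartedSpace (EuclideanSpace ℝ (Fin m)) M]
  {δ : RealDivisor.{u, v} m M}

/-- Permuting the divisors of a normal crossing. -/
theorem IsLocalNormalCrossing.comp_perm {U : TopologicalSpace.Opens M} {j : ℕ}
    {ε : Fin j → RealDivisor.{u, 0} m U} (hε : δ.IsLocalNormalCrossing U ε)
    (σ : Equiv.Perm (Fin j)) : δ.IsLocalNormalCrossing U (fun i => ε (σ i)) := by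
  refine ⟨fun i => hε.1 _, fun x w => ?_, ?_⟩
  · obtain ⟨z, hz⟩ := hε.2.1 x fun i => w (σ.symm i)
    refine ⟨z, fun i hi => ?_⟩
    have := hz (σ i) hi
    rwa [σ.symm_apply_apply] at this
  · rw [hε.2.2]
    exact (Equiv.prod_comp σ fun i => (ε i).ideal).symm

namespace LocalChoice

variable {n : ℕ} {x : M} (c : δ.LocalChoice n x)

/-- The point `x` in the domain of a local choice. -/
def point : c.U := ⟨x, c.mem⟩

/-- The vanishing locus of the `i`-th divisor of a local choice, as a subset of `M`. -/
def divisorLocus (i : Fin n) : Set M := Subtype.val '' (c.ε i).locus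

/-- The tangent space of the `i`-th divisor of a local choice. -/
def tangentTo (i : Fin n) : Submodule ℝ (TangentSpace (𝓡 m) x) :=
  tangentSpaceOf m (c.divisorLocus i) x

/-- The Hessian of the `i`-th function of a local choice. -/
noncomputable def hess (i : Fin n) :
    TangentSpace (𝓡 m) x →L[ℝ] TangentSpace (𝓡 m) x →L[ℝ] ℝ :=
  hessianAt m (c.f i) c.point

theorem mem_divisorLocus_iff (i : Fin n) (y : c.U) : y.1 ∈ c.divisorLocus i ↔ y ∈ (c.ε i).locus :=
  Subtype.val_injective.mem_set_image

theorem mem_tangentTo_iff (i : Fin n) (w : EuclideanSpace ℝ (Fin m)) :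
    w ∈ c.tangentTo i ↔ w ∈ tangentSpaceOf m (c.ε i).locus c.point :=
  (mem_tangentSpaceOf_opens_iff (y := c.point)
    (Eventually.of_forall fun y => (c.mem_divisorLocus_iff i y).symm) w).symm

/-- A local choice at `x` is a local choice at each point of its domain. -/
def move {y : M} (hy : y ∈ c.U) : δ.LocalChoice n y := { c with mem := hy }

/-- The local choice obtained by permuting the divisors and rescaling the functions. -/
noncomputable def translate (g : WreathConformal n) : δ.LocalChoice n x where
  U := c.U
  mem := c.mem
  -- The `i`-th plane of a translated frame is the plane `g.right i` of the old one, stretched by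
  -- its factor `r`; dividing the function by `r ^ 2` makes the new pair orthonormal.
  ε i := c.ε (g.right i)
  isLocalNormalCrossing := c.isLocalNormalCrossing.comp_perm g.right
  f i := (((g.left (g.right i)).2 : ℝ) ^ 2)⁻¹ • c.f (g.right i)
  nonneg i y := mul_nonneg (inv_nonneg.2 (sq_nonneg _)) (c.nonneg _ y)
  ideal_eq i := by
    have hr : (((g.left (g.right i)).2 : ℝ) ^ 2)⁻¹ ≠ 0 :=
      inv_ne_zero (pow_ne_zero 2 (g.left (g.right i)).2.2.ne')
    rw [c.ideal_eq, Algebra.smul_def, Ideal.span_singleton_mul_left_unit]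
    exact (isUnit_iff_ne_zero.2 hr).map _

theorem hess_translate (g : WreathConformal n) (i : Fin n) :
    (c.translate g).hess i = (((g.left (g.right i)).2 : ℝ) ^ 2)⁻¹ • c.hess (g.right i) :=
  hessianAt_const_smul _ _ _

variable [IsManifold (𝓡 m) ∞ M]

/-- All data are moved from `T_x U` to `T_x M`, where different choices, with different domains, can
be compared by linear algebra. -/
theorem isAdapted_iff {S : Set M} {u : Module.Basis (Fin n × Fin 2) ℝ (NormalFibre m S x)} :
    c.IsAdapted u ↔ ∃ z : Fin n × Fin 2 → TangentSpace (𝓡 m) x,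
      IsOrthonormalLift c.tangentTo c.hess z ∧ ∀ p, u p = (tangentSpaceOf m S x).mkQ (z p) := by
  constructor
  · rintro ⟨z, h1, h2, h3⟩
    refine ⟨z, ⟨fun i k hk a => (c.mem_tangentTo_iff k _).2 (h2 i k hk a), h3⟩, fun p => ?_⟩
    exact (h1 p).trans (congrArg _ (mfderiv_val_apply c.point (z p)))
  · rintro ⟨z, ⟨h2, h3⟩, h1⟩
    refine ⟨z, fun p => ?_, fun i k hk a => (c.mem_tangentTo_iff k _).1 (h2 i k hk a), h3⟩
    exact (h1 p).trans (congrArg _ (mfderiv_val_apply c.point (z p)).symm)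

theorem isAdapted_translate {S : Set M}
    {u w : Module.Basis (Fin n × Fin 2) ℝ (NormalFibre m S x)} (hu : c.IsAdapted u)
    {g : WreathConformal n} (hw : IsFrameTranslate u (wreathHom n g) w) :
    (c.translate g).IsAdapted w := by
  rw [isAdapted_iff] at hu ⊢
  obtain ⟨z, hz, hu⟩ := hu
  refine ⟨fun q => ∑ p, wreathMatrix g p q • z p, ?_, fun p => ?_⟩
  · have h := hz.translate g
    rwa [← show (c.translate g).hess = _ from funext (c.hess_translate g)] at h
  · rw [hw p, map_sum]
    refine Finset.sum_congr rfl fun q _ => ?_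
    rw [map_smul, hu]
    rfl

variable [T2Space M]

theorem mem_stratum_iff {y : M} (hy : y ∈ c.U) : y ∈ δ.stratum n ↔ ∀ i, y ∈ c.divisorLocus i := by
  rw [c.isLocalNormalCrossing.mem_stratum_iff ⟨y, hy⟩]
  exact forall_congr' fun i => (c.mem_divisorLocus_iff i ⟨y, hy⟩).symm

theorem tangentSpaceOf_stratum_le (i : Fin n) :
    tangentSpaceOf m (δ.stratum n) x ≤ c.tangentTo i :=
  tangentSpaceOf_mono (by
    filter_upwards [c.U.isOpen.mem_nhds c.mem] with y hy h using (c.mem_stratum_iff hy).1 h i)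

theorem point_mem_locus (hx : x ∈ δ.stratum n) (i : Fin n) : c.point ∈ (c.ε i).locus :=
  (c.isLocalNormalCrossing.mem_stratum_iff c.point).1 hx i

theorem isNormalForm (hx : x ∈ δ.stratum n) (i : Fin n) :
    IsNormalForm (c.tangentTo i) (c.hess i) := by
  have h := (c.isLocalNormalCrossing.1 i).isNormalForm (c.ideal_eq i) (c.nonneg i)
    (c.point_mem_locus hx i)
  exact ⟨h.symm, fun w hw v => h.ker w ((c.mem_tangentTo_iff i w).1 hw) v,
    fun w hw => h.pos w fun hw' => hw ((c.mem_tangentTo_iff i w).2 hw')⟩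

/-- The products of the Hessians of two local choices at the same point are proportional. -/
theorem exists_prod_hess_eq (c c' : δ.LocalChoice n x) (hx : x ∈ δ.stratum n) :
    ∃ κ : ℝ, κ ≠ 0 ∧ ∀ v, ∏ i, c.hess i v v = κ * ∏ i, c'.hess i v v := by
  obtain ⟨a, ha, h⟩ := c.isLocalNormalCrossing.tendsto_chartLine (c.point_mem_locus hx)
    (g := fun i => c.f i) fun i => associated_localRep_of_ideal_eq_span (c.ideal_eq i) _
  obtain ⟨b, hb, h'⟩ := c'.isLocalNormalCrossing.tendsto_chartLine (c'.point_mem_locus hx)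
    (g := fun i => c'.f i) fun i => associated_localRep_of_ideal_eq_span (c'.ideal_eq i) _
  refine ⟨a⁻¹ * b, mul_ne_zero (inv_ne_zero ha) hb, fun v => ?_⟩
  have h1 : a * ∏ i, c.hess i v v = b * ∏ i, c'.hess i v v := tendsto_nhds_unique (h v) (h' v)
  rw [mul_assoc, ← h1, inv_mul_cancel_left₀ ha]

theorem exists_isFrameTranslate {c c' : δ.LocalChoice n x} (hx : x ∈ δ.stratum n)
    {u w : Module.Basis (Fin n × Fin 2) ℝ (NormalFibre m (δ.stratum n) x)} (hu : c.IsAdapted u)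
    (hw : c'.IsAdapted w) : ∃ g : WreathConformal n, IsFrameTranslate u (wreathHom n g) w := by
  rw [isAdapted_iff] at hu hw
  obtain ⟨z, hz, hu⟩ := hu
  obtain ⟨z', hz', hw⟩ := hw
  obtain ⟨κ, hκ, hprod⟩ := c.exists_prod_hess_eq c' hx
  exact hz.exists_isFrameTranslate (c.isNormalForm hx) hz' (c'.isNormalForm hx) hκ hprod
    c.tangentSpaceOf_stratum_le hu hw

end LocalChoice

theorem mem_adaptedFrames_iff [IsManifold (𝓡 m) ∞ M] [T2Space M] {n : ℕ} {x : M}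
    (hx : x ∈ δ.stratum n) {u : Module.Basis (Fin n × Fin 2) ℝ (NormalFibre m (δ.stratum n) x)}
    (hu : u ∈ δ.adaptedFrames n x)
    (w : Module.Basis (Fin n × Fin 2) ℝ (NormalFibre m (δ.stratum n) x)) :
    w ∈ δ.adaptedFrames n x ↔ ∃ g : WreathConformal n, IsFrameTranslate u (wreathHom n g) w := by
  obtain ⟨c, hc⟩ := hu
  exact ⟨fun ⟨c', hc'⟩ => LocalChoice.exists_isFrameTranslate hx hc hc',
    fun ⟨g, hg⟩ => ⟨c.translate g, c.isAdapted_translate hc hg⟩⟩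

end

end RealDivisor

/-! ### Vector fields, defining submersions and the manifold structure of the stratum. -/

section VectorFields

variable {m : ℕ} {M : Type u} [TopologicalSpace M] [ChartedSpace (EuclideanSpace ℝ (Fin m)) M]
  [IsManifold (𝓡 m) ∞ M]

local notation "𝔼" => EuclideanSpace ℝ (Fin m)

/-- A vector field with a prescribed smooth expression in the chart at `x`. -/
theorem exists_vectorField (x : M) (v : 𝔼 → 𝔼) :
    ∃ s : ∀ y : M, TangentSpace (𝓡 m) y, ∀ y ∈ (extChartAt (𝓡 m) x).source,
      mfderiv (𝓡 m) 𝓘(ℝ, 𝔼) (extChartAt (𝓡 m) x) y (s y) = v (extChartAt (𝓡 m) x y) ∧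
      (ContDiffAt ℝ ∞ v (extChartAt (𝓡 m) x y) → ContMDiffAt (𝓡 m) (𝓡 m).tangent ∞
        (fun y => (⟨y, s y⟩ : TangentBundle (𝓡 m) M)) y) := by
  set e := trivializationAt 𝔼 (TangentSpace (𝓡 m) : M → Type) x with he
  have hsrc : (extChartAt (𝓡 m) x).source = (chartAt 𝔼 x).source := extChartAt_source (𝓡 m) x
  have hbase : e.baseSet = (chartAt 𝔼 x).source := rfl
  refine ⟨fun y => e.symm y (v (extChartAt (𝓡 m) x y)), fun y hy => ?_⟩
  rw [hsrc] at hy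
  refine ⟨?_, fun hv => ?_⟩
  · rw [← TangentBundle.continuousLinearMapAt_trivializationAt hy]
    have h1 := e.continuousLinearMapAt_symmL (R := ℝ) hy (v (extChartAt (𝓡 m) x y))
    rwa [e.symmL_apply (R := ℝ) (hbase ▸ hy)] at h1
  · have h1 : ContMDiffAt (𝓡 m) 𝓘(ℝ, 𝔼) ∞ (fun z => v (extChartAt (𝓡 m) x z)) y :=
      hv.contMDiffAt.comp y (contMDiffAt_extChartAt_of_mem x (hsrc ▸ hy))
    refine (e.contMDiffAt_section_iff (IB := 𝓡 m) (n := ∞) hy).2 (h1.congr_of_eventuallyEq ?_)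
    filter_upwards [(chartAt 𝔼 x).open_source.mem_nhds hy] with z hz
    exact congrArg Prod.snd (e.apply_mk_symm (hbase ▸ hz) _)

end VectorFields

namespace RealDivisor.LocalChoice

variable {m : ℕ} {M : Type u} [TopologicalSpace M] [ChartedSpace (EuclideanSpace ℝ (Fin m)) M]
  {δ : RealDivisor.{u, v} m M} {n : ℕ} {x : M} (c : δ.LocalChoice n x)

local notation "𝔼" => EuclideanSpace ℝ (Fin m)
local notation "ℝ²" => EuclideanSpace ℝ (Fin 2)

theorem isEmbeddedSubmanifold_divisorLocus (i : Fin n) :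
    IsEmbeddedSubmanifold m (c.divisorLocus i) 2 := (c.isLocalNormalCrossing.1 i).1.image_val

variable [IsManifold (𝓡 m) ∞ M] [T2Space M]

/-- Defining submersions `G i` of the divisors near a point of their intersection, and a smooth
right inverse of their joint differential in the chart. -/
theorem exists_submersions (hx : x ∈ δ.stratum n) :
    ∃ (G : Fin n → M → ℝ²) (Z : 𝔼 → (Fin n → ℝ²) →L[ℝ] 𝔼),
      (∀ᶠ y in 𝓝 x, ∀ i, ContMDiffAt (𝓡 m) (𝓡 2) ∞ (G i) y ∧
        Function.Surjective (mfderiv (𝓡 m) (𝓡 2) (G i) y) ∧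
        (y ∈ c.divisorLocus i ↔ G i y = 0)) ∧
      ∀ᶠ p in 𝓝 (extChartAt (𝓡 m) x x), ContDiffAt ℝ ∞ Z p ∧
        ∀ ξ i, fderiv ℝ (G i ∘ (extChartAt (𝓡 m) x).symm) p (Z p ξ) = ξ i := by
  have hxD := (c.mem_stratum_iff c.mem).1 hx
  choose G hG using fun i => (c.isEmbeddedSubmanifold_divisorLocus i).exists_submersion (hxD i)
  have hG := eventually_all.2 hG
  have hx0 := hG.self_of_nhds
  set φ := extChartAt (𝓡 m) x with hφ
  have hxs : x ∈ φ.source := mem_extChartAt_source x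
  set Γ : 𝔼 → Fin n → ℝ² := fun p i => G i (φ.symm p) with hΓ
  have hd : ∀ᶠ p in 𝓝 (φ x), ∀ i, ContDiffAt ℝ ∞ (G i ∘ φ.symm) p := by
    filter_upwards [eventually_extChartAt_symm x hxs hG, extChartAt_target_mem_nhds x]
      with p hp hpt i
    have h1 := (hp i).1.contDiffAt_comp_extChartAt_symm x (φ.map_target hpt)
    rwa [φ.right_inv hpt] at h1
  have hΓd : ∀ p, (∀ i, ContDiffAt ℝ ∞ (G i ∘ φ.symm) p) → ∀ v i,
      fderiv ℝ Γ p v i = fderiv ℝ (G i ∘ φ.symm) p v := by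
    intro p hp v i
    have h1 : HasFDerivAt Γ (ContinuousLinearMap.pi fun i => fderiv ℝ (G i ∘ φ.symm) p) p :=
      hasFDerivAt_pi.2 fun i => ((hp i).differentiableAt (by simp)).hasFDerivAt
    rw [h1.fderiv]
    rfl
  -- Lift each `ξ i` through its own submersion; transversality gives one vector congruent to all
  -- the lifts modulo the respective tangent spaces, which are the kernels.
  have hs : Function.Surjective (fderiv ℝ Γ (φ x)) := by
    intro ξ
    choose w hw using fun i => (hx0 i).2.1 (ξ i)
    obtain ⟨z, hz⟩ := c.isLocalNormalCrossing.2.1 c.point w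
    refine ⟨mfderiv (𝓡 m) 𝓘(ℝ, 𝔼) φ x z, funext fun i => ?_⟩
    refine (hΓd _ hd.self_of_nhds _ i).trans ?_
    refine (mfderiv_eq_fderiv_comp_mfderiv_extChartAt x hxs (hx0 i).1 z).symm.trans ?_
    have h1 := (c.mem_tangentTo_iff i _).2 (hz i (c.point_mem_locus hx i))
    have h2 := (mem_tangentSpaceOf_iff (hx0 i).1 (hx0 i).2.1 ((hx0 i).2.2.1 (hxD i))
      (hG.mono fun y hy => (hy i).2.2) _).1 h1
    exact (sub_eq_zero.1 ((map_sub _ _ _).symm.trans h2)).trans (hw i)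
  obtain ⟨Z, hZ⟩ := exists_contDiffAt_rightInverse
    (G := Γ) (hd.mono fun p hp => contDiffAt_pi.2 hp) hs
  refine ⟨G, Z, hG, ?_⟩
  filter_upwards [hZ, hd] with p hp hpd
  exact ⟨hp.1, fun ξ i => by rw [← hΓd p hpd, hp.2]⟩

end RealDivisor.LocalChoice

namespace RealDivisor

variable {m : ℕ} {M : Type u} [TopologicalSpace M] [ChartedSpace (EuclideanSpace ℝ (Fin m)) M]
  [IsManifold (𝓡 m) ∞ M] [T2Space M] {δ : RealDivisor.{u, v} m M}

local notation "ℝ²" => EuclideanSpace ℝ (Fin 2)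

/-- Locally the stratum is the intersection of the `n` loci, that is, the zero set of their joint
defining map, a submersion by transversality. -/
theorem IsElliptic.isEmbeddedSubmanifold_stratum (hδ : δ.IsElliptic) (n : ℕ) :
    IsEmbeddedSubmanifold m (δ.stratum n) (2 * n) := by
  intro x hx
  obtain ⟨c⟩ := exists_localChoice hδ hx
  obtain ⟨G, Z, hG, hZ⟩ := c.exists_submersions hx
  have hfin : Module.finrank ℝ (Fin n → ℝ²) =
      Module.finrank ℝ (EuclideanSpace ℝ (Fin (2 * n))) := by
    rw [Module.finrank_pi_fintype]
    simp [mul_comm]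
  let L : (Fin n → ℝ²) ≃L[ℝ] EuclideanSpace ℝ (Fin (2 * n)) :=
    ContinuousLinearEquiv.ofFinrankEq hfin
  set F : M → EuclideanSpace ℝ (Fin (2 * n)) := fun y => L fun i => G i y with hF
  have hxs : x ∈ (extChartAt (𝓡 m) x).source := mem_extChartAt_source x
  have hall : ∀ᶠ y in 𝓝 x, ContMDiffAt (𝓡 m) (𝓡 (2 * n)) ∞ F y ∧
      Function.Surjective (mfderiv (𝓡 m) (𝓡 (2 * n)) F y) ∧ (y ∈ δ.stratum n ↔ F y = 0) := by
    filter_upwards [hG, c.U.isOpen.mem_nhds c.mem, extChartAt_source_mem_nhds (I := 𝓡 m) x,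
      (continuousAt_extChartAt (I := 𝓡 m) x).eventually hZ] with y hy hyU hys hyZ
    have hFy : ContMDiffAt (𝓡 m) (𝓡 (2 * n)) ∞ F y :=
      (L.contDiff.contMDiff.contMDiffAt (x := fun i => G i y)).comp y
        (contMDiffAt_pi_space.2 fun i => (hy i).1)
    refine ⟨hFy, fun ξ => ?_, ?_⟩
    · obtain ⟨w, hw⟩ := (bijective_mfderiv_extChartAt x hys).2
        (Z (extChartAt (𝓡 m) x y) (L.symm ξ))
      refine ⟨w, (mfderiv_eq_fderiv_comp_mfderiv_extChartAt x hys hFy w).trans ?_⟩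
      rw [hw]
      have h1 : HasFDerivAt (F ∘ (extChartAt (𝓡 m) x).symm)
          ((L : (Fin n → ℝ²) →L[ℝ] _).comp (ContinuousLinearMap.pi fun i =>
            fderiv ℝ (G i ∘ (extChartAt (𝓡 m) x).symm) (extChartAt (𝓡 m) x y)))
          (extChartAt (𝓡 m) x y) :=
        L.hasFDerivAt.comp _ (hasFDerivAt_pi.2 fun i =>
          (((hy i).1.contDiffAt_comp_extChartAt_symm x hys).differentiableAt
            (by simp)).hasFDerivAt)
      rw [h1.fderiv]
      change L (fun i => fderiv ℝ (G i ∘ (extChartAt (𝓡 m) x).symm) (extChartAt (𝓡 m) x y)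
        (Z (extChartAt (𝓡 m) x y) (L.symm ξ))) = ξ
      simp only [hyZ.2]
      exact L.apply_symm_apply ξ
    · rw [c.mem_stratum_iff hyU, hF]
      simp only [(hy _).2.2, map_eq_zero_iff L L.injective, funext_iff, Pi.zero_apply]
  obtain ⟨V, hV, hVo, hxV⟩ := eventually_nhds_iff.1 hall
  refine ⟨V, F, hVo, hxV, fun y hy => (hV y hy).1.contMDiffWithinAt, fun y hy => (hV y hy).2.1, ?_⟩
  ext y
  exact ⟨fun ⟨h1, h2⟩ => ⟨h2, (hV y h2).2.2.1 h1⟩, fun ⟨h1, h2⟩ => ⟨(hV y h1).2.2.2 h2, h1⟩⟩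

end RealDivisor

/-! ### Smooth adapted frames. -/

namespace RealDivisor.LocalChoice

variable {m : ℕ} {M : Type u} [TopologicalSpace M] [ChartedSpace (EuclideanSpace ℝ (Fin m)) M]
  {δ : RealDivisor.{u, v} m M} {n : ℕ} {x : M} (c : δ.LocalChoice n x)

local notation "𝔼" => EuclideanSpace ℝ (Fin m)
local notation "ℝ²" => EuclideanSpace ℝ (Fin 2)

/-- The `i`-th function of a local choice, extended by zero. -/
noncomputable def extended (i : Fin n) : M → ℝ := Function.extend Subtype.val (c.f i) 0

theorem contMDiffAt_extended (i : Fin n) {y : M} (hy : y ∈ c.U) :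
    ContMDiffAt (𝓡 m) 𝓘(ℝ, ℝ) ∞ (c.extended i) y :=
  contMDiffAt_extend_val (y := ⟨y, hy⟩) (c.f i).contMDiff.contMDiffAt

variable [IsManifold (𝓡 m) ∞ M]

theorem contDiffAt_fderiv_fderiv_extended (i : Fin n) {x₀ : M}
    (hs : x ∈ (extChartAt (𝓡 m) x₀).source) :
    ContDiffAt ℝ ∞ (fderiv ℝ (fderiv ℝ (c.extended i ∘ (extChartAt (𝓡 m) x₀).symm)))
      (extChartAt (𝓡 m) x₀ x) :=
  (((c.contMDiffAt_extended i c.mem).contDiffAt_comp_extChartAt_symm x₀ hs).fderiv_right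
    (m := ∞) (by simp)).fderiv_right (m := ∞) (by simp)

variable [T2Space M]

theorem mfderiv_extended (hx : x ∈ δ.stratum n) (i : Fin n) :
    mfderiv (𝓡 m) 𝓘(ℝ, ℝ) (c.extended i) x = 0 := by
  ext w
  refine (mfderiv_comp_val (y := c.point) (c.contMDiffAt_extended i c.mem) w).symm.trans ?_
  rw [extended, extend_val_apply, ((c.isLocalNormalCrossing.1 i).of_associated
    (associated_localRep_of_ideal_eq_span (c.ideal_eq i) _) (c.point_mem_locus hx i)).1]
  rfl

/-- Expressing the Hessian in the fixed chart at `x₀` makes it the value of a smooth family of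
forms, to which Gram–Schmidt applies smoothly. -/
theorem hess_eq (hx : x ∈ δ.stratum n) (i : Fin n) {x₀ : M}
    (hs : x ∈ (extChartAt (𝓡 m) x₀).source) (w w' : TangentSpace (𝓡 m) x) :
    c.hess i w w' = fderiv ℝ (fderiv ℝ (c.extended i ∘ (extChartAt (𝓡 m) x₀).symm))
      (extChartAt (𝓡 m) x₀ x) (mfderiv (𝓡 m) 𝓘(ℝ, 𝔼) (extChartAt (𝓡 m) x₀) x w)
      (mfderiv (𝓡 m) 𝓘(ℝ, 𝔼) (extChartAt (𝓡 m) x₀) x w') := by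
  rw [← hessianAt_eq_of_critical x₀ hs (c.contMDiffAt_extended i c.mem) (c.mfderiv_extended hx i)]
  refine Eq.trans ?_ (hessianAt_comp_val (c.extended i) c.point w w')
  rw [extended, extend_val_apply]
  rfl

/-- Smooth vector fields that are orthonormal lifts at all the points of the stratum near `x`. -/
theorem exists_orthonormalLift (hx : x ∈ δ.stratum n) :
    ∃ (V : Set M) (s : Fin n × Fin 2 → ∀ y : M, TangentSpace (𝓡 m) y), IsOpen V ∧ x ∈ V ∧
      (∀ p, ContMDiffOn (𝓡 m) (𝓡 m).tangent ∞
        (fun y => (⟨y, s p y⟩ : TangentBundle (𝓡 m) M)) V) ∧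
      ∀ y ∈ δ.stratum n ∩ V, ∃ hy : y ∈ c.U,
        IsOrthonormalLift (c.move hy).tangentTo (c.move hy).hess fun p => s p y := by
  obtain ⟨G, Z, hG, hZ⟩ := c.exists_submersions hx
  have hxD := (c.mem_stratum_iff c.mem).1 hx
  set φ := extChartAt (𝓡 m) x with hφ
  have hxs : x ∈ φ.source := mem_extChartAt_source x
  set H : Fin n → 𝔼 → 𝔼 →L[ℝ] 𝔼 →L[ℝ] ℝ := fun i =>
    fderiv ℝ (fderiv ℝ (c.extended i ∘ φ.symm)) with hH
  -- These vectors are killed by the differentials of `G k` for `k ≠ i` and map to the standard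
  -- basis under that of `G i`. Along the stratum they therefore span the `i`-th normal summand, and
  -- Gram–Schmidt inside each pair preserves this.
  set z : Fin n → Fin 2 → 𝔼 → 𝔼 := fun i a p => Z p (Pi.single i (EuclideanSpace.single a 1))
    with hz
  have hzG : ∀ p, (∀ ξ i, fderiv ℝ (G i ∘ φ.symm) p (Z p ξ) = ξ i) → ∀ i a,
      fderiv ℝ (G i ∘ φ.symm) p (z i a p) = EuclideanSpace.single a 1 := by
    intro p hp i a
    rw [hz, hp, Pi.single_eq_same]
  have hpos : ∀ i v, fderiv ℝ (G i ∘ φ.symm) (φ x) v ≠ 0 → 0 < H i (φ x) v v := by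
    intro i v hv
    obtain ⟨w, rfl⟩ := (bijective_mfderiv_extChartAt x hxs).2 v
    have hGx := hG.self_of_nhds i
    rw [← c.hess_eq hx i hxs]
    refine (c.isNormalForm hx i).pos w fun hw => hv ?_
    rw [← mfderiv_eq_fderiv_comp_mfderiv_extChartAt x hxs hGx.1]
    exact (mem_tangentSpaceOf_iff hGx.1 hGx.2.1 (hGx.2.2.1 (hxD i))
      (hG.mono fun y hy => (hy i).2.2) _).1 hw
  have hpos0 : ∀ i, 0 < H i (φ x) (z i 0 (φ x)) (z i 0 (φ x)) := by
    intro i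
    refine hpos i _ ?_
    rw [hzG _ hZ.self_of_nhds.2]
    intro h
    simpa using congrArg (fun ξ : ℝ² => ξ 0) h
  have hpos1 : ∀ i, 0 < H i (φ x) (orthPart (H i (φ x)) (z i 0 (φ x)) (z i 1 (φ x)))
      (orthPart (H i (φ x)) (z i 0 (φ x)) (z i 1 (φ x))) := by
    intro i
    refine hpos i _ ?_
    rw [orthPart, map_sub, map_smul, hzG _ hZ.self_of_nhds.2, hzG _ hZ.self_of_nhds.2]
    intro h
    simpa using congrArg (fun ξ : ℝ² => ξ 1) h
  have hHs : ∀ᶠ y in 𝓝 x, ∀ i, ContDiffAt ℝ ∞ (H i) (φ y) := by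
    filter_upwards [c.U.isOpen.mem_nhds c.mem, extChartAt_source_mem_nhds (I := 𝓡 m) x]
      with y hyU hys i using (c.move hyU).contDiffAt_fderiv_fderiv_extended i hys
  have hzs : ∀ p, ContDiffAt ℝ ∞ Z p → ∀ i a, ContDiffAt ℝ ∞ (z i a) p := fun p hp i a =>
    hp.clm_apply contDiffAt_const
  have hxH := hHs.self_of_nhds
  have hxz := hzs _ hZ.self_of_nhds.1
  have hcont : Tendsto φ (𝓝 x) (𝓝 (φ x)) := continuousAt_extChartAt (I := 𝓡 m) x
  have hpos' : ∀ᶠ y in 𝓝 x, ∀ i, 0 < H i (φ y) (z i 0 (φ y)) (z i 0 (φ y)) ∧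
      0 < H i (φ y) (orthPart (H i (φ y)) (z i 0 (φ y)) (z i 1 (φ y)))
      (orthPart (H i (φ y)) (z i 0 (φ y)) (z i 1 (φ y))) := by
    refine hcont.eventually (p := fun p => ∀ i, 0 < H i p (z i 0 p) (z i 0 p) ∧
      0 < H i p (orthPart (H i p) (z i 0 p) (z i 1 p)) (orthPart (H i p) (z i 0 p) (z i 1 p)))
      (eventually_all.2 fun i => ?_)
    have ho := contDiffAt_orthPart (hxH i) (hxz i 0) (hxz i 1) (hpos0 i).ne'
    exact ((((hxH i).clm_apply (hxz i 0)).clm_apply (hxz i 0)).continuousAt.eventually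
      (lt_mem_nhds (hpos0 i))).and
      ((((hxH i).clm_apply ho).clm_apply ho).continuousAt.eventually (lt_mem_nhds (hpos1 i)))
  choose s hs using fun p : Fin n × Fin 2 => exists_vectorField (m := m) x
    fun q => orthonormalPair (H p.1 q) (z p.1 0 q) (z p.1 1 q) p.2
  have hU : ∀ᶠ y in 𝓝 x, y ∈ c.U := c.U.isOpen.mem_nhds c.mem
  have hsrc : ∀ᶠ y in 𝓝 x, y ∈ φ.source := extChartAt_source_mem_nhds (I := 𝓡 m) x
  -- Identifying the tangent space at `y` with a kernel needs the properties of `G` in a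
  -- neighbourhood of `y`, hence the iterated `eventually`.
  obtain ⟨V, hV, hVo, hxV⟩ := eventually_nhds_iff.1 ((((eventually_eventually_nhds.2 hG).and
    (hcont.eventually hZ)).and (hHs.and hpos')).and
    (hU.and hsrc))
  refine ⟨V, s, hVo, hxV, fun p y hy => ?_, ?_⟩
  · obtain ⟨⟨⟨-, hyZ⟩, hyH, hyp⟩, -, hys⟩ := hV y hy
    exact ((hs p y hys).2 (contDiffAt_orthonormalPair (hyH p.1) (hzs _ hyZ.1 _ _)
      (hzs _ hyZ.1 _ _) (hyp p.1).1 (hyp p.1).2 p.2)).contMDiffWithinAt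
  · rintro y ⟨hyS, hy⟩
    obtain ⟨⟨⟨hyG, hyZ⟩, hyH, hyp⟩, hyU, hys⟩ := hV y hy
    have hyD := (c.mem_stratum_iff hyU).1 hyS
    refine ⟨hyU, fun i k hk a => ?_, fun i a b => ?_⟩
    · have hGy := hyG.self_of_nhds k
      refine (mem_tangentSpaceOf_iff hGy.1 hGy.2.1 (hGy.2.2.1 (hyD k))
        (hyG.mono fun y hy => (hy k).2.2) _).2 ?_
      refine (mfderiv_eq_fderiv_comp_mfderiv_extChartAt x hys hGy.1 _).trans ?_
      rw [(hs (i, a) y hys).1]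
      have hker : ∀ b, z i b (φ y) ∈ LinearMap.ker
          (fderiv ℝ (G k ∘ φ.symm) (φ y) : 𝔼 →ₗ[ℝ] ℝ²) := fun b =>
        (hyZ.2 _ k).trans (Pi.single_eq_of_ne hk _)
      exact orthonormalPair_mem (hker 0) (hker 1) a
    · rw [(c.move hyU).hess_eq hyS i hys, (hs (i, a) y hys).1, (hs (i, b) y hys).1]
      refine orthonormalPair_apply (fun v w => ?_) (hyp i).1 (hyp i).2 a b
      exact (((c.contMDiffAt_extended i hyU).contDiffAt_comp_extChartAt_symm x
        hys).isSymmSndFDerivAt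
        (by rw [minSmoothness_of_isRCLikeNormedField]; exact two_le_smooth)) v w

/-- An orthonormal lift projects to an adapted frame of the normal space of the stratum. -/
theorem exists_isAdapted (hδ : δ.IsElliptic) (hx : x ∈ δ.stratum n)
    {z : Fin n × Fin 2 → TangentSpace (𝓡 m) x} (hz : IsOrthonormalLift c.tangentTo c.hess z) :
    ∃ u : Module.Basis (Fin n × Fin 2) ℝ (NormalFibre m (δ.stratum n) x),
      c.IsAdapted u ∧ ∀ p, u p = (tangentSpaceOf m (δ.stratum n) x).mkQ (z p) := by
  have hli := hz.linearIndependent (c.isNormalForm hx) c.tangentSpaceOf_stratum_le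
  have : FiniteDimensional ℝ (TangentSpace (𝓡 m) x) := inferInstanceAs (FiniteDimensional ℝ 𝔼)
  -- The `2n` independent classes span because the stratum has codimension `2n`.
  have hspan := hli.span_eq_top_of_card_eq_finrank' (by
    rw [((hδ.isEmbeddedSubmanifold_stratum n).finrank_normalFibre hx :)]
    simp [mul_comm])
  set u : Module.Basis (Fin n × Fin 2) ℝ (NormalFibre m (δ.stratum n) x) :=
    Module.Basis.mk hli hspan.ge
  have hu : ∀ p, u p = (tangentSpaceOf m (δ.stratum n) x).mkQ (z p) := fun p =>
    Module.Basis.mk_apply hli hspan.ge p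
  exact ⟨u, c.isAdapted_iff.2 ⟨z, hz, hu⟩, hu⟩

theorem exists_isAdapted_frame (hδ : δ.IsElliptic) (hx : x ∈ δ.stratum n) :
    ∃ u : Module.Basis (Fin n × Fin 2) ℝ (NormalFibre m (δ.stratum n) x), c.IsAdapted u := by
  obtain ⟨V, s, -, hxV, -, hs⟩ := c.exists_orthonormalLift hx
  obtain ⟨hxU, hz⟩ := hs x ⟨hx, hxV⟩
  obtain ⟨u, hu, -⟩ := c.exists_isAdapted hδ hx hz
  exact ⟨u, hu⟩

end RealDivisor.LocalChoice

theorem mainTheorem4 {m : ℕ} {M : Type u} [TopologicalSpace M] [T2Space M]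
    [SecondCountableTopology M] [ChartedSpace (EuclideanSpace ℝ (Fin m)) M]
    [IsManifold (𝓡 m) ∞ M] (δ : RealDivisor.{u, v} m M) (hδ : δ.IsElliptic) (n : ℕ)
    (hn : δ.HasIntersectionNumber n) :
    IsEmbeddedSubmanifold m (δ.stratum n) (2 * n) ∧
    Function.Injective (wreathHom n) ∧
    IsStructureGroupReduction (δ.stratum n) (wreathHom n).range (δ.adaptedFrames n) ∧
    (∀ x ∈ δ.stratum n, ∀ c : δ.LocalChoice n x,
      ∃ u : Module.Basis (Fin n × Fin 2) ℝ (NormalFibre m (δ.stratum n) x), c.IsAdapted u ∧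
        δ.adaptedFrames n x =
          {w | ∃ g : WreathConformal n, IsFrameTranslate u (wreathHom n g) w}) := by
  refine ⟨hδ.isEmbeddedSubmanifold_stratum n, wreathHom_injective n,
    ⟨fun x hx => ?_, fun x hx u hu w => ?_, fun x hx => ?_⟩, fun x hx c => ?_⟩
  · obtain ⟨c⟩ := RealDivisor.exists_localChoice hδ hx
    obtain ⟨u, hu⟩ := c.exists_isAdapted_frame hδ hx
    exact ⟨u, c, hu⟩
  · rw [RealDivisor.mem_adaptedFrames_iff hx hu]
    exact ⟨fun ⟨g, hg⟩ => ⟨_, ⟨g, rfl⟩, hg⟩, fun ⟨_, ⟨g, hg⟩, h⟩ => ⟨g, hg ▸ h⟩⟩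
  · obtain ⟨c⟩ := RealDivisor.exists_localChoice hδ hx
    obtain ⟨V, s, hV, hxV, hs, hlift⟩ := c.exists_orthonormalLift hx
    refine ⟨V, s, hV, hxV, hs, fun y hy => ?_⟩
    obtain ⟨hyU, hz⟩ := hlift y hy
    obtain ⟨u, hu, hus⟩ := (c.move hyU).exists_isAdapted hδ hy.1 hz
    exact ⟨u, ⟨_, hu⟩, hus⟩
  · obtain ⟨u, hu⟩ := c.exists_isAdapted_frame hδ hx
    exact ⟨u, hu, Set.ext (RealDivisor.mem_adaptedFrames_iff hx ⟨c, hu⟩)⟩
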